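/- Let $d\ge 5$ and let $\mu$ be a probability law on $\mathbb N=\{0,1,\dots\}$ with mean $\sum_i i\mu(i)=1$ and finite, positive variance. Let $\mathcal T$ be the random infinite tree in which the root has $i$ offspring with probability $\mu(i-1)$ for $i\ge 1$, the first one being special and the others normal; normal vertices have offspring law $\mu$; special vertices have offspring law $i\mu(i)$, and one offspring of each special vertex, chosen uniformly at random, is special, the others being normal (all choices independent). The root and the special vertices form the spine. The future $\mathcal T_+$ consists of the root $\emptyset$ and of the normal vertices to the right of the spine (the descendants of those normal offspring of spine vertices that come after the special one); the past $\mathcal T_-$ consists of all other vertices, i.e. the spine vertices other than the root and the normal vertices to the left of the spine. Let $d_i$ be the number of normal offspring, in the future, of the spine vertex at distance $i$ from the root. Let $(S_u)_{u\in\mathcal T}$ be the walk indexed by $\mathcal T$ with $S_\emptyset=0$, whose jumps along the edges are independent and uniform on the $2d$ neighbours of the origin of $\mathbb Z^d$, and let $\widetilde X_i$ be its position at the spine vertex at distance $i$ from the root. Let $(X_j)_{j\in\mathbb Z}$ be a two-sided simple random walk on $\mathbb Z^d$ with $X_0=0$; for $1\le n<\infty$ let $\xi_n^l,\xi_n^r$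 be geometric with parameter $1/n$, i.e. $\mathbb P(\xi=k)=\frac1n(1-\frac1n)^k$ for $k\ge 0$, and let $\xi_\infty^l=\xi_\infty^r=\infty$. The walk on $\mathcal T$ (tree and jumps), $X$, $\xi_n^l$ and $\xi_n^r$ are independent. Let $g(x,y)$ be the expected number of visits to $y$, time $0$ included, of a simple random walk started from $x$. For $1\le n\le\infty$, with $j$ and $k$ ranging over integers, put $$\mathcal A_n=\big\{\{S_u:u\in\mathcal T_-\}\cap\{X_j:-\xi_n^l\le j\le\xi_n^r\}=\emptyset\big\},\qquad e_n=\mathbf 1\{X_k\ne 0\text{ for all }1\le k\le\xi_n^r\},$$ $$\mathcal L_n=\sum_{-\xi_n^l\le j\le\xi_n^r}\ \sum_{u\in\mathcal T_+}\mathbf 1\{S_u=X_j\},\qquad N_n=\sum_{-\xi_n^l\le j\le\xi_n^r}\mathbf 1\{X_j=0\},$$ $$U_n=\sum_{-\xi_n^l\le j\le\xi_n^r}\ \sum_{i\ge 0}d_i\,g(X_j,\widetilde X_i),\qquad Z_n=\sum_{-\xi_n^l\le j\le\xi_n^r}\ \sum_{i\ge 0}d_i\,\mathbf 1\{X_j=\widetilde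 X_i\}.$$ **Lemma 2.6 and Corollary 2.7.** For every integer $n\ge 1$, one has $\mathbb E[\mathbf 1_{\mathcal A_n}\,e_n\,\mathcal L_n]=1$; moreover $Z_n\le U_n<\infty$ almost surely, and $\mathbb E[\mathbf 1_{\mathcal A_n}\,e_n\,(N_n+U_n-Z_n)]=1$. If $d\ge 7$, then also $Z_\infty\le U_\infty<\infty$ almost surely and $\mathbb E[\mathbf 1_{\mathcal A_\infty}\,e_\infty\,(N_\infty+U_\infty-Z_\infty)]=1$. -/

import Mathlib

open MeasureTheory ProbabilityTheory
open scoped ENNReal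

noncomputable section

namespace LawlerTree

/-! ### Offspring laws -/

/-- The size-biased law `i ↦ i * μ i` of a law `μ` on `ℕ` with mean one. -/
def sizeBiased (μ : PMF ℕ) (hμ : ∑' i : ℕ, (i : ℝ≥0∞) * μ i = 1) : PMF ℕ :=
  ⟨fun i => (i : ℝ≥0∞) * μ i, by
    have h := (ENNReal.summable (f := fun i : ℕ => (i : ℝ≥0∞) * μ i)).hasSum
    rwa [hμ] at h⟩

theorem antidiagonal_nonempty (m : ℕ) : (Finset.HasAntidiagonal.antidiagonal m).Nonempty :=
  ⟨(0, m), by simp⟩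

/-- Law of the pair `(a, b)`, where a special vertex has `N` offspring, `N` being size-biased,
one of them is chosen uniformly at random to be special, `a` offspring come before it
and `b` come after it, so that `a + b = N - 1`. (The value `N = 0` has probability zero.) -/
def specialLaw (μ : PMF ℕ) (hμ : ∑' i : ℕ, (i : ℝ≥0∞) * μ i = 1) : PMF (ℕ × ℕ) :=
  (sizeBiased μ hμ).bind fun N =>
    PMF.uniformOfFinset (Finset.HasAntidiagonal.antidiagonal (N - 1)) (antidiagonal_nonempty (N - 1))

/-- Law of the numbers (before, after) of normal offspring of the spine vertex at graph
distance `k` from the root. The root has `i` offspring with probability `μ (i - 1)`, the first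
being special, so that no normal offspring come before it and a `μ`-distributed number of them
come after it. -/
def spineLaw (μ : PMF ℕ) (hμ : ∑' i : ℕ, (i : ℝ≥0∞) * μ i = 1) : ℕ → PMF (ℕ × ℕ)
  | 0 => μ.map fun r => (0, r)
  | _ + 1 => specialLaw μ hμ

/-! ### Potential vertices of the infinite tree -/

/-- The two sides of the spine: left (past) and right (future). -/
inductive Side
  | past
  | future

/-- Label of a potential normal vertex. It belongs to the subtree of the `child`-th normal
offspring, on the given `side`, of the spine vertex at distance `stem` from the root, and is
reached from that offspring along `address`; the last generation is the head of the list. -/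
structure NormalVertex where
  side : Side
  stem : ℕ
  child : ℕ
  address : List ℕ

/-- Potential vertices: the spine vertices, indexed by their distance from the root, and the
normal vertices. The root is `spine 0`. -/
inductive Vertex
  | spine (k : ℕ)
  | normal (v : NormalVertex)

/-- Points of the lattice `ℤ^d`. -/
abbrev Site (d : ℕ) := Fin d → ℤ

/-- The marks from which the tree and the walk indexed by it are built:
the numbers (before, after) of normal offspring of the spine vertices, the numbers of offspring
of the normal vertices, and the spatial jump from its parent of each vertex other than the root
(the mark of the root is not used). -/
abbrev TreeData (d : ℕ) := (ℕ → ℕ × ℕ) × (NormalVertex → ℕ) × (Vertex → Site d)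

/-! ### Random walks -/

/-- Uniform law on the `2 d` neighbours `± e_i` of the origin. -/
def stepLaw (d : ℕ) [NeZero d] : PMF (Site d) :=
  (PMF.uniformOfFintype (Fin d × ℤˣ)).map fun p => Pi.single p.1 (p.2 : ℤ)

/-- Position at time `n` of the walk started from `x` with increments `s 0, s 1, …`. -/
def walk {d : ℕ} (x : Site d) (s : ℕ → Site d) (n : ℕ) : Site d :=
  x + ∑ k ∈ Finset.range n, s k

/-- Law of the increments of a simple random walk. -/
def stepsLaw (d : ℕ) [NeZero d] : Measure (ℕ → Site d) :=
  Measure.infinitePi fun _ => (stepLaw d).toMeasure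

/-- Indicator of a proposition. -/
def ind (p : Prop) : ℝ≥0∞ := by
  classical exact if p then 1 else 0

/-- Green's function of simple random walk:
the expected number of visits to `y` of the walk started from `x`, time zero included. -/
def green (d : ℕ) [NeZero d] (x y : Site d) : ℝ≥0∞ :=
  ∫⁻ s, ∑' n : ℕ, ind (walk x s n = y) ∂(stepsLaw d)

/-! ### The infinite tree and the walk indexed by it -/

namespace TreeData

variable {d : ℕ} (τ : TreeData d)

/-- Number of normal offspring, on a given side, of the spine vertex at distance `k`. -/
def spineOffspring : Side → ℕ → ℕ
  | .past, k => (τ.1 k).1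
  | .future, k => (τ.1 k).2

/-- Whether the potential normal vertex with the given label belongs to the tree. -/
def HasNormal (side : Side) (stem child : ℕ) : List ℕ → Prop
  | [] => child < τ.spineOffspring side stem
  | j :: u => HasNormal side stem child u ∧ j < τ.2.1 ⟨side, stem, child, u⟩

/-- The past of the tree: the spine vertices other than the root, and the normal vertices
to the left of the spine. -/
def past : Set Vertex
  | .spine k => k ≠ 0
  | .normal v => v.side = .past ∧ τ.HasNormal v.side v.stem v.child v.address

/-- The future of the tree: the root, and the normal vertices to the right of the spine. -/
def future : Set Vertex
  | .spine k => k = 0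
  | .normal v => v.side = .future ∧ τ.HasNormal v.side v.stem v.child v.address

/-- The walk indexed by the spine, started from `x`. -/
def spineWalk (x : Site d) (k : ℕ) : Site d :=
  walk x (fun i => τ.2.2 (.spine (i + 1))) k

/-- Position of the tree-indexed walk at a normal vertex. -/
def normalWalk (x : Site d) (side : Side) (stem child : ℕ) : List ℕ → Site d
  | [] => τ.spineWalk x stem + τ.2.2 (.normal ⟨side, stem, child, []⟩)
  | j :: u => normalWalk x side stem child u + τ.2.2 (.normal ⟨side, stem, child, j :: u⟩)

/-- The tree-indexed walk started from `x`: the position at a vertex is the position at its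
parent plus the jump attached to the vertex. -/
def treeWalk (x : Site d) : Vertex → Site d
  | .spine k => τ.spineWalk x k
  | .normal v => τ.normalWalk x v.side v.stem v.child v.address

/-- The range in the past of the tree-indexed walk started from `x`. -/
def pastRange (x : Site d) : Set (Site d) := τ.treeWalk x '' τ.past

/-- The local time at `x`, in the future (root included), of the tree-indexed walk started
from `y`. -/
def futureLocalTime (y x : Site d) : ℝ≥0∞ := ∑' u : τ.future, ind (τ.treeWalk y u = x)

end TreeData

/-! ### The tree-indexed walk together with a two-sided simple random walk -/

/-- Law of the marks: all of them are independent; normal vertices have `μ`-distributed numbers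
of offspring, and the jumps are uniform on the neighbours of the origin. -/
def treeLaw (d : ℕ) [NeZero d] (μ : PMF ℕ) (hμ : ∑' i : ℕ, (i : ℝ≥0∞) * μ i = 1) :
    Measure (TreeData d) :=
  (Measure.infinitePi fun k => (spineLaw μ hμ k).toMeasure).prod
    ((Measure.infinitePi fun _ => μ.toMeasure).prod
      (Measure.infinitePi fun _ => (stepLaw d).toMeasure))

/-- Marks of the tree, increments of the walk in positive times, and increments of the walk in
negative times. -/
abbrev Sample (d : ℕ) := TreeData d × (ℕ → Site d) × (ℕ → Site d)

/-- Law of the tree-indexed walk and of an independent two-sided simple random walk. -/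
def law (d : ℕ) [NeZero d] (μ : PMF ℕ) (hμ : ∑' i : ℕ, (i : ℝ≥0∞) * μ i = 1) :
    Measure (Sample d) :=
  (treeLaw d μ hμ).prod ((stepsLaw d).prod (stepsLaw d))

/-- Geometric law with parameter `1 / n`: the mass of `k` is `(1 / n) * (1 - 1 / n) ^ k`. -/
def geomLaw (n : ℕ) : Measure ℕ :=
  geometricMeasure ⟨(n : ℝ)⁻¹, inv_nonneg.2 (Nat.cast_nonneg n), Nat.cast_inv_le_one n⟩

/-- Law of the tree-indexed walk, of the two-sided walk, and of the times `ξ_n^l` and `ξ_n^r`,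
all of them independent. -/
def lawN (d : ℕ) [NeZero d] (μ : PMF ℕ) (hμ : ∑' i : ℕ, (i : ℝ≥0∞) * μ i = 1) (n : ℕ) :
    Measure (Sample d × ℕ × ℕ) :=
  (law d μ hμ).prod ((geomLaw n).prod (geomLaw n))

/-- The integers `j` with `-a ≤ j ≤ b`; the end points may be infinite. -/
def window (a b : ℕ∞) : Set ℤ :=
  {j | (((-j).toNat : ℕ) : ℕ∞) ≤ a ∧ ((j.toNat : ℕ) : ℕ∞) ≤ b}

variable {d : ℕ}

/-- The two-sided simple random walk `(X_j)`, `j ∈ ℤ`, with `X_0 = 0`. -/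
def X (ω : Sample d) (j : ℤ) : Site d :=
  if 0 ≤ j then walk 0 ω.2.1 j.toNat else walk 0 ω.2.2 (-j).toNat

/-- The event that the past of the tree-indexed walk started from the origin avoids the
two-sided walk between times `-a` and `b`. -/
def Avoids (ω : Sample d) (a b : ℕ∞) : Prop :=
  Disjoint (ω.1.pastRange 0) (X ω '' window a b)

/-- The event that the two-sided walk does not return to the origin between times `1` and `b`. -/
def NoReturn (ω : Sample d) (b : ℕ∞) : Prop :=
  ∀ k : ℕ, 1 ≤ k → (k : ℕ∞) ≤ b → X ω k ≠ 0

/-- The local time in the future of the tree-indexed walk, summed along the two-sided walk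
between times `-a` and `b`. -/
def L (ω : Sample d) (a b : ℕ∞) : ℝ≥0∞ :=
  ∑' j : window a b, ω.1.futureLocalTime 0 (X ω j)

/-- The number of visits to the origin of the two-sided walk between times `-a` and `b`. -/
def N (ω : Sample d) (a b : ℕ∞) : ℝ≥0∞ :=
  ∑' j : window a b, ind (X ω j = 0)

/-- The sum over `-a ≤ j ≤ b` and `i ≥ 0` of `d_i * g (X_j, X̃_i)`, where `X̃` is the walk on the
spine and `d_i` is the number of (normal) offspring, in the future, of its `i`-th vertex. -/
def U [NeZero d] (ω : Sample d) (a b : ℕ∞) : ℝ≥0∞ :=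
  ∑' j : window a b, ∑' i : ℕ,
    (ω.1.spineOffspring .future i : ℝ≥0∞) * green d (X ω j) (ω.1.spineWalk 0 i)

/-- The sum over `-a ≤ j ≤ b` and `i ≥ 0` of `d_i * 1 {X_j = X̃_i}`. -/
def Z (ω : Sample d) (a b : ℕ∞) : ℝ≥0∞ :=
  ∑' j : window a b, ∑' i : ℕ,
    (ω.1.spineOffspring .future i : ℝ≥0∞) * ind (X ω j = ω.1.spineWalk 0 i)

end LawlerTree

end

/-!
Fix a finite set `K` and `y ∈ K`. Everything rests on the identity
`∑ x ∈ K, E[1{past of the tree rooted at x avoids K} * l(x, y)] = 1`, where `l(x, y)` is the local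
time at `y` of the future of the tree rooted at `x`, or its conditional mean given the spine
(`sum_lintegral_avoid_futureLocalTime`, `sum_lintegral_avoid_meanFutureLocalTime`). It is proved
by potential theory of simple random walk, without re-rooting the tree.

Let `P` be the transition operator of the walk (`avg`), `v z` the probability that a critical tree
whose root is a child of a vertex at `z` hits `K` (`hitProb`), and `w x` the probability that the
past of the tree rooted at `x` avoids `K` (`pastAvoidProb`). Let `φ z` be the probability that a
special vertex at `z` and its left subtrees avoid `K`, and `ψ z` the mean, on that event, of the
number of its offspring on the right (`leftWeight`, `leftRightWeight`). The choice of the special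
offspring, uniform after size-biasing, yields with geometric sums
`v = P (1_K + φ v)`, `w = P (φ w)` and `φ + ψ v = 1` off `K`, whatever the offspring law with mean
one (`hitProb_eq_avg`, `pastAvoidProb_eq`, `leftWeight_add_leftRightWeight`). As the offspring
law has mean one, a normal offspring of a spine vertex at `z` contributes on average `greenPos z y`
to the local time. The left-hand side of the identity is therefore a sum over walks weighted by `φ`
which start in `K`, end with a factor `ψ` and are followed by `w` and `greenPos`. Reversal in
time turns the sum over `x ∈ K` into `v`, and what remains is `w y` plus the Green potential at `y`
of the charge `1_K w + ψ v w = w - φ w`. Since `P w = w + P (w - φ w)`, summation along the walk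
started from `y` shows this to be the limit of `P ^ n w (y)` (`sum_weightedAvg_eq_one`). The limit
is one by transience, in the form `∑ (n + 1) p_n < ∞` for `d ≥ 5` (`exists_heat_le`,
`tendsto_avg_pastAvoidProb`); finiteness of the variance bounds the number of offspring of a spine
vertex.

To pass from `K` to the walk, take for `K` the range of a walk of `m + 1` points. A point of `K` is
the position of the walk at exactly one time that is the last visit to its position, and the event
that the two-sided walk does not return to the origin says that time zero is such a time. Summing
over `x ∈ K` and over the `m + 1` values of `y` along the walk shows that the `m + 1` windows
`[-a, b]` with `a + b = m` contribute `m + 1` altogether (`sum_windowMean`). Independent geometric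
times give the same weight to each of these windows, whence the two statements for finite `n`, the
second one because `N + U - Z` is the sum of the conditional means of the local times
(`N_add_U_sub_Z`). For `d ≥ 7`, `∑ (n + 1)² p_n < ∞` makes `U` integrable over the infinite window;
the contributions of the windows converge by dominated convergence, and their averages over
`a + b = m` are equal to one, so the limit is one (`windowMean_top_eq_one`).
-/

noncomputable section

namespace LawlerTree

open Function Filter Topology

/-! ### Product measures -/

section ProductMeasures

variable {ι κ κ' E : Type*} [MeasurableSpace E]

theorem measurePreserving_comp_infinitePi (μ : ι → Measure E) [∀ i, IsProbabilityMeasure (μ i)]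
    {f : κ → ι} (hf : Injective f) :
    MeasurePreserving (fun (ω : ι → E) k => ω (f k)) (Measure.infinitePi μ)
      (Measure.infinitePi fun k => μ (f k)) := by
  refine ⟨by fun_prop, Measure.eq_infinitePi _ fun s t ht => ?_⟩
  have hext : ∀ k, extend f t (fun _ => Set.univ) (f k) = t k := fun k => hf.extend_apply _ _ _
  have hpre : (fun (ω : ι → E) k => ω (f k)) ⁻¹' (Set.pi s t)
      = Set.pi (s.map ⟨f, hf⟩) (extend f t fun _ => Set.univ) := by
    ext ω
    simp [Set.mem_pi, hext]
  rw [Measure.map_apply (by fun_prop) (MeasurableSet.pi s.countable_toSet fun i _ => ht i), hpre,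
    Measure.infinitePi_pi]
  · simp [hext]
  · intro i hi
    obtain ⟨k, -, rfl⟩ := Finset.mem_map.1 hi
    simpa [hext] using ht k

theorem measurePreserving_sumElim_infinitePi (μ : κ → Measure E) (ν : κ' → Measure E)
    [∀ i, IsProbabilityMeasure (μ i)] [∀ i, IsProbabilityMeasure (ν i)] :
    MeasurePreserving (fun p : (κ → E) × (κ' → E) => Sum.elim p.1 p.2)
      ((Measure.infinitePi μ).prod (Measure.infinitePi ν))
      (Measure.infinitePi (Sum.elim μ ν)) := by
  have hm : Measurable (fun p : (κ → E) × (κ' → E) => (Sum.elim p.1 p.2 : κ ⊕ κ' → E)) := by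
    refine measurable_pi_iff.2 ?_
    rintro (i | i) <;> simp only [Sum.elim_inl, Sum.elim_inr] <;> fun_prop
  have : ∀ i, IsProbabilityMeasure (Sum.elim μ ν i) := by
    rintro (i | i) <;> simp only [Sum.elim_inl, Sum.elim_inr] <;> infer_instance
  refine ⟨hm, Measure.eq_infinitePi _ fun s t ht => ?_⟩
  have hpre : (fun p : (κ → E) × (κ' → E) => (Sum.elim p.1 p.2 : κ ⊕ κ' → E)) ⁻¹' (Set.pi s t)
      = (Set.pi s.toLeft fun i => t (.inl i)) ×ˢ (Set.pi s.toRight fun i => t (.inr i)) := by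
    ext p
    simp [Set.mem_pi]
  rw [Measure.map_apply hm (MeasurableSet.pi s.countable_toSet fun i _ => ht i), hpre,
    Measure.prod_prod, Measure.infinitePi_pi _ fun i _ => ht _,
    Measure.infinitePi_pi _ fun i _ => ht _]
  conv_rhs => rw [← s.toLeft_disjSum_toRight, Finset.prod_disjSum]
  simp

/-- The coordinates with indices in two disjoint sets are independent: reading them off gives a
sample of a product of two product measures. -/
theorem measurePreserving_split_infinitePi (μ : ι → Measure E) [∀ i, IsProbabilityMeasure (μ i)]
    {f : κ → ι} {g : κ' → ι} (hf : Injective f) (hg : Injective g) (hfg : ∀ a b, f a ≠ g b) :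
    MeasurePreserving (fun ω : ι → E => (⟨fun k => ω (f k), fun k => ω (g k)⟩ : (κ → E) × (κ' → E)))
      (Measure.infinitePi μ)
      ((Measure.infinitePi fun k => μ (f k)).prod (Measure.infinitePi fun k => μ (g k))) := by
  have h1 := measurePreserving_comp_infinitePi μ (hf.sumElim hg hfg)
  have h2 := measurePreserving_sumElim_infinitePi (fun k => μ (f k)) (fun k => μ (g k))
  have h0 : (fun k => μ (Sum.elim f g k)) = Sum.elim (fun k => μ (f k)) (fun k => μ (g k)) := by
    ext (k | k) <;> rfl
  rw [h0] at h1
  have hm : Measurable (fun p : κ ⊕ κ' → E =>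
      (⟨fun k => p (.inl k), fun k => p (.inr k)⟩ : (κ → E) × (κ' → E))) := by fun_prop
  refine ⟨by fun_prop, ?_⟩
  have h3 : (fun ω : ι → E => (⟨fun k => ω (f k), fun k => ω (g k)⟩ : (κ → E) × (κ' → E)))
      = (fun p : κ ⊕ κ' → E => (⟨fun k => p (.inl k), fun k => p (.inr k)⟩ : (κ → E) × (κ' → E)))
        ∘ fun ω k => ω (Sum.elim f g k) := rfl
  rw [h3, ← Measure.map_map hm h1.measurable, h1.map_eq, ← h2.map_eq,
    Measure.map_map hm h2.measurable]
  exact Measure.map_id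

/-- Integration of a function of one coordinate and of a family of other coordinates. -/
theorem lintegral_infinitePi_split_one (μ : ι → Measure E) [∀ i, IsProbabilityMeasure (μ i)]
    {i : ι} {g : κ → ι} (hg : Injective g) (hi : ∀ b, i ≠ g b)
    {F : E → (κ → E) → ℝ≥0∞} (hF : Measurable (uncurry F)) :
    ∫⁻ ω, F (ω i) (fun k => ω (g k)) ∂(Measure.infinitePi μ)
      = ∫⁻ e, ∫⁻ ω, F e ω ∂(Measure.infinitePi fun k => μ (g k)) ∂(μ i) := by
  have h := measurePreserving_split_infinitePi μ (f := fun _ : Unit => i)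
    (injective_of_subsingleton _) hg (fun _ => hi)
  have h1 : ∫⁻ ω, F (ω i) (fun k => ω (g k)) ∂(Measure.infinitePi μ)
      = ∫⁻ p : (Unit → E) × (κ → E), F (p.1 ()) p.2 ∂((Measure.infinitePi fun _ : Unit => μ i).prod
        (Measure.infinitePi fun k => μ (g k))) :=
    h.lintegral_comp (f := fun p : (Unit → E) × (κ → E) => F (p.1 ()) p.2)
      (hF.comp (by fun_prop : Measurable fun p : (Unit → E) × (κ → E) => (p.1 (), p.2)))
  have h2 : AEMeasurable (fun p : (Unit → E) × (κ → E) => F (p.1 ()) p.2)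
      ((Measure.infinitePi fun _ : Unit => μ i).prod (Measure.infinitePi fun k => μ (g k))) :=
    (hF.comp (by fun_prop : Measurable fun p : (Unit → E) × (κ → E) => (p.1 (), p.2))).aemeasurable
  rw [h1, lintegral_prod _ h2]
  exact (measurePreserving_eval_infinitePi (fun _ : Unit => μ i) ()).lintegral_comp
    (f := fun e => ∫⁻ ω, F e ω ∂(Measure.infinitePi fun k => μ (g k)))
    hF.lintegral_prod_right'

end ProductMeasures

/-! ### Indicators and averages over the neighbours -/

section Average

@[simp] theorem ind_true : ind True = 1 := by simp [ind]
@[simp] theorem ind_false : ind False = 0 := by simp [ind]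

theorem ind_of {p : Prop} (h : p) : ind p = 1 := by simp [ind, h]
theorem ind_of_not {p : Prop} (h : ¬p) : ind p = 0 := by simp [ind, h]

theorem ind_le_one (p : Prop) : ind p ≤ 1 := by
  by_cases h : p <;> simp [h]

theorem ind_and (p q : Prop) : ind (p ∧ q) = ind p * ind q := by
  by_cases h : p <;> by_cases h' : q <;> simp [h, h']

theorem ind_add_ind_not (p : Prop) : ind p + ind (¬p) = 1 := by
  by_cases h : p <;> simp [h]

theorem measurable_ind {α : Type*} [MeasurableSpace α] {p : α → Prop}
    (hp : MeasurableSet {a | p a}) : Measurable fun a => ind (p a) := by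
  have : (fun a => ind (p a)) = Set.indicator {a | p a} 1 := by
    ext a
    by_cases h : p a <;> simp [h]
  rw [this]
  exact measurable_one.indicator hp

theorem measurable_ind_not {α : Type*} [MeasurableSpace α] {p : α → Prop}
    (hp : MeasurableSet {a | p a}) : Measurable fun a => ind (¬p a) :=
  measurable_ind ((congrArg MeasurableSet (by ext; simp)).mp hp.compl)

theorem measurable_site {d : ℕ} {β : Type*} [MeasurableSpace β] (f : Site d → β) : Measurable f :=
  measurable_of_countable f

variable {d : ℕ} [NeZero d]

/-- The mean of `f` over the neighbours of a site. -/
def avg (f : Site d → ℝ≥0∞) (x : Site d) : ℝ≥0∞ := ∫⁻ s, f (x + s) ∂(stepLaw d).toMeasure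

theorem avg_eq_tsum (f : Site d → ℝ≥0∞) (x : Site d) :
    avg f x = ∑' s, stepLaw d s * f (x + s) := by
  rw [avg, lintegral_countable']
  simp [PMF.toMeasure_apply_singleton, mul_comm]

theorem stepLaw_apply (s : Site d) :
    stepLaw d s = ∑ p : Fin d × ℤˣ, if s = Pi.single p.1 (p.2 : ℤ) then (d * 2 : ℝ≥0∞)⁻¹ else 0 := by
  rw [stepLaw, PMF.map_apply, tsum_fintype]
  simp

theorem avg_eq_sum (f : Site d → ℝ≥0∞) (x : Site d) :
    avg f x = (d : ℝ≥0∞)⁻¹ * ∑ i : Fin d,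
      (f (x + Pi.single i 1) + f (x + Pi.single i (-1))) / 2 := by
  simp only [avg_eq_tsum, stepLaw_apply, Finset.sum_mul, ite_mul, zero_mul]
  rw [Summable.tsum_finsetSum fun _ _ => ENNReal.summable]
  simp only [tsum_ite_eq]
  rw [Fintype.sum_prod_type, Finset.mul_sum]
  refine Finset.sum_congr rfl fun i _ => ?_
  rw [Fintype.sum_eq_add (1 : ℤˣ) (-1) (by decide)]
  · push_cast
    rw [ENNReal.mul_inv (by simp) (by simp), ENNReal.div_eq_inv_mul]
    ring
  · intro u hu
    rcases Int.units_eq_one_or u with h | h <;> simp [h] at hu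

theorem stepLaw_neg (s : Site d) : stepLaw d (-s) = stepLaw d s := by
  rw [stepLaw_apply, stepLaw_apply]
  refine Fintype.sum_equiv ((Equiv.refl (Fin d)).prodCongr (Equiv.neg ℤˣ)) _ _ fun p => ?_
  simp [neg_eq_iff_eq_neg, Pi.single_neg]

theorem avg_mono {f g : Site d → ℝ≥0∞} (h : ∀ x, f x ≤ g x) (x : Site d) : avg f x ≤ avg g x :=
  lintegral_mono fun _ => h _

theorem avg_add (f g : Site d → ℝ≥0∞) (x : Site d) :
    avg (fun z => f z + g z) x = avg f x + avg g x :=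
  lintegral_add_left (measurable_site _) _

theorem avg_const (c : ℝ≥0∞) (x : Site d) : avg (fun _ => c) x = c := by
  simp [avg]

theorem avg_const_mul (c : ℝ≥0∞) (f : Site d → ℝ≥0∞) (x : Site d) :
    avg (fun z => c * f z) x = c * avg f x :=
  lintegral_const_mul _ (measurable_site _)

theorem avg_tsum {ι : Type*} [Countable ι] (f : ι → Site d → ℝ≥0∞) (x : Site d) :
    avg (fun z => ∑' i, f i z) x = ∑' i, avg (f i) x :=
  lintegral_tsum fun _ => (measurable_site _).aemeasurable

theorem avg_sum {ι : Type*} (s : Finset ι) (f : ι → Site d → ℝ≥0∞) (x : Site d) :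
    avg (fun z => ∑ i ∈ s, f i z) x = ∑ i ∈ s, avg (f i) x :=
  lintegral_finsetSum _ fun _ _ => measurable_site _

theorem avg_adjoint (f g : Site d → ℝ≥0∞) : ∑' x, f x * avg g x = ∑' x, avg f x * g x := by
  simp only [avg_eq_tsum, ← ENNReal.tsum_mul_left, ← ENNReal.tsum_mul_right]
  rw [ENNReal.tsum_comm, ENNReal.tsum_comm (f := fun x s => stepLaw d s * f (x + s) * g x),
    ← (Equiv.neg (Site d)).tsum_eq]
  refine tsum_congr fun s => ?_
  rw [← (Equiv.addRight s).tsum_eq]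
  refine tsum_congr fun x => ?_
  simp [stepLaw_neg]
  ring

end Average

/-! ### Iterated averages and Green's function -/

section Green

theorem measurable_walk {d : ℕ} (x : Site d) (n : ℕ) : Measurable fun s : ℕ → Site d => walk x s n := by
  unfold walk
  fun_prop

theorem walk_succ {d : ℕ} (x : Site d) (s : ℕ → Site d) (n : ℕ) :
    walk x s (n + 1) = walk (x + s 0) (fun k => s (k + 1)) n := by
  rw [walk, walk, Finset.sum_range_succ', add_assoc, add_comm (s 0)]

variable {d : ℕ} [NeZero d]

theorem avg_iterate_mono {f g : Site d → ℝ≥0∞} (h : ∀ x, f x ≤ g x) (n : ℕ) (x : Site d) :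
    avg^[n] f x ≤ avg^[n] g x := by
  induction n generalizing x with
  | zero => exact h x
  | succ n ih =>
    rw [iterate_succ_apply', iterate_succ_apply']
    exact avg_mono ih x

theorem avg_iterate_add (f g : Site d → ℝ≥0∞) (n : ℕ) (x : Site d) :
    avg^[n] (fun z => f z + g z) x = avg^[n] f x + avg^[n] g x := by
  induction n generalizing x with
  | zero => rfl
  | succ n ih =>
    simp only [iterate_succ_apply', ← avg_add]
    congr 1
    exact funext ih

theorem avg_iterate_const_mul (c : ℝ≥0∞) (f : Site d → ℝ≥0∞) (n : ℕ) (x : Site d) :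
    avg^[n] (fun z => c * f z) x = c * avg^[n] f x := by
  induction n generalizing x with
  | zero => rfl
  | succ n ih =>
    simp only [iterate_succ_apply', ← avg_const_mul]
    congr 1
    exact funext ih

theorem avg_iterate_const (c : ℝ≥0∞) (n : ℕ) (x : Site d) : avg^[n] (fun _ => c) x = c := by
  induction n generalizing x with
  | zero => rfl
  | succ n ih =>
    rw [iterate_succ_apply', funext ih, avg_const]

theorem avg_iterate_tsum {ι : Type*} [Countable ι] (f : ι → Site d → ℝ≥0∞) (n : ℕ) (x : Site d) :
    avg^[n] (fun z => ∑' i, f i z) x = ∑' i, avg^[n] (f i) x := by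
  induction n generalizing x with
  | zero => rfl
  | succ n ih =>
    simp only [iterate_succ_apply', ← avg_tsum]
    congr 1
    exact funext ih

theorem avg_iterate_sum {ι : Type*} (s : Finset ι) (f : ι → Site d → ℝ≥0∞) (n : ℕ) (x : Site d) :
    avg^[n] (fun z => ∑ i ∈ s, f i z) x = ∑ i ∈ s, avg^[n] (f i) x := by
  induction n generalizing x with
  | zero => rfl
  | succ n ih =>
    simp only [iterate_succ_apply', ← avg_sum]
    congr 1
    exact funext ih

theorem avg_iterate_adjoint (f g : Site d → ℝ≥0∞) (n : ℕ) :
    ∑' x, f x * avg^[n] g x = ∑' x, avg^[n] f x * g x := by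
  induction n generalizing g with
  | zero => rfl
  | succ n ih => rw [iterate_succ_apply, ih, avg_adjoint, iterate_succ_apply']

theorem avg_translate (f : Site d → ℝ≥0∞) (z x : Site d) :
    avg (fun y => f (y + z)) x = avg f (x + z) := by
  simp only [avg, add_right_comm]

theorem avg_iterate_translate (f : Site d → ℝ≥0∞) (z : Site d) (n : ℕ) (x : Site d) :
    avg^[n] (fun y => f (y + z)) x = avg^[n] f (x + z) := by
  induction n generalizing x with
  | zero => rfl
  | succ n ih => rw [iterate_succ_apply', iterate_succ_apply', funext ih, avg_translate]

theorem tsum_ind_mul {α : Type*} (f : α → ℝ≥0∞) (y : α) : ∑' x, ind (x = y) * f x = f y := by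
  rw [tsum_eq_single y fun x hx => by simp [ind_of_not hx]]
  simp

/-- The probability that simple random walk started from `x` is at `y` at time `n`. -/
def heat (n : ℕ) (x y : Site d) : ℝ≥0∞ := avg^[n] (fun z => ind (z = y)) x

theorem heat_zero (x y : Site d) : heat 0 x y = ind (x = y) := rfl

theorem tsum_mul_heat (f : Site d → ℝ≥0∞) (n : ℕ) (y : Site d) :
    ∑' x, f x * heat n x y = avg^[n] f y := by
  unfold heat
  rw [avg_iterate_adjoint]
  simp_rw [mul_comm (avg^[n] f _)]
  exact tsum_ind_mul _ _

theorem heat_comm (n : ℕ) (x y : Site d) : heat n x y = heat n y x := by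
  rw [← tsum_ind_mul (fun z => heat n z y) x, tsum_mul_heat]
  rfl

theorem avg_iterate_heat (m n : ℕ) (x y : Site d) :
    avg^[m] (fun z => heat n z y) x = heat (m + n) x y := by
  unfold heat
  rw [iterate_add_apply]

theorem heat_add_right (n : ℕ) (x y z : Site d) : heat n (x + z) (y + z) = heat n x y := by
  unfold heat
  rw [← avg_iterate_translate]
  simp

theorem heat_eq_zero_right (n : ℕ) (x y : Site d) : heat n x y = heat n (x - y) 0 := by
  rw [← heat_add_right n (x - y) 0 y]
  simp

theorem lintegral_walk (f : Site d → ℝ≥0∞) (n : ℕ) (x : Site d) :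
    ∫⁻ s, f (walk x s n) ∂(stepsLaw d) = avg^[n] f x := by
  induction n generalizing x with
  | zero => simp [walk, stepsLaw]
  | succ n ih =>
    have hF : Measurable (uncurry fun (e : Site d) (s : ℕ → Site d) => f (walk (x + e) s n)) := by
      refine (measurable_site f).comp ?_
      unfold walk
      fun_prop
    simp only [walk_succ]
    rw [stepsLaw, lintegral_infinitePi_split_one (fun _ => (stepLaw d).toMeasure)
      (g := fun k : ℕ => k + 1) (add_left_injective 1) (fun b => (Nat.succ_ne_zero b).symm) hF]
    rw [iterate_succ_apply', avg]
    exact lintegral_congr fun e => ih _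

theorem green_eq_tsum (x y : Site d) : green d x y = ∑' n, heat n x y := by
  rw [green, lintegral_tsum (f := fun n s => ind (walk x s n = y)) fun n =>
    ((measurable_site fun z => ind (z = y)).comp (measurable_walk x n)).aemeasurable]
  exact tsum_congr fun n => lintegral_walk (fun z => ind (z = y)) n x

/-- The expected number of visits to `y`, time `0` excluded, of simple random walk started
from `x`. -/
def greenPos (x y : Site d) : ℝ≥0∞ := ∑' n, heat (n + 1) x y

theorem green_eq_add (x y : Site d) : green d x y = ind (x = y) + greenPos x y := by
  rw [green_eq_tsum, tsum_eq_zero_add' ENNReal.summable, heat_zero, greenPos]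

theorem green_comm (x y : Site d) : green d x y = green d y x := by
  simp only [green_eq_tsum, heat_comm]

theorem avg_iterate_green (n : ℕ) (x y : Site d) :
    avg^[n] (fun z => green d z y) x = ∑' k, heat (n + k) x y := by
  simp only [green_eq_tsum, avg_iterate_tsum, avg_iterate_heat]

theorem avg_green (x y : Site d) : avg (fun z => green d z y) x = greenPos x y := by
  have := avg_iterate_green 1 x y
  simpa [add_comm, greenPos] using this

theorem greenPos_add_right (x y z : Site d) : greenPos (x + z) (y + z) = greenPos x y := by
  simp only [greenPos, heat_add_right]

end Green

/-! ### The heat kernel bound -/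

section HeatKernel

/-- The probability that simple random walk on `ℤ` started from the origin is at `x` at
time `m`. -/
def lineHeat : ℕ → ℤ → ℝ
  | 0, x => if x = 0 then 1 else 0
  | m + 1, x => (lineHeat m (x + 1) + lineHeat m (x - 1)) / 2

theorem lineHeat_nonneg (m : ℕ) (x : ℤ) : 0 ≤ lineHeat m x := by
  induction m generalizing x with
  | zero => unfold lineHeat; split_ifs <;> simp
  | succ m ih =>
    unfold lineHeat
    linarith [ih (x + 1), ih (x - 1)]

/-- The binomial law; the odd sites are not reached at even times, and conversely. -/
theorem lineHeat_eq (m : ℕ) (j : ℤ) :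
    lineHeat m (2 * j - m) = (if 0 ≤ j then (m.choose j.toNat : ℝ) else 0) / 2 ^ m
      ∧ lineHeat m (2 * j - m + 1) = 0 := by
  induction m generalizing j with
  | zero =>
    constructor
    · rcases lt_trichotomy j 0 with h | h | h
      · simp [lineHeat, h.not_ge, h.ne]
      · simp [lineHeat, h]
      · obtain ⟨n, rfl⟩ := Int.eq_succ_of_zero_lt h
        simp [lineHeat]
        omega
    · simp [lineHeat]
      omega
  | succ m ih =>
    have e1 : 2 * j - ((m + 1 : ℕ) : ℤ) + 1 = 2 * j - m := by push_cast; ring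
    have e2 : 2 * j - ((m + 1 : ℕ) : ℤ) - 1 = 2 * (j - 1) - m := by push_cast; ring
    have e3 : 2 * j - ((m + 1 : ℕ) : ℤ) + 1 + 1 = 2 * j - m + 1 := by push_cast; ring
    have e4 : 2 * j - ((m + 1 : ℕ) : ℤ) + 1 - 1 = 2 * (j - 1) - m + 1 := by push_cast; ring
    refine ⟨?_, ?_⟩
    · rw [lineHeat, e1, e2, (ih j).1, (ih (j - 1)).1]
      rcases lt_trichotomy j 0 with h | h | h
      · rw [if_neg (by omega), if_neg (by omega), if_neg (by omega)]
        simp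
      · subst h
        simp [pow_succ]
        ring
      · obtain ⟨n, rfl⟩ := Int.eq_succ_of_zero_lt h
        have hn : ((n : ℤ) + 1 - 1).toNat = n := by simp
        have hn' : ((n : ℤ) + 1).toNat = n + 1 := by simp
        rw [if_pos (by omega), if_pos (by omega), if_pos (by omega), hn, hn',
          Nat.choose_succ_succ]
        push_cast
        rw [pow_succ]
        ring
    · rw [lineHeat, e3, e4, (ih j).2, (ih (j - 1)).2]
      simp

theorem centralBinom_sq_mul_le (n : ℕ) :
    (n.centralBinom : ℝ) ^ 2 * (2 * n + 1) ≤ (4 ^ n) ^ 2 := by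
  induction n with
  | zero => simp
  | succ n ih =>
    have h : ((n : ℝ) + 1) * (n + 1).centralBinom = 2 * (2 * n + 1) * n.centralBinom := by
      exact_mod_cast Nat.succ_mul_centralBinom_succ n
    have h2 : ((n : ℝ) + 1) ^ 2 * (((n + 1).centralBinom : ℝ) ^ 2 * (2 * (n + 1) + 1))
        ≤ ((n : ℝ) + 1) ^ 2 * (4 ^ (n + 1)) ^ 2 := by
      calc _ = (((n : ℝ) + 1) * (n + 1).centralBinom) ^ 2 * (2 * n + 3) := by ring
        _ = 4 * (2 * n + 1) * (2 * n + 3) * ((n.centralBinom : ℝ) ^ 2 * (2 * n + 1)) := by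
          rw [h]; ring
        _ ≤ 4 * (2 * n + 1) * (2 * n + 3) * (4 ^ n) ^ 2 := by gcongr
        _ ≤ (16 * (n + 1) ^ 2) * (4 ^ n) ^ 2 := by
          refine mul_le_mul_of_nonneg_right ?_ (by positivity)
          nlinarith
        _ = _ := by rw [pow_succ]; ring
    push_cast
    exact le_of_mul_le_mul_left h2 (by positivity)

theorem choose_sq_mul_le (m k : ℕ) : ((m.choose k : ℝ) / 2 ^ m) ^ 2 ≤ 1 / (m + 1) := by
  rw [div_pow, div_le_div_iff₀ (by positivity) (by positivity), one_mul]
  have hk : (m.choose k : ℝ) ≤ m.choose (m / 2) := by exact_mod_cast Nat.choose_le_middle k m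
  refine le_trans (by gcongr : _ ≤ (m.choose (m / 2) : ℝ) ^ 2 * (m + 1)) ?_
  rcases Nat.even_or_odd' m with ⟨n, rfl | rfl⟩
  · have := centralBinom_sq_mul_le n
    rw [Nat.centralBinom_eq_two_mul_choose] at this
    rw [Nat.mul_div_cancel_left _ two_pos, pow_mul]
    push_cast
    norm_num
    exact this
  · have h := centralBinom_sq_mul_le (n + 1)
    have hc : ((n + 1).centralBinom : ℝ) = 2 * (2 * n + 1).choose n := by
      rw [Nat.centralBinom_eq_two_mul_choose]
      have : 2 * (n + 1) = (2 * n + 1) + 1 := by ring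
      rw [this, Nat.choose_succ_succ, Nat.choose_symm_half]
      push_cast
      ring
    rw [hc] at h
    have hd : (2 * n + 1) / 2 = n := by omega
    rw [hd]
    have e : ((2 : ℝ) ^ (2 * n + 1)) ^ 2 = (4 ^ (n + 1)) ^ 2 / 4 := by
      have h4 : (4 : ℝ) = 2 ^ 2 := by norm_num
      rw [h4, ← pow_mul, ← pow_mul, ← pow_mul, eq_div_iff (by norm_num), ← pow_add]
      congr 1
      ring
    rw [e]
    push_cast at h ⊢
    nlinarith [sq_nonneg ((2 * n + 1).choose n : ℝ)]

theorem lineHeat_sq_le (m : ℕ) (x : ℤ) : lineHeat m x ^ 2 ≤ 1 / (m + 1) := by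
  have key : ∀ j : ℤ, lineHeat m (2 * j - m) ^ 2 ≤ 1 / (m + 1) := by
    intro j
    rw [(lineHeat_eq m j).1]
    split_ifs
    · exact choose_sq_mul_le m _
    · simp
      positivity
  rcases Int.even_or_odd' (x + m) with ⟨j, h | h⟩
  · rw [show x = 2 * j - m by omega]
    exact key j
  · rw [show x = 2 * j - m + 1 by omega, (lineHeat_eq m j).2]
    simp
    positivity

variable {d : ℕ}

/-- The mean of `F m` over a multinomial vector `m` with `n` trials and `d` equally likely
outcomes. -/
def multinomialMean : ℕ → ((Fin d → ℕ) → ℝ) → ℝ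
  | 0, F => F 0
  | n + 1, F => (d : ℝ)⁻¹ * ∑ i, multinomialMean n fun m => F (m + Pi.single i 1)

theorem multinomialMean_mono {F G : (Fin d → ℕ) → ℝ} (h : ∀ m, F m ≤ G m) (n : ℕ) :
    multinomialMean n F ≤ multinomialMean n G := by
  induction n generalizing F G with
  | zero => exact h 0
  | succ n ih =>
    unfold multinomialMean
    gcongr with i
    exact ih fun m => h _

theorem multinomialMean_const_mul (c : ℝ) (F : (Fin d → ℕ) → ℝ) (n : ℕ) :
    multinomialMean n (fun m => c * F m) = c * multinomialMean n F := by
  induction n generalizing F with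
  | zero => rfl
  | succ n ih =>
    simp only [multinomialMean, ih, ← Finset.mul_sum]
    ring

theorem multinomialMean_add (F G : (Fin d → ℕ) → ℝ) (n : ℕ) :
    multinomialMean n (fun m => F m + G m) = multinomialMean n F + multinomialMean n G := by
  induction n generalizing F G with
  | zero => rfl
  | succ n ih => simp only [multinomialMean, ih, Finset.sum_add_distrib, mul_add]

theorem multinomialMean_const [NeZero d] (c : ℝ) (n : ℕ) :
    multinomialMean n (fun _ : Fin d → ℕ => c) = c := by
  induction n with
  | zero => rfl
  | succ n ih =>
    have : (d : ℝ) ≠ 0 := by simp [NeZero.ne d]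
    simp only [multinomialMean, ih]
    simp
    field_simp

/-- Size-biasing a multinomial vector by one of its entries. -/
theorem multinomialMean_mul_apply [NeZero d] (i : Fin d) (F : (Fin d → ℕ) → ℝ) (n : ℕ) :
    multinomialMean (n + 1) (fun m => m i * F m)
      = (n + 1) / d * multinomialMean n fun m => F (m + Pi.single i 1) := by
  have hd : (d : ℝ) ≠ 0 := by simp [NeZero.ne d]
  have hsplit : ∀ (F : (Fin d → ℕ) → ℝ) n, multinomialMean (n + 1) (fun m : Fin d → ℕ => m i * F m)
      = (d : ℝ)⁻¹ * ((∑ j, multinomialMean n fun m => (m i : ℝ) * F (m + Pi.single j 1))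
        + multinomialMean n fun m => F (m + Pi.single i 1)) := by
    intro F n
    have h : ∀ j, (multinomialMean n fun m : Fin d → ℕ =>
          (((m + Pi.single j 1 : Fin d → ℕ) i : ℕ) : ℝ) * F (m + Pi.single j 1))
        = (multinomialMean n fun m => (m i : ℝ) * F (m + Pi.single j 1))
          + if j = i then multinomialMean n fun m => F (m + Pi.single i 1) else 0 := by
      intro j
      by_cases hj : j = i
      · subst hj
        rw [if_pos rfl, ← multinomialMean_add]
        congr 1
        ext m
        simp
        ring
      · simp [hj, Ne.symm hj]
    rw [multinomialMean, Finset.sum_congr rfl fun j _ => h j, Finset.sum_add_distrib]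
    simp
  induction n generalizing F with
  | zero =>
    rw [hsplit]
    simp [multinomialMean]
  | succ n ih =>
    have h1 : ∀ j, (multinomialMean (n + 1) fun m : Fin d → ℕ => (m i : ℝ) * F (m + Pi.single j 1))
        = (n + 1) / d * multinomialMean n fun m => F (m + Pi.single i 1 + Pi.single j 1) :=
      fun j => ih fun m => F (m + Pi.single j 1)
    rw [hsplit, Finset.sum_congr rfl fun j _ => h1 j, ← Finset.mul_sum]
    have h2 : ∑ j, (multinomialMean n fun m : Fin d → ℕ => F (m + Pi.single i 1 + Pi.single j 1))
        = d * multinomialMean (n + 1) fun m => F (m + Pi.single i 1) := by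
      rw [multinomialMean, mul_inv_cancel_left₀ hd]
      simp only [add_right_comm]
    rw [h2]
    push_cast
    field_simp

/-- Each factor `1 / (m i + 1)` is removed by size-biasing, at the cost of a factor `d / (n + 1)`. -/
theorem multinomialMean_prod_inv_le [NeZero d] (S : Finset (Fin d)) (n : ℕ) :
    multinomialMean n (fun m : Fin d → ℕ => ∏ i ∈ S, (1 / ((m i : ℝ) + 1)))
      ≤ (d / (n + 1)) ^ S.card := by
  have hd : (d : ℝ) ≠ 0 := by simp [NeZero.ne d]
  induction S using Finset.induction_on generalizing n with
  | empty => simp [multinomialMean_const]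
  | insert i S hi ih =>
    have h1 := multinomialMean_mul_apply i
      (fun m => (1 / (m i : ℝ)) * ∏ k ∈ S, (1 / ((m k : ℝ) + 1))) n
    have h2 : ∀ m : Fin d → ℕ, (1 / ((m + Pi.single i 1 : Fin d → ℕ) i : ℝ))
          * ∏ k ∈ S, (1 / (((m + Pi.single i 1 : Fin d → ℕ) k : ℝ) + 1))
        = ∏ k ∈ insert i S, (1 / ((m k : ℝ) + 1)) := by
      intro m
      rw [Finset.prod_insert hi]
      congr 1
      · simp
      · refine Finset.prod_congr rfl fun k hk => ?_
        have : k ≠ i := fun h => hi (h ▸ hk)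
        simp [this]
    simp only [h2] at h1
    have h3 : multinomialMean (n + 1) (fun m : Fin d → ℕ =>
        (m i : ℝ) * ((1 / (m i : ℝ)) * ∏ k ∈ S, (1 / ((m k : ℝ) + 1))))
        ≤ (d / (n + 1)) ^ S.card := by
      refine (multinomialMean_mono (fun m => ?_) _).trans ((ih (n + 1)).trans ?_)
      · rw [← mul_assoc]
        refine mul_le_of_le_one_left (by positivity) ?_
        rw [mul_one_div]
        exact div_self_le_one _
      · gcongr
        linarith
    rw [h1] at h3
    rw [Finset.card_insert_of_notMem hi, pow_succ']
    calc _ = (d / (n + 1)) * ((n + 1) / d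
          * multinomialMean n fun m => ∏ k ∈ insert i S, (1 / ((m k : ℝ) + 1))) := by
          field_simp
      _ ≤ _ := by gcongr

theorem multinomialMean_nonneg {F : (Fin d → ℕ) → ℝ} (h : ∀ m, 0 ≤ F m) (n : ℕ) :
    0 ≤ multinomialMean n F := by
  induction n generalizing F with
  | zero => exact h 0
  | succ n ih =>
    unfold multinomialMean
    exact mul_nonneg (by positivity) (Finset.sum_nonneg fun i _ => ih fun m => h _)

theorem prod_lineHeat_add_single (m : Fin d → ℕ) (x : Site d) (i : Fin d) :
    ∏ k, lineHeat ((m + Pi.single i 1 : Fin d → ℕ) k) (x k)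
      = (∏ k, lineHeat (m k) ((x + Pi.single i 1 : Site d) k)
        + ∏ k, lineHeat (m k) ((x + Pi.single i (-1) : Site d) k)) / 2 := by
  have h1 : ∏ k ∈ Finset.univ.erase i, lineHeat ((m + Pi.single i 1 : Fin d → ℕ) k) (x k)
      = ∏ k ∈ Finset.univ.erase i, lineHeat (m k) (x k) :=
    Finset.prod_congr rfl fun k hk => by simp [Finset.ne_of_mem_erase hk]
  have h2 : ∀ c : ℤ, ∏ k, lineHeat (m k) ((x + Pi.single i c : Site d) k)
      = lineHeat (m i) (x i + c) * ∏ k ∈ Finset.univ.erase i, lineHeat (m k) (x k) := by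
    intro c
    rw [← Finset.mul_prod_erase Finset.univ _ (Finset.mem_univ i)]
    congr 1
    · simp
    · exact Finset.prod_congr rfl fun k hk => by simp [Finset.ne_of_mem_erase hk]
  rw [← Finset.mul_prod_erase Finset.univ _ (Finset.mem_univ i), h1, h2, h2]
  simp only [Pi.add_apply, Pi.single_eq_same, lineHeat]
  ring_nf

/-- Given the numbers of steps in the `d` directions, the coordinates of simple random walk are
independent simple random walks on `ℤ`. -/
theorem heat_eq_multinomialMean [NeZero d] (n : ℕ) (x : Site d) :
    heat n x 0 = ENNReal.ofReal
      (multinomialMean n fun m : Fin d → ℕ => ∏ k, lineHeat (m k) (x k)) := by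
  have hnn : ∀ n (x : Site d),
      0 ≤ multinomialMean n fun m : Fin d → ℕ => ∏ k, lineHeat (m k) (x k) := fun n x =>
    multinomialMean_nonneg (fun m => Finset.prod_nonneg fun k _ => lineHeat_nonneg _ _) n
  have hd : (0 : ℝ) < d := by simp [NeZero.pos d]
  induction n generalizing x with
  | zero =>
    simp only [multinomialMean, heat_zero, lineHeat]
    by_cases h : x = 0
    · simp [h]
    · obtain ⟨k, hk⟩ := Function.ne_iff.1 h
      rw [ind_of_not h, Finset.prod_eq_zero (Finset.mem_univ k) (if_neg hk), ENNReal.ofReal_zero]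
  | succ n ih =>
    have h : heat (n + 1) x 0 = avg (fun z => heat n z 0) x := by
      rw [heat, iterate_succ_apply']
      rfl
    rw [h, avg_eq_sum, multinomialMean, ENNReal.ofReal_mul (by positivity),
      ENNReal.ofReal_inv_of_pos hd, ENNReal.ofReal_natCast, ENNReal.ofReal_sum_of_nonneg]
    · congr 1
      refine Finset.sum_congr rfl fun i _ => ?_
      simp only [prod_lineHeat_add_single, div_eq_inv_mul]
      rw [multinomialMean_const_mul, multinomialMean_add, ih, ih, ENNReal.ofReal_mul (by positivity),
        ENNReal.ofReal_add (hnn _ _) (hnn _ _), ENNReal.div_eq_inv_mul]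
      congr 1
      rw [ENNReal.ofReal_inv_of_pos two_pos, ENNReal.ofReal_ofNat]
    · intro i _
      simp only [prod_lineHeat_add_single, div_eq_inv_mul]
      rw [multinomialMean_const_mul, multinomialMean_add]
      have h1 := hnn n (x + Pi.single i 1)
      have h2 := hnn n (x + Pi.single i (-1))
      positivity

/-- The bound of order `n ^ (-d / 2)`. Given the numbers `m k` of steps in the `d` directions, the
square of the transition probability is at most `∏ k, 1 / (m k + 1)`. -/
theorem heat_le [NeZero d] (n : ℕ) (x y : Site d) :
    heat n x y ≤ ENNReal.ofReal (√((d / (n + 1)) ^ d)) := by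
  rw [heat_eq_zero_right, heat_eq_multinomialMean]
  refine ENNReal.ofReal_le_ofReal ?_
  generalize x - y = x
  have hd : (0 : ℝ) < d := by simp [NeZero.pos d]
  set t : ℝ := √((d / (n + 1)) ^ d) with ht
  have ht0 : 0 < t := by positivity
  have ht2 : t ^ 2 = (d / (n + 1)) ^ d := Real.sq_sqrt (by positivity)
  -- The inequality of the means, with the weight that makes its two terms comparable.
  have key : ∀ m : Fin d → ℕ, ∏ k, lineHeat (m k) (x k)
      ≤ t / 2 + (1 / (2 * t)) * ∏ k, (1 / ((m k : ℝ) + 1)) := by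
    intro m
    have h1 : (∏ k, lineHeat (m k) (x k)) ^ 2 ≤ ∏ k, (1 / ((m k : ℝ) + 1)) := by
      rw [← Finset.prod_pow]
      exact Finset.prod_le_prod (fun k _ => sq_nonneg _) fun k _ => lineHeat_sq_le _ _
    generalize ∏ k, lineHeat (m k) (x k) = a at *
    calc a ≤ t / 2 + (1 / (2 * t)) * a ^ 2 := by
          have : t / 2 + (1 / (2 * t)) * a ^ 2 - a = (t - a) ^ 2 / (2 * t) := by
            field_simp
            ring
          have h2 : 0 ≤ (t - a) ^ 2 / (2 * t) := by positivity
          linarith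
      _ ≤ _ := by gcongr
  refine (multinomialMean_mono key n).trans ?_
  rw [multinomialMean_add, multinomialMean_const, multinomialMean_const_mul]
  have h := multinomialMean_prod_inv_le (Finset.univ : Finset (Fin d)) n
  rw [Finset.card_univ, Fintype.card_fin, ← ht2] at h
  calc _ ≤ t / 2 + 1 / (2 * t) * t ^ 2 := by gcongr
    _ = t := by field_simp; ring

/-- The bound `heat n ≤ C (n + 1) ^ (-d / 2)`, in the form in which it is used. -/
theorem exists_heat_le [NeZero d] (k : ℕ) (hd : 2 * k + 3 ≤ d) :
    ∃ B : ℕ → ℝ≥0∞, (∀ n (x y : Site d), heat n x y ≤ B n)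
      ∧ ∑' n : ℕ, ((n : ℝ≥0∞) + 1) ^ k * B n ≠ ∞ := by
  refine ⟨_, fun n x y => heat_le n x y, ?_⟩
  have hs : Summable fun n : ℕ => √((d : ℝ) ^ d) * (1 / ((n + 1 : ℕ) : ℝ) ^ (3 / 2 : ℝ)) :=
    ((summable_nat_add_iff 1).2 (Real.summable_one_div_nat_rpow.2 (by norm_num))).mul_left _
  have hle : ∀ n : ℕ, ((n : ℝ≥0∞) + 1) ^ k * ENNReal.ofReal (√(((d : ℝ) / (n + 1)) ^ d))
      ≤ ENNReal.ofReal (√((d : ℝ) ^ d) * (1 / ((n + 1 : ℕ) : ℝ) ^ (3 / 2 : ℝ))) := by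
    intro n
    have h1 : ((n : ℝ≥0∞) + 1) ^ k = ENNReal.ofReal (((n : ℝ) + 1) ^ k) := by
      rw [ENNReal.ofReal_pow (by positivity), ENNReal.ofReal_add (by positivity) zero_le_one]
      simp
    rw [h1, ← ENNReal.ofReal_mul (by positivity)]
    refine ENNReal.ofReal_le_ofReal ?_
    push_cast
    set a : ℝ := n + 1
    have ha : 1 ≤ a := by simp [a]
    have ha0 : 0 < a := by linarith
    rw [div_pow, Real.sqrt_div (by positivity), mul_div_assoc', mul_comm, mul_div_assoc]
    refine mul_le_mul_of_nonneg_left ?_ (by positivity)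
    rw [div_le_div_iff₀ (by positivity) (by positivity), one_mul, Real.sqrt_eq_rpow,
      ← Real.rpow_natCast, ← Real.rpow_natCast, ← Real.rpow_mul ha0.le, ← Real.rpow_add ha0]
    refine Real.rpow_le_rpow_of_exponent_le ha ?_
    have : ((2 * k + 3 : ℕ) : ℝ) ≤ d := by exact_mod_cast hd
    push_cast at this
    linarith
  refine ne_top_of_le_ne_top ?_ (ENNReal.tsum_le_tsum hle)
  rw [← ENNReal.ofReal_tsum_of_nonneg (fun n => by positivity) hs]
  exact ENNReal.ofReal_ne_top

end HeatKernel

/-! ### The identity for killed random walks -/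

section Killed

variable {d : ℕ} [NeZero d]

/-- One step of simple random walk followed by the weight `φ` at the new position. -/
def weightedAvg (φ f : Site d → ℝ≥0∞) (x : Site d) : ℝ≥0∞ := avg (fun z => φ z * f z) x

theorem weightedAvg_add (φ f g : Site d → ℝ≥0∞) (x : Site d) :
    weightedAvg φ (fun z => f z + g z) x = weightedAvg φ f x + weightedAvg φ g x := by
  simp only [weightedAvg, mul_add, avg_add]

theorem weightedAvg_sum {ι : Type*} (φ : Site d → ℝ≥0∞) (s : Finset ι) (f : ι → Site d → ℝ≥0∞)
    (x : Site d) : weightedAvg φ (fun z => ∑ i ∈ s, f i z) x = ∑ i ∈ s, weightedAvg φ (f i) x := by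
  simp only [weightedAvg, Finset.mul_sum, avg_sum]

theorem weightedAvg_iterate_le {φ : Site d → ℝ≥0∞} (hφ : ∀ z, φ z ≤ 1) (f : Site d → ℝ≥0∞)
    (n : ℕ) (x : Site d) : (weightedAvg φ)^[n] f x ≤ avg^[n] f x := by
  induction n generalizing x with
  | zero => exact le_rfl
  | succ n ih =>
    rw [iterate_succ_apply', iterate_succ_apply']
    exact avg_mono (fun z => (mul_le_of_le_one_left' (hφ z)).trans (ih z)) x

/-- Reversal in time of a walk that is weighted at its intermediate positions. -/
theorem weightedAvg_iterate_adjoint (φ f g : Site d → ℝ≥0∞) (n : ℕ) :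
    ∑' x, f x * (weightedAvg φ)^[n] (avg g) x = ∑' x, (weightedAvg φ)^[n] (avg f) x * g x := by
  induction n generalizing g with
  | zero => exact avg_adjoint f g
  | succ n ih =>
    have h1 : (weightedAvg φ)^[n + 1] (avg g)
        = (weightedAvg φ)^[n] (avg fun z => φ z * avg g z) := by
      rw [iterate_succ_apply]
      rfl
    rw [h1, ih, iterate_succ_apply']
    calc _ = ∑' x, (φ x * (weightedAvg φ)^[n] (avg f) x) * avg g x := by
          refine tsum_congr fun x => ?_
          ring
      _ = _ := avg_adjoint _ _

/-- Let `v` solve `v = avg (1_K + φ v)` and vanish in mean at infinity, let `w` solve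
`w = avg (φ w)` and tend to one in mean at infinity, and let `φ + ψ v = 1` off `K` and `φ = 0`
on `K`. By reversal in time, `v z` is the total weight of the walks from `K` to `z`; so the sum
over `x ∈ K` reduces to the potential of the charge `w - φ w`, whose value is found from
`avg w - w = avg (w - φ w)` by summing along the walk started from `y`. -/
theorem sum_weightedAvg_eq_one {K : Finset (Site d)} {φ ψ v w : Site d → ℝ≥0∞}
    (hv : ∀ x, v x = avg (fun z => ind (z ∈ K) + φ z * v z) x)
    (hψ : ∀ z, φ z + ψ z * v z = ind (z ∉ K))
    (hw : ∀ x, w x = weightedAvg φ w x)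
    (hv0 : ∀ x, Tendsto (fun n => avg^[n] v x) atTop (𝓝 0))
    (hwlim : ∀ x, Tendsto (fun n => avg^[n] w x) atTop (𝓝 1))
    {y : Site d} (hy : y ∈ K) :
    ∑ x ∈ K, (w x * (ind (x = y) + greenPos x y)
      + ∑' i, (weightedAvg φ)^[i] (avg fun z => ψ z * greenPos z y * w z) x) = 1 := by
  classical
  have hφ : ∀ z, φ z ≤ 1 := fun z => (le_self_add.trans (hψ z).le).trans (ind_le_one _)
  -- The total weight of the walks from `K` to a site.
  have hvN : ∀ N x, v x = ∑ i ∈ Finset.range N, (weightedAvg φ)^[i] (avg fun z => ind (z ∈ K)) x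
      + (weightedAvg φ)^[N] v x := by
    intro N
    induction N with
    | zero => simp
    | succ N ih =>
      intro x
      have h1 : v x = avg (fun z => ind (z ∈ K)) x + weightedAvg φ v x := by
        rw [hv x, avg_add]
        rfl
      rw [h1]
      conv_lhs => rw [funext ih, weightedAvg_add, weightedAvg_sum]
      rw [Finset.sum_range_succ']
      simp only [iterate_succ_apply', iterate_zero, id]
      ring
  have hvsum : ∀ x, ∑' i, (weightedAvg φ)^[i] (avg fun z => ind (z ∈ K)) x = v x := by
    intro x
    have h0 : Tendsto (fun N => (weightedAvg φ)^[N] v x) atTop (𝓝 0) :=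
      tendsto_of_tendsto_of_tendsto_of_le_of_le tendsto_const_nhds (hv0 x) (fun _ => zero_le)
        fun n => weightedAvg_iterate_le hφ v n x
    have h1 := (ENNReal.tendsto_nat_tsum
      fun i => (weightedAvg φ)^[i] (avg fun z => ind (z ∈ K)) x).add h0
    rw [add_zero] at h1
    refine tendsto_nhds_unique h1 ?_
    simp only [← hvN]
    exact tendsto_const_nhds
  have hK : ∀ f : Site d → ℝ≥0∞, ∑ x ∈ K, f x = ∑' x, ind (x ∈ K) * f x := by
    intro f
    rw [tsum_eq_sum (s := K) fun x hx => by simp [hx]]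
    exact Finset.sum_congr rfl fun x hx => by simp [hx]
  let c : Site d → ℝ≥0∞ := fun z => ind (z ∈ K) * w z + ψ z * v z * w z
  have hwc : ∀ z, w z = φ z * w z + c z := by
    intro z
    have h1 : ind (z ∈ K) + ind (z ∉ K) = 1 := ind_add_ind_not _
    rw [← hψ z] at h1
    calc w z = 1 * w z := (one_mul _).symm
      _ = _ := by
        rw [← h1]
        simp only [c]
        ring
  have hN : ∀ N, avg^[N] w y = w y + ∑ n ∈ Finset.range N, avg^[n + 1] c y := by
    intro N
    induction N with
    | zero => simp
    | succ N ih =>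
      have h1 : avg w = fun x => w x + avg c x := by
        funext x
        conv_lhs => rw [funext hwc, avg_add]
        rw [hw x]
        rfl
      rw [iterate_succ_apply, h1, avg_iterate_add, ih, Finset.sum_range_succ, add_assoc,
        ← iterate_succ_apply]
  have hlim : w y + ∑' n, avg^[n + 1] c y = 1 := by
    refine tendsto_nhds_unique ?_ (hwlim y)
    simp only [hN]
    exact tendsto_const_nhds.add (ENNReal.tendsto_nat_tsum _)
  have hpot : ∑' z, c z * greenPos z y = ∑' n, avg^[n + 1] c y := by
    simp only [greenPos, ← ENNReal.tsum_mul_left]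
    rw [ENNReal.tsum_comm]
    exact tsum_congr fun n => tsum_mul_heat c (n + 1) y
  rw [← hlim, ← hpot, Finset.sum_add_distrib, hK, hK]
  have h1 : ∑' x, ind (x ∈ K) * ∑' i, (weightedAvg φ)^[i]
        (avg fun z => ψ z * greenPos z y * w z) x
      = ∑' z, v z * (ψ z * greenPos z y * w z) := by
    simp only [← ENNReal.tsum_mul_left]
    rw [ENNReal.tsum_comm]
    simp only [weightedAvg_iterate_adjoint]
    rw [ENNReal.tsum_comm]
    simp only [ENNReal.tsum_mul_right, hvsum]
  have h2 : ∑' x, ind (x ∈ K) * (w x * (ind (x = y) + greenPos x y))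
      = w y + ∑' x, ind (x ∈ K) * w x * greenPos x y := by
    simp only [mul_add]
    rw [ENNReal.tsum_add]
    congr 1
    · rw [tsum_eq_single y fun x hx => by simp [hx]]
      simp [hy]
    · simp only [mul_assoc]
  rw [h1, h2, add_assoc, ← ENNReal.tsum_add]
  congr 1
  refine tsum_congr fun z => ?_
  simp only [c]
  ring

end Killed

/-! ### Marks of branching random walks -/

theorem measurePreserving_prod_prod_comm {α β γ δ : Type*} [MeasurableSpace α] [MeasurableSpace β]
    [MeasurableSpace γ] [MeasurableSpace δ] (a : Measure α) (b : Measure β) (c : Measure γ)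
    (e : Measure δ) [SFinite a] [SFinite b] [SFinite c] [SFinite e] :
    MeasurePreserving (fun p : (α × β) × (γ × δ) => ((p.1.1, p.2.1), (p.1.2, p.2.2)))
      ((a.prod b).prod (c.prod e)) ((a.prod c).prod (b.prod e)) := by
  refine ⟨by fun_prop, Measure.ext_of_lintegral _ fun f hf => ?_⟩
  rw [lintegral_map hf (by fun_prop), lintegral_prod _ (by fun_prop), lintegral_prod _ (by fun_prop),
    lintegral_prod _ (by fun_prop), lintegral_prod _ (by fun_prop)]
  refine lintegral_congr fun x => ?_
  have h1 : ∀ y, ∫⁻ z, f ((x, z.1), (y, z.2)) ∂(c.prod e)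
      = ∫⁻ u, ∫⁻ v, f ((x, u), (y, v)) ∂e ∂c := fun y => lintegral_prod _ (by fun_prop)
  have h2 : ∀ u, ∫⁻ z, f ((x, u), z) ∂(b.prod e)
      = ∫⁻ y, ∫⁻ v, f ((x, u), (y, v)) ∂e ∂b := fun u => lintegral_prod _ (by fun_prop)
  simp only [h1, h2]
  rw [lintegral_lintegral_swap]
  exact (Measurable.lintegral_prod_right' (f := fun q : (β × γ) × δ => f ((x, q.1.2), (q.1.1, q.2)))
    (by fun_prop)).aemeasurable

/-- Offspring numbers and spatial jumps of a family of vertices. -/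
abbrev Marks (d : ℕ) (ι : Type*) := (ι → ℕ) × (ι → Site d)

/-- The marks of a subfamily of vertices. -/
def Marks.comp {d : ℕ} {ι κ : Type*} (p : Marks d ι) (f : κ → ι) : Marks d κ :=
  (fun k => p.1 (f k), fun k => p.2 (f k))

theorem Marks.measurable_comp {d : ℕ} {ι κ : Type*} (f : κ → ι) :
    Measurable fun p : Marks d ι => p.comp f := by
  unfold Marks.comp
  fun_prop

/-- Law of the marks of a family of vertices: all of them are independent, the offspring numbers
have law `μ` and the jumps are uniform on the neighbours of the origin. -/
def marksLaw (d : ℕ) [NeZero d] (μ : PMF ℕ) (ι : Type*) : Measure (Marks d ι) :=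
  (Measure.infinitePi fun _ => μ.toMeasure).prod (Measure.infinitePi fun _ => (stepLaw d).toMeasure)

instance (d : ℕ) [NeZero d] (μ : PMF ℕ) (ι : Type*) : IsProbabilityMeasure (marksLaw d μ ι) := by
  unfold marksLaw
  infer_instance

section MarksLaw

variable {d : ℕ} [NeZero d] (μ : PMF ℕ) {ι κ κ' : Type*}

theorem measurePreserving_marks_comp {f : κ → ι} (hf : Injective f) :
    MeasurePreserving (fun p : Marks d ι => p.comp f) (marksLaw d μ ι) (marksLaw d μ κ) :=
  (measurePreserving_comp_infinitePi _ hf).prod (measurePreserving_comp_infinitePi _ hf)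

theorem measurePreserving_marks_split {f : κ → ι} {g : κ' → ι} (hf : Injective f)
    (hg : Injective g) (hfg : ∀ a b, f a ≠ g b) :
    MeasurePreserving (fun p : Marks d ι => (p.comp f, p.comp g))
      (marksLaw d μ ι) ((marksLaw d μ κ).prod (marksLaw d μ κ')) :=
  (measurePreserving_prod_prod_comm _ _ _ _).comp
    ((measurePreserving_split_infinitePi (fun _ => μ.toMeasure) hf hg hfg).prod
      (measurePreserving_split_infinitePi (fun _ => (stepLaw d).toMeasure) hf hg hfg))

theorem lintegral_marks_mul {f : κ → ι} {g : κ' → ι} (hf : Injective f)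
    (hg : Injective g) (hfg : ∀ a b, f a ≠ g b) {F : Marks d κ → ℝ≥0∞} {G : Marks d κ' → ℝ≥0∞}
    (hF : Measurable F) (hG : Measurable G) :
    ∫⁻ p, F (p.comp f) * G (p.comp g) ∂(marksLaw d μ ι)
      = (∫⁻ p, F p ∂(marksLaw d μ κ)) * ∫⁻ p, G p ∂(marksLaw d μ κ') := by
  rw [← lintegral_prod_mul hF.aemeasurable hG.aemeasurable]
  exact (measurePreserving_marks_split μ hf hg hfg).lintegral_comp
    (f := fun q : Marks d κ × Marks d κ' => F q.1 * G q.2) (by fun_prop)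

/-- Integration of a function of the marks of one vertex and of those of other vertices. -/
theorem lintegral_marks_head_tail {i : ι} {g : κ → ι} (hg : Injective g) (hi : ∀ b, i ≠ g b)
    {F : ℕ → Site d → Marks d κ → ℝ≥0∞} (hF : ∀ n s, Measurable (F n s)) :
    ∫⁻ p, F (p.1 i) (p.2 i) (p.comp g) ∂(marksLaw d μ ι)
      = ∫⁻ s, ∫⁻ n, ∫⁻ p, F n s p ∂(marksLaw d μ κ) ∂μ.toMeasure ∂(stepLaw d).toMeasure := by
  have hm : Measurable fun q : (ℕ × Site d) × Marks d κ => F q.1.1 q.1.2 q.2 :=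
    measurable_from_prod_countable_right fun x => hF x.1 x.2
  have h := (measurePreserving_marks_split (d := d) μ (f := fun _ : Unit => i)
    (injective_of_subsingleton _) hg (fun _ => hi)).lintegral_comp
    (f := fun q : Marks d Unit × Marks d κ => F (q.1.1 ()) (q.1.2 ()) q.2)
    (hm.comp (by fun_prop :
      Measurable fun q : Marks d Unit × Marks d κ => ((q.1.1 (), q.1.2 ()), q.2)))
  have h1 : Measurable fun q : Marks d Unit × Marks d κ => F (q.1.1 ()) (q.1.2 ()) q.2 :=
    hm.comp (by fun_prop :
      Measurable fun q : Marks d Unit × Marks d κ => ((q.1.1 (), q.1.2 ()), q.2))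
  refine h.trans ?_
  rw [lintegral_prod _ h1.aemeasurable]
  have h2 : Measurable fun q : Site d × ℕ => ∫⁻ p, F q.2 q.1 p ∂(marksLaw d μ κ) :=
    measurable_of_countable _
  have h3 : MeasurePreserving (fun p : Marks d Unit => (p.2 (), p.1 ())) (marksLaw d μ Unit)
      ((stepLaw d).toMeasure.prod μ.toMeasure) :=
    Measure.measurePreserving_swap.comp ((measurePreserving_eval_infinitePi _ ()).prod
      (measurePreserving_eval_infinitePi _ ()))
  rw [← lintegral_prod (μ := (stepLaw d).toMeasure) (ν := μ.toMeasure)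
    (fun q : Site d × ℕ => ∫⁻ p, F q.2 q.1 p ∂(marksLaw d μ κ)) h2.aemeasurable]
  exact h3.lintegral_comp (f := fun q : Site d × ℕ => ∫⁻ p, F q.2 q.1 p ∂(marksLaw d μ κ)) h2

end MarksLaw

/-! ### Forests of critical branching random walks -/

/-- Whether the vertex with address `u` in the `c`-th tree belongs to the forest of `m` trees with
the given offspring numbers. As for `NormalVertex`, the last generation is the head of the list. -/
def InForest {d : ℕ} (m : ℕ) (p : Marks d (ℕ × List ℕ)) (c : ℕ) : List ℕ → Prop
  | [] => c < m
  | j :: u => InForest m p c u ∧ j < p.1 (c, u)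

/-- Position of a vertex of a forest the roots of whose trees are children of a vertex at `z`. -/
def forestWalk {d : ℕ} (z : Site d) (p : Marks d (ℕ × List ℕ)) (c : ℕ) : List ℕ → Site d
  | [] => z + p.2 (c, [])
  | j :: u => forestWalk z p c u + p.2 (c, j :: u)

/-- The index, in a forest, of a vertex below the root of the `c`-th tree, given its index in the
forest of the descendants of that root. -/
def below (c : ℕ) (q : ℕ × List ℕ) : ℕ × List ℕ := (c, q.2 ++ [q.1])

theorem below_injective (c : ℕ) : Injective (below c) := by
  rintro ⟨a, u⟩ ⟨b, v⟩ h
  simpa [below, and_comm] using h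

theorem root_ne_below (c : ℕ) (q : ℕ × List ℕ) : (c, []) ≠ below c q := by
  simp [below]

/-- The forest without its first tree. -/
def shiftForest (q : ℕ × List ℕ) : ℕ × List ℕ := (q.1 + 1, q.2)

theorem shiftForest_injective : Injective shiftForest := by
  rintro ⟨a, u⟩ ⟨b, v⟩ h
  simpa [shiftForest] using h

section Forest

variable {d : ℕ}

theorem inForest_append (m : ℕ) (p : Marks d (ℕ × List ℕ)) (c c' : ℕ) (u : List ℕ) :
    InForest m p c (u ++ [c'])
      ↔ c < m ∧ InForest (p.1 (c, [])) (p.comp (below c)) c' u := by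
  induction u with
  | nil => simp [InForest]
  | cons j u ih =>
    simp only [List.cons_append, InForest, ih, and_assoc]
    rfl

theorem forestWalk_append (z : Site d) (p : Marks d (ℕ × List ℕ)) (c c' : ℕ) (u : List ℕ) :
    forestWalk z p c (u ++ [c'])
      = forestWalk (z + p.2 (c, [])) (p.comp (below c)) c' u := by
  induction u with
  | nil => simp [forestWalk, Marks.comp, below]
  | cons j u ih =>
    simp only [List.cons_append, forestWalk, ih]
    rfl

theorem inForest_shift (m : ℕ) (p : Marks d (ℕ × List ℕ)) (c : ℕ) (u : List ℕ) :
    InForest (m + 1) p (c + 1) u ↔ InForest m (p.comp shiftForest) c u := by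
  induction u with
  | nil => simp [InForest]
  | cons j u ih =>
    simp only [InForest, ih]
    rfl

theorem forestWalk_shift (z : Site d) (p : Marks d (ℕ × List ℕ)) (c : ℕ) (u : List ℕ) :
    forestWalk z p (c + 1) u = forestWalk z (p.comp shiftForest) c u := by
  induction u with
  | nil => rfl
  | cons j u ih =>
    simp only [forestWalk, ih]
    rfl

theorem InForest.lt {m : ℕ} {p : Marks d (ℕ × List ℕ)} {c : ℕ} {u : List ℕ}
    (h : InForest m p c u) : c < m := by
  induction u with
  | nil => exact h
  | cons j u ih => exact ih h.1

theorem inForest_iff (m : ℕ) (p : Marks d (ℕ × List ℕ)) (c : ℕ) (u : List ℕ) :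
    InForest m p c u ↔ c < m ∧ InForest (c + 1) p c u := by
  induction u with
  | nil => simp [InForest]
  | cons j u ih => simp only [InForest, ih, and_assoc]

theorem measurableSet_inForest (m c : ℕ) (u : List ℕ) :
    MeasurableSet {p : Marks d (ℕ × List ℕ) | InForest m p c u} := by
  induction u with
  | nil => exact MeasurableSet.const _
  | cons j u ih =>
    exact ih.inter (measurableSet_lt measurable_const
      (by fun_prop : Measurable fun p : Marks d (ℕ × List ℕ) => p.1 (c, u)))

theorem measurable_forestWalk (z : Site d) (c : ℕ) (u : List ℕ) :
    Measurable fun p : Marks d (ℕ × List ℕ) => forestWalk z p c u := by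
  induction u with
  | nil => unfold forestWalk; fun_prop
  | cons j u ih => unfold forestWalk; fun_prop

/-- The forest of `m` trees whose roots are children of a vertex at `z` does not hit `K`. -/
def ForestAvoids (K : Set (Site d)) (m : ℕ) (z : Site d) (p : Marks d (ℕ × List ℕ)) : Prop :=
  ∀ c u, InForest m p c u → forestWalk z p c u ∉ K

theorem measurableSet_forestAvoids (K : Set (Site d)) (m : ℕ) (z : Site d) :
    MeasurableSet {p : Marks d (ℕ × List ℕ) | ForestAvoids K m z p} := by
  simp only [ForestAvoids, Set.ofPred_forall, imp_iff_not_or]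
  refine MeasurableSet.iInter fun c => MeasurableSet.iInter fun u => ?_
  exact (measurableSet_inForest m c u).compl.union
    (measurable_forestWalk z c u (MeasurableSet.of_discrete (s := Kᶜ)))

theorem measurable_ind_forestAvoids (K : Set (Site d)) (m : ℕ) (z : Site d) :
    Measurable fun p => ind (ForestAvoids K m z p) :=
  measurable_ind (measurableSet_forestAvoids K m z)

theorem forestAvoids_zero (K : Set (Site d)) (z : Site d) (p : Marks d (ℕ × List ℕ)) :
    ForestAvoids K 0 z p := fun _ _ h => absurd h.lt (Nat.not_lt_zero _)

theorem forestAvoids_succ (K : Set (Site d)) (m : ℕ) (z : Site d) (p : Marks d (ℕ × List ℕ)) :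
    ForestAvoids K (m + 1) z p
      ↔ ForestAvoids K 1 z p ∧ ForestAvoids K m z (p.comp shiftForest) := by
  constructor
  · refine fun h => ⟨fun c u hu => h c u ?_, fun c u hu => ?_⟩
    · rw [inForest_iff] at hu ⊢
      exact ⟨by omega, hu.2⟩
    · rw [← forestWalk_shift]
      exact h _ _ ((inForest_shift m p c u).2 hu)
  · rintro ⟨h1, h2⟩ c u hu
    rcases c with _ | c
    · refine h1 0 u ?_
      rw [inForest_iff] at hu ⊢
      exact ⟨one_pos, hu.2⟩
    · rw [forestWalk_shift]
      exact h2 c u ((inForest_shift m p c u).1 hu)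

theorem forestAvoids_one (K : Set (Site d)) (z : Site d) (p : Marks d (ℕ × List ℕ)) :
    ForestAvoids K 1 z p ↔ z + p.2 (0, []) ∉ K
      ∧ ForestAvoids K (p.1 (0, [])) (z + p.2 (0, [])) (p.comp (below 0)) := by
  constructor
  · refine fun h => ⟨h 0 [] (by simp [InForest]), fun c u hu => ?_⟩
    rw [← forestWalk_append]
    exact h _ _ ((inForest_append 1 p 0 c u).2 ⟨one_pos, hu⟩)
  · rintro ⟨h1, h2⟩ c u hu
    obtain rfl : c = 0 := by have := hu.lt; omega
    rcases List.eq_nil_or_concat u with rfl | ⟨v, j, rfl⟩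
    · exact h1
    · rw [List.concat_eq_append] at hu ⊢
      rw [forestWalk_append]
      exact h2 _ _ ((inForest_append 1 p 0 j v).1 hu).2

/-- Only the marks of the first tree matter for a forest of one tree. -/
theorem forestAvoids_one_comp (K : Set (Site d)) (z : Site d) (p : Marks d (ℕ × List ℕ)) :
    ForestAvoids K 1 z p ↔ ForestAvoids K 1 z ((p.comp (Prod.mk 0)).comp Prod.snd) := by
  have h1 : ∀ u, InForest 1 p 0 u ↔ InForest 1 ((p.comp (Prod.mk 0)).comp Prod.snd) 0 u := by
    intro u
    induction u with
    | nil => rfl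
    | cons j u ih => simp only [InForest, ih]; rfl
  have h2 : ∀ u, forestWalk z p 0 u = forestWalk z ((p.comp (Prod.mk 0)).comp Prod.snd) 0 u := by
    intro u
    induction u with
    | nil => rfl
    | cons j u ih => simp only [forestWalk, ih]; rfl
  constructor
  · intro h c u hu
    obtain rfl : c = 0 := by have := hu.lt; omega
    rw [← h2]
    exact h 0 u ((h1 u).2 hu)
  · intro h c u hu
    obtain rfl : c = 0 := by have := hu.lt; omega
    rw [h2]
    exact h 0 u ((h1 u).1 hu)

variable [NeZero d] (μ : PMF ℕ)

/-- The probability that the tree whose root is a child of a vertex at `z` does not hit `K`. -/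
def avoidProb (K : Set (Site d)) (z : Site d) : ℝ≥0∞ :=
  ∫⁻ p, ind (ForestAvoids K 1 z p) ∂(marksLaw d μ (ℕ × List ℕ))

/-- The probability that the tree whose root is a child of a vertex at `z` hits `K`. -/
def hitProb (K : Set (Site d)) (z : Site d) : ℝ≥0∞ :=
  ∫⁻ p, ind (¬ForestAvoids K 1 z p) ∂(marksLaw d μ (ℕ × List ℕ))

theorem lintegral_forestAvoids (K : Set (Site d)) (m : ℕ) (z : Site d) :
    ∫⁻ p, ind (ForestAvoids K m z p) ∂(marksLaw d μ (ℕ × List ℕ)) = avoidProb μ K z ^ m := by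
  induction m with
  | zero => simp [ind_of (forestAvoids_zero K z _)]
  | succ m ih =>
    have hT : Measurable fun p : Marks d (List ℕ) => ind (ForestAvoids K 1 z (p.comp Prod.snd)) :=
      (measurable_ind_forestAvoids K 1 z).comp (Marks.measurable_comp Prod.snd)
    have h1 : avoidProb μ K z
        = ∫⁻ p, ind (ForestAvoids K 1 z (p.comp Prod.snd)) ∂(marksLaw d μ (List ℕ)) := by
      rw [avoidProb, ← (measurePreserving_marks_comp (d := d) μ
        (Prod.mk_right_injective (β := List ℕ) 0)).lintegral_comp hT]
      simp only [← forestAvoids_one_comp]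
    have h2 : ∀ p : Marks d (ℕ × List ℕ), ind (ForestAvoids K (m + 1) z p)
        = ind (ForestAvoids K 1 z ((p.comp (Prod.mk 0)).comp Prod.snd))
          * ind (ForestAvoids K m z (p.comp shiftForest)) := by
      intro p
      rw [forestAvoids_succ K m, ind_and, forestAvoids_one_comp K z]
    rw [lintegral_congr h2, lintegral_marks_mul μ (f := Prod.mk 0) (g := shiftForest)
      (F := fun p => ind (ForestAvoids K 1 z (p.comp Prod.snd)))
      (G := fun p => ind (ForestAvoids K m z p))
      (Prod.mk_right_injective 0) shiftForest_injective (fun a b => by simp [shiftForest])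
      hT (measurable_ind_forestAvoids K m z), ih, ← h1, pow_succ']

theorem hitProb_add_avoidProb (K : Set (Site d)) (z : Site d) :
    hitProb μ K z + avoidProb μ K z = 1 := by
  rw [hitProb, avoidProb, ← lintegral_add_right _ (measurable_ind_forestAvoids K 1 z)]
  simp only [add_comm (ind (¬_)), ind_add_ind_not]
  simp

theorem avoidProb_le_one (K : Set (Site d)) (z : Site d) : avoidProb μ K z ≤ 1 :=
  le_add_self.trans (hitProb_add_avoidProb μ K z).le

end Forest

/-! ### Expected local times of forests -/

section LocalTime

theorem measurableSet_inForest_visit {d : ℕ} (m : ℕ) (z y : Site d) (c : ℕ) (u : List ℕ) :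
    MeasurableSet {p : Marks d (ℕ × List ℕ) | InForest m p c u ∧ forestWalk z p c u = y} :=
  (measurableSet_inForest m c u).inter (measurable_forestWalk z c u (MeasurableSet.singleton y))

/-- Number of visits to `y` of a forest whose roots are children of a vertex at `z`. -/
def forestLocalTime {d : ℕ} (m : ℕ) (z y : Site d) (p : Marks d (ℕ × List ℕ)) : ℝ≥0∞ :=
  ∑' c, ∑' u, ind (InForest m p c u ∧ forestWalk z p c u = y)

theorem measurable_forestLocalTime {d : ℕ} (m : ℕ) (z y : Site d) :
    Measurable (forestLocalTime m z y) :=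
  Measurable.tsum fun c => Measurable.tsum fun u =>
    measurable_ind (measurableSet_inForest_visit m z y c u)

theorem ind_not_forestAvoids_le {d : ℕ} (K : Finset (Site d)) (m : ℕ) (z : Site d)
    (p : Marks d (ℕ × List ℕ)) :
    ind (¬ForestAvoids K m z p) ≤ ∑ y ∈ K, forestLocalTime m z y p := by
  by_cases h : ForestAvoids K m z p
  · simp [h]
  · rw [ind_of (p := ¬_) h]
    simp only [ForestAvoids, not_forall, not_not] at h
    obtain ⟨c, u, hu, hK⟩ := h
    calc (1 : ℝ≥0∞) = ind (InForest m p c u ∧ forestWalk z p c u = forestWalk z p c u) := by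
          rw [ind_of ⟨hu, rfl⟩]
      _ ≤ forestLocalTime m z (forestWalk z p c u) p :=
          (ENNReal.le_tsum u).trans (ENNReal.le_tsum
            (f := fun c => ∑' u, ind (InForest m p c u ∧ forestWalk z p c u = _)) c)
      _ ≤ _ := Finset.single_le_sum (f := fun y => forestLocalTime m z y p)
          (fun _ _ => zero_le) hK

variable {d : ℕ} [NeZero d] (μ : PMF ℕ)

theorem tsum_list (G : List ℕ → ℝ≥0∞) : ∑' u, G u = G [] + ∑' c, ∑' u, G (u ++ [c]) := by
  let e : Unit ⊕ (ℕ × List ℕ) → List ℕ := Sum.elim (fun _ => []) fun q => q.2 ++ [q.1]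
  have he : Bijective e := by
    constructor
    · refine (injective_of_subsingleton _).sumElim ?_ ?_
      · rintro ⟨a, u⟩ ⟨b, v⟩ h
        simpa [and_comm] using h
      · intro a q
        simp
    · intro u
      rcases List.eq_nil_or_concat u with rfl | ⟨v, j, rfl⟩
      · exact ⟨.inl (), rfl⟩
      · exact ⟨.inr (j, v), by simp [e]⟩
  rw [← (Equiv.ofBijective e he).tsum_eq, ENNReal.summable.tsum_sum ENNReal.summable]
  simp only [Equiv.ofBijective_apply, e, Sum.elim_inl, Sum.elim_inr, tsum_fintype,
    Finset.univ_unique, Finset.sum_singleton]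
  rw [← ENNReal.tsum_prod (f := fun c u => G (u ++ [c]))]

theorem tsum_ind_lt (m : ℕ) (a : ℝ≥0∞) : ∑' c : ℕ, ind (c < m) * a = m * a := by
  rw [ENNReal.tsum_mul_right, tsum_eq_sum (s := Finset.range m) fun c hc => by
    simpa using ind_of_not (by simpa using hc)]
  congr 1
  rw [Finset.sum_congr rfl fun c hc => ind_of (Finset.mem_range.1 hc)]
  simp

theorem lintegral_nat (f : ℕ → ℝ≥0∞) : ∫⁻ n, f n ∂μ.toMeasure = ∑' n, μ n * f n := by
  rw [lintegral_countable']
  simp [PMF.toMeasure_apply_singleton, mul_comm]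

/-- The mean number of visits to `y` by generation `n` of the `c`-th tree. -/
theorem tsum_lintegral_generation (hμ : ∑' i : ℕ, (i : ℝ≥0∞) * μ i = 1) (n m c : ℕ)
    (z y : Site d) :
    ∑' u : List ℕ, ∫⁻ p, ind (u.length = n) * ind (InForest m p c u ∧ forestWalk z p c u = y)
        ∂(marksLaw d μ (ℕ × List ℕ))
      = ind (c < m) * heat (n + 1) z y := by
  induction n generalizing m c z with
  | zero =>
    rw [tsum_eq_single [] fun u hu => by simp [hu]]
    have h := lintegral_marks_head_tail (d := d) μ (i := (c, [])) (below_injective c)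
      (root_ne_below c) (F := fun _ s _ => ind (c < m) * ind (z + s = y))
      (fun n s => measurable_const)
    simp only [InForest, forestWalk, ind_and, List.length_nil, ind_true, one_mul]
    rw [h]
    simp only [lintegral_const, measure_univ, mul_one]
    rw [lintegral_const_mul _ (measurable_site _)]
    rfl
  | succ n ih =>
    rw [tsum_list]
    have h1 : ∀ c' (u : List ℕ), ∫⁻ p, ind ((u ++ [c']).length = n + 1)
          * ind (InForest m p c (u ++ [c']) ∧ forestWalk z p c (u ++ [c']) = y)
          ∂(marksLaw d μ (ℕ × List ℕ))
        = ind (c < m) * ∫⁻ s, ∫⁻ k, ∫⁻ p, ind (u.length = n)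
            * ind (InForest k p c' u ∧ forestWalk (z + s) p c' u = y)
          ∂(marksLaw d μ (ℕ × List ℕ)) ∂μ.toMeasure ∂(stepLaw d).toMeasure := by
      intro c' u
      have h2 : ∀ k s, Measurable fun p : Marks d (ℕ × List ℕ) => ind (u.length = n)
          * ind (InForest k p c' u ∧ forestWalk (z + s) p c' u = y) := fun k s =>
        measurable_const.mul (measurable_ind (measurableSet_inForest_visit k (z + s) y c' u))
      rw [← lintegral_marks_head_tail μ (i := (c, [])) (below_injective c) (root_ne_below c) h2]
      rw [← lintegral_const_mul']
      · refine lintegral_congr fun p => ?_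
        simp only [inForest_append, forestWalk_append, List.length_append, List.length_singleton,
          Nat.add_right_cancel_iff, and_assoc]
        rw [ind_and (c < m)]
        ring
      · exact ne_top_of_le_ne_top ENNReal.one_ne_top (ind_le_one _)
    simp only [h1]
    simp only [ENNReal.tsum_mul_left]
    have h3 : ∀ s k, ∑' c', ∑' u : List ℕ, ∫⁻ p, ind (u.length = n)
            * ind (InForest k p c' u ∧ forestWalk (z + s) p c' u = y)
          ∂(marksLaw d μ (ℕ × List ℕ)) = k * heat (n + 1) (z + s) y := by
      intro s k
      simp only [ih, tsum_ind_lt]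
    have h4 : ∑' c', ∑' u : List ℕ, ∫⁻ s, ∫⁻ k, ∫⁻ p, ind (u.length = n)
            * ind (InForest k p c' u ∧ forestWalk (z + s) p c' u = y)
          ∂(marksLaw d μ (ℕ × List ℕ)) ∂μ.toMeasure ∂(stepLaw d).toMeasure
        = ∫⁻ s, ∫⁻ k, (k : ℝ≥0∞) * heat (n + 1) (z + s) y ∂μ.toMeasure ∂(stepLaw d).toMeasure := by
      simp only [← h3]
      rw [lintegral_congr fun s => lintegral_tsum fun _ =>
        (measurable_of_countable _).aemeasurable, lintegral_tsum fun _ =>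
        (measurable_site _).aemeasurable]
      refine tsum_congr fun c' => ?_
      rw [← lintegral_tsum fun _ => (measurable_site _).aemeasurable]
      refine lintegral_congr fun s => ?_
      exact (lintegral_tsum fun _ => (measurable_of_countable _).aemeasurable).symm
    rw [h4]
    simp only [lintegral_nat, ← mul_assoc, ENNReal.tsum_mul_right]
    simp only [mul_comm (μ _), hμ, one_mul, List.length_nil]
    rw [ind_of_not (p := (0 = n + 1)) (by omega)]
    simp only [zero_mul, lintegral_zero, zero_add]
    congr 1
    unfold heat
    rw [iterate_succ_apply' (n := n + 1)]
    rfl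

/-- As the offspring law has mean one, each tree contributes the local time of a walk. -/
theorem lintegral_forestLocalTime (hμ : ∑' i : ℕ, (i : ℝ≥0∞) * μ i = 1) (m : ℕ) (z y : Site d) :
    ∫⁻ p, forestLocalTime m z y p ∂(marksLaw d μ (ℕ × List ℕ)) = m * greenPos z y := by
  have h1 : ∀ p : Marks d (ℕ × List ℕ), forestLocalTime m z y p
      = ∑' n, ∑' c, ∑' u : List ℕ, ind (u.length = n)
          * ind (InForest m p c u ∧ forestWalk z p c u = y) := by
    intro p
    rw [forestLocalTime]
    conv_rhs => rw [ENNReal.tsum_comm]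
    refine tsum_congr fun c => ?_
    conv_rhs => rw [ENNReal.tsum_comm]
    refine tsum_congr fun u => ?_
    rw [ENNReal.tsum_mul_right, tsum_eq_single u.length fun n hn => ind_of_not (Ne.symm hn)]
    simp
  have hm : ∀ n c (u : List ℕ), Measurable fun p : Marks d (ℕ × List ℕ) =>
      ind (u.length = n) * ind (InForest m p c u ∧ forestWalk z p c u = y) := fun n c u =>
    measurable_const.mul (measurable_ind (measurableSet_inForest_visit m z y c u))
  simp only [h1]
  rw [lintegral_tsum fun n => (Measurable.tsum fun c =>
    Measurable.tsum fun u => hm n c u).aemeasurable]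
  rw [greenPos, ← ENNReal.tsum_mul_left]
  refine tsum_congr fun n => ?_
  rw [lintegral_tsum fun c => (Measurable.tsum fun u => hm n c u).aemeasurable]
  rw [← tsum_ind_lt]
  refine tsum_congr fun c => ?_
  rw [lintegral_tsum fun u => (hm n c u).aemeasurable]
  exact tsum_lintegral_generation μ hμ n m c z y

theorem hitProb_le (hμ : ∑' i : ℕ, (i : ℝ≥0∞) * μ i = 1) (K : Finset (Site d)) (z : Site d) :
    hitProb μ K z ≤ ∑ y ∈ K, greenPos z y := by
  refine (lintegral_mono fun p => ind_not_forestAvoids_le K 1 z p).trans ?_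
  rw [lintegral_finsetSum _ fun y _ => measurable_forestLocalTime 1 z y]
  simp [lintegral_forestLocalTime μ hμ]

end LocalTime

/-! ### The offspring of the special vertices -/

section Offspring

variable (μ : PMF ℕ) (hμ : ∑' i : ℕ, (i : ℝ≥0∞) * μ i = 1)

theorem lintegral_specialLaw (F : ℕ × ℕ → ℝ≥0∞) :
    ∫⁻ c, F c ∂(specialLaw μ hμ).toMeasure
      = ∑' N, μ N * ∑ a ∈ Finset.range N, F (a, N - 1 - a) := by
  rw [lintegral_countable']
  simp only [PMF.toMeasure_apply_singleton _ _ (MeasurableSet.singleton _), specialLaw,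
    PMF.bind_apply, ← ENNReal.tsum_mul_left]
  rw [ENNReal.tsum_comm]
  refine tsum_congr fun N => ?_
  -- For `N = 0` the truncated difference `N - 1` is harmless: this value has no mass.
  rcases N with _ | N
  · have h0 : sizeBiased μ hμ 0 = 0 := by
      change ((0 : ℕ) : ℝ≥0∞) * μ 0 = 0
      simp
    simp [h0]
  have hN : sizeBiased μ hμ (N + 1) = ((N + 1 : ℕ) : ℝ≥0∞) * μ (N + 1) := rfl
  have hn0 : ((N + 1 : ℕ) : ℝ≥0∞) ≠ 0 := by exact_mod_cast Nat.succ_ne_zero N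
  rw [tsum_eq_sum (s := Finset.HasAntidiagonal.antidiagonal (N + 1 - 1)) fun c hc => by
    rw [PMF.uniformOfFinset_apply, if_neg hc, mul_zero, mul_zero]]
  simp only [Nat.add_sub_cancel]
  rw [Finset.Nat.sum_antidiagonal_eq_sum_range_succ_mk, Finset.mul_sum]
  refine Finset.sum_congr rfl fun a ha => ?_
  have hmem : (a, N - a) ∈ Finset.HasAntidiagonal.antidiagonal N := by
    simp at ha ⊢
    omega
  rw [PMF.uniformOfFinset_apply, if_pos hmem, Finset.Nat.card_antidiagonal, hN]
  calc _ = (((N + 1 : ℕ) : ℝ≥0∞) * ((N + 1 : ℕ) : ℝ≥0∞)⁻¹) * (μ (N + 1) * F (a, N - a)) := by ring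
    _ = _ := by rw [ENNReal.mul_inv_cancel hn0 (ENNReal.natCast_ne_top _), one_mul]

/-- Generating function of the number of offspring of a special vertex on the left. -/
def leftGen (r : ℝ≥0∞) : ℝ≥0∞ := ∫⁻ c, r ^ c.1 ∂(specialLaw μ hμ).toMeasure

/-- The mean of `b * r ^ a`, where `a` and `b` are the numbers of offspring of a special vertex on
the left and on the right. -/
def leftRightGen (r : ℝ≥0∞) : ℝ≥0∞ :=
  ∫⁻ c, (c.2 : ℝ≥0∞) * r ^ c.1 ∂(specialLaw μ hμ).toMeasure

/-- The truncated geometric series, without subtraction. -/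
theorem geom_sum_identity {r v : ℝ≥0∞} (h : v + r = 1) (N : ℕ) :
    v * ∑ a ∈ Finset.range N, r ^ a + r ^ N = 1 := by
  induction N with
  | zero => simp
  | succ N ih =>
    rw [Finset.sum_range_succ, mul_add, add_assoc, pow_succ', ← add_mul, h, one_mul, ih]

theorem leftRight_sum_identity {r v : ℝ≥0∞} (h : v + r = 1) (N : ℕ) :
    ∑ a ∈ Finset.range N, r ^ a
      + (∑ a ∈ Finset.range N, ((N - 1 - a : ℕ) : ℝ≥0∞) * r ^ a) * v = N := by
  induction N with
  | zero => simp
  | succ N ih =>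
    have h1 : ∑ a ∈ Finset.range (N + 1), ((N + 1 - 1 - a : ℕ) : ℝ≥0∞) * r ^ a
        = ∑ a ∈ Finset.range N, ((N - 1 - a : ℕ) : ℝ≥0∞) * r ^ a
          + ∑ a ∈ Finset.range N, r ^ a := by
      rw [Finset.sum_range_succ, ← Finset.sum_add_distrib]
      simp only [Nat.add_sub_cancel, Nat.sub_self, Nat.cast_zero, zero_mul, add_zero]
      refine Finset.sum_congr rfl fun a ha => ?_
      have : N - a = (N - 1 - a) + 1 := by
        have := Finset.mem_range.1 ha
        omega
      rw [this]
      push_cast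
      ring
    rw [h1, Finset.sum_range_succ, Nat.cast_succ]
    have h2 := geom_sum_identity h N
    generalize ∑ a ∈ Finset.range N, r ^ a = S at *
    generalize ∑ a ∈ Finset.range N, ((N - 1 - a : ℕ) : ℝ≥0∞) * r ^ a = T at *
    rw [← ih, ← h2]
    ring

/-- With `r` the probability that a tree avoids a set, this compares the hitting probability of
a vertex with that of one of its children. -/
theorem tsum_mul_pow_add_leftGen {r v : ℝ≥0∞} (h : v + r = 1) :
    ∑' N, μ N * r ^ N + leftGen μ hμ r * v = 1 := by
  rw [leftGen, lintegral_specialLaw, ← ENNReal.tsum_mul_right, ← ENNReal.tsum_add, ← μ.tsum_coe]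
  refine tsum_congr fun N => ?_
  nth_rewrite 3 [← mul_one (μ N)]
  rw [← geom_sum_identity h N]
  ring

theorem leftGen_add_leftRightGen {r v : ℝ≥0∞} (h : v + r = 1) :
    leftGen μ hμ r + leftRightGen μ hμ r * v = 1 := by
  rw [leftGen, leftRightGen, lintegral_specialLaw, lintegral_specialLaw, ← ENNReal.tsum_mul_right,
    ← ENNReal.tsum_add, ← hμ]
  refine tsum_congr fun N => ?_
  rw [← leftRight_sum_identity h N]
  ring

/-- Mean number of normal offspring of a special vertex on the right. -/
def rightMean : ℝ≥0∞ := ∫⁻ c, (c.2 : ℝ≥0∞) ∂(specialLaw μ hμ).toMeasure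

theorem leftRightGen_le {r : ℝ≥0∞} (hr : r ≤ 1) : leftRightGen μ hμ r ≤ rightMean μ hμ :=
  lintegral_mono fun _ => mul_le_of_le_one_right' (pow_le_one' hr _)

theorem rightMean_ne_top (hvar : evariance (fun i : ℕ => (i : ℝ)) μ.toMeasure < ∞) :
    rightMean μ hμ ≠ ∞ := by
  have hmem : MemLp (fun i : ℕ => (i : ℝ)) 2 μ.toMeasure :=
    (evariance_lt_top_iff_memLp (measurable_of_countable _).aestronglyMeasurable).1 hvar
  have h2 : ∑' N, μ N * (N : ℝ≥0∞) ^ 2 ≠ ∞ := by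
    have h := hmem.eLpNorm_lt_top
    rw [eLpNorm_lt_top_iff_lintegral_rpow_enorm_lt_top (by norm_num) (by norm_num),
      lintegral_nat] at h
    refine ne_top_of_le_ne_top h.ne (le_of_eq (tsum_congr fun N => ?_))
    simp
  refine ne_top_of_le_ne_top h2 ?_
  rw [rightMean, lintegral_specialLaw]
  refine ENNReal.tsum_le_tsum fun N => ?_
  gcongr
  calc ∑ a ∈ Finset.range N, ((N - 1 - a : ℕ) : ℝ≥0∞)
      ≤ ∑ a ∈ Finset.range N, (N : ℝ≥0∞) := by
        refine Finset.sum_le_sum fun a _ => ?_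
        exact_mod_cast (by omega : N - 1 - a ≤ N)
    _ = (N : ℝ≥0∞) ^ 2 := by simp [sq]

end Offspring

section Weights

variable {d : ℕ} [NeZero d] (μ : PMF ℕ) (hμ : ∑' i : ℕ, (i : ℝ≥0∞) * μ i = 1)

/-- Probability that neither a special vertex at `z` nor the trees of its offspring on the left
hit `K`. -/
def leftWeight (K : Finset (Site d)) (z : Site d) : ℝ≥0∞ :=
  ind (z ∉ K) * leftGen μ hμ (avoidProb μ K z)

/-- Mean number of the offspring on the right of a special vertex at `z`, on the event that
neither this vertex nor the trees of its offspring on the left hit `K`. -/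
def leftRightWeight (K : Finset (Site d)) (z : Site d) : ℝ≥0∞ :=
  ind (z ∉ K) * leftRightGen μ hμ (avoidProb μ K z)

theorem leftWeight_add_leftRightWeight (K : Finset (Site d)) (z : Site d) :
    leftWeight μ hμ K z + leftRightWeight μ hμ K z * hitProb μ K z = ind (z ∉ K) := by
  rw [leftWeight, leftRightWeight, mul_assoc, ← mul_add,
    leftGen_add_leftRightGen μ hμ (hitProb_add_avoidProb μ K z), mul_one]

theorem hitProb_eq_avg (K : Finset (Site d)) (x : Site d) :
    hitProb μ K x = avg (fun z => ind (z ∈ K) + leftWeight μ hμ K z * hitProb μ K z) x := by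
  have h1 : avoidProb μ K x = avg (fun z => ind (z ∉ K) * ∑' N, μ N * avoidProb μ K z ^ N) x := by
    have hF : ∀ (n : ℕ) (s : Site d), Measurable fun p : Marks d (ℕ × List ℕ) =>
        ind (x + s ∉ K) * ind (ForestAvoids K n (x + s) p) := fun n s =>
      measurable_const.mul (measurable_ind_forestAvoids _ _ _)
    have h := lintegral_marks_head_tail (d := d) μ (i := (0, [])) (below_injective 0)
      (root_ne_below 0) hF
    rw [avoidProb, avg]
    simp only [← lintegral_forestAvoids, ← lintegral_nat]
    simp only [forestAvoids_one, ind_and, SetLike.mem_coe]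
    rw [h]
    refine lintegral_congr fun s => ?_
    rw [← lintegral_const_mul _ (measurable_of_countable _)]
    exact lintegral_congr fun n => lintegral_const_mul _ (measurable_ind_forestAvoids _ _ _)
  have h2 : hitProb μ K x + avoidProb μ K x
      = avg (fun z => ind (z ∈ K) + leftWeight μ hμ K z * hitProb μ K z) x
        + avoidProb μ K x := by
    rw [hitProb_add_avoidProb]
    conv_rhs => rw [h1, ← avg_add]
    rw [← avg_const 1 x]
    congr 1
    funext z
    have h3 := tsum_mul_pow_add_leftGen μ hμ (hitProb_add_avoidProb μ K z)
    rw [leftWeight, mul_assoc, add_assoc, ← mul_add, add_comm (leftGen _ _ _ * _), h3, mul_one,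
      ind_add_ind_not]
  exact (ENNReal.add_left_inj (ne_top_of_le_ne_top ENNReal.one_ne_top
    (avoidProb_le_one μ K x))).1 h2

end Weights

/-! ### The spine and the past -/

theorem measurePreserving_head_tail {E : Type*} [MeasurableSpace E] (ν : Measure E)
    [IsProbabilityMeasure ν] :
    MeasurePreserving (fun ω : ℕ → E => (ω 0, fun k => ω (k + 1)))
      (Measure.infinitePi fun _ => ν) (ν.prod (Measure.infinitePi fun _ => ν)) := by
  have h := measurePreserving_split_infinitePi (fun _ : ℕ => ν) (f := fun _ : Unit => 0)
    (g := fun k : ℕ => k + 1) (injective_of_subsingleton _) (add_left_injective 1)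
    (fun _ b => (Nat.succ_ne_zero b).symm)
  exact ((measurePreserving_eval_infinitePi (fun _ : Unit => ν) ()).prod
    (MeasurePreserving.id _)).comp h

/-- Index of a normal vertex on one side of the spine: the spine vertex, the tree at this vertex
and the address in this tree. -/
abbrev SideIndex := ℕ × ℕ × List ℕ

/-- The index of a normal vertex after removal of the first spine vertex. -/
def shiftSpine (q : SideIndex) : SideIndex := (q.1 + 1, q.2)

theorem shiftSpine_injective : Injective shiftSpine := by
  rintro ⟨a, u⟩ ⟨b, v⟩ h
  simpa [shiftSpine] using h

/-- The marks on which the past depends: the numbers of normal offspring of the special vertices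
(at distances `1, 2, …` from the root), the jumps to the special vertices, and the marks of the
normal vertices on the left. -/
abbrev SpineData (d : ℕ) := (ℕ → ℕ × ℕ) × (ℕ → Site d) × Marks d SideIndex

/-- What is seen from the first special vertex. -/
def SpineData.tail {d : ℕ} (t : SpineData d) : SpineData d :=
  (fun k => t.1 (k + 1), fun k => t.2.1 (k + 1), t.2.2.comp shiftSpine)

/-- The marks of the left subtrees of the first special vertex. -/
def SpineData.firstForest {d : ℕ} (t : SpineData d) : Marks d (ℕ × List ℕ) :=
  t.2.2.comp (Prod.mk 0)

/-- Neither a special vertex at `z` nor its left subtrees hit `K`. -/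
def LevelAvoids {d : ℕ} (K : Set (Site d)) (z : Site d) (c : ℕ × ℕ) (p : Marks d (ℕ × List ℕ)) :
    Prop := z ∉ K ∧ ForestAvoids K c.1 z p

/-- None of the special vertices and of their left subtrees hits `K`, the walk being started
from `x`. -/
def SpineAvoids {d : ℕ} (K : Set (Site d)) (x : Site d) (t : SpineData d) : Prop :=
  ∀ k, LevelAvoids K (walk x t.2.1 (k + 1)) (t.1 k) (t.2.2.comp (Prod.mk k))

section

variable {d : ℕ}

theorem measurableSet_levelAvoids (K : Set (Site d)) (z : Site d) (c : ℕ × ℕ) :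
    MeasurableSet {p : Marks d (ℕ × List ℕ) | LevelAvoids K z c p} :=
  (MeasurableSet.const _).inter (measurableSet_forestAvoids K c.1 z)

theorem measurableSet_levelAvoids_spine (K : Set (Site d)) (x : Site d) (k : ℕ) :
    MeasurableSet {t : SpineData d |
      LevelAvoids K (walk x t.2.1 (k + 1)) (t.1 k) (t.2.2.comp (Prod.mk k))} := by
  have h : Measurable fun q : (Site d × (ℕ × ℕ)) × Marks d (ℕ × List ℕ) =>
      ind (LevelAvoids K q.1.1 q.1.2 q.2) :=
    measurable_from_prod_countable_right fun q => measurable_ind (measurableSet_levelAvoids K q.1 q.2)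
  have h2 : Measurable fun t : SpineData d => ((walk x t.2.1 (k + 1), t.1 k),
      t.2.2.comp (Prod.mk k)) := by
    refine Measurable.prodMk (Measurable.prodMk ?_ (by fun_prop)) ?_
    · exact (measurable_walk x (k + 1)).comp (by fun_prop)
    · exact (Marks.measurable_comp _).comp (by fun_prop)
  have h3 := (h.comp h2) (measurableSet_singleton (1 : ℝ≥0∞))
  refine (congrArg MeasurableSet ?_).mp h3
  ext t
  by_cases ht : LevelAvoids K (walk x t.2.1 (k + 1)) (t.1 k) (t.2.2.comp (Prod.mk k)) <;> simp [ht]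

theorem measurableSet_spineAvoids (K : Set (Site d)) (x : Site d) :
    MeasurableSet {t : SpineData d | SpineAvoids K x t} := by
  simp only [SpineAvoids, Set.ofPred_forall]
  exact MeasurableSet.iInter fun k => measurableSet_levelAvoids_spine K x k

theorem measurable_ind_spineAvoids (K : Set (Site d)) (x : Site d) :
    Measurable fun t : SpineData d => ind (SpineAvoids K x t) :=
  measurable_ind (measurableSet_spineAvoids K x)

theorem measurable_ind_levelAvoids (K : Set (Site d)) (z : Site d) (c : ℕ × ℕ) :
    Measurable fun p => ind (LevelAvoids K z c p) :=
  measurable_ind (measurableSet_levelAvoids K z c)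

theorem measurable_spine_functional (k : ℕ) (x : Site d) (f : ℕ × ℕ → Site d → ℝ≥0∞) :
    Measurable fun t : SpineData d => f (t.1 k) (walk x t.2.1 (k + 1)) := by
  have h : Measurable fun t : SpineData d => (t.1 k, walk x t.2.1 (k + 1)) :=
    Measurable.prodMk (by fun_prop) ((measurable_walk x (k + 1)).comp (by fun_prop))
  exact (measurable_of_countable (fun q : (ℕ × ℕ) × Site d => f q.1 q.2)).comp h

theorem spineAvoids_iff (K : Set (Site d)) (x : Site d) (t : SpineData d) :
    SpineAvoids K x t ↔ LevelAvoids K (x + t.2.1 0) (t.1 0) t.firstForest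
      ∧ SpineAvoids K (x + t.2.1 0) t.tail := by
  rw [SpineAvoids, ← Nat.and_forall_add_one]
  refine and_congr ?_ ?_
  · simp [walk, SpineData.firstForest]
  · simp only [walk_succ x, SpineAvoids]
    rfl

end

section Law

variable {d : ℕ} [NeZero d] (μ : PMF ℕ) (hμ : ∑' i : ℕ, (i : ℝ≥0∞) * μ i = 1)

/-- Law of the marks on which the past depends. -/
def spineDataLaw (d : ℕ) [NeZero d] (μ : PMF ℕ) (hμ : ∑' i : ℕ, (i : ℝ≥0∞) * μ i = 1) :
    Measure (SpineData d) :=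
  (Measure.infinitePi fun _ => (specialLaw μ hμ).toMeasure).prod
    ((stepsLaw d).prod (marksLaw d μ SideIndex))

instance : IsProbabilityMeasure (stepsLaw d) := by
  unfold stepsLaw
  infer_instance

instance : IsProbabilityMeasure (spineDataLaw d μ hμ) := by
  unfold spineDataLaw
  infer_instance

theorem measurePreserving_spineData_tail :
    MeasurePreserving (fun t : SpineData d => ((t.1 0, t.2.1 0, t.firstForest), t.tail))
      (spineDataLaw d μ hμ)
      (((specialLaw μ hμ).toMeasure.prod ((stepLaw d).toMeasure.prod
        (marksLaw d μ (ℕ × List ℕ)))).prod (spineDataLaw d μ hμ)) := by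
  have h1 := measurePreserving_head_tail (specialLaw μ hμ).toMeasure
  have h2 := measurePreserving_head_tail (stepLaw d).toMeasure
  have h3 := measurePreserving_marks_split (d := d) μ (f := Prod.mk (0 : ℕ)) (g := shiftSpine)
    (Prod.mk_right_injective (0 : ℕ)) shiftSpine_injective (fun a b => by simp [shiftSpine])
  exact (measurePreserving_prod_prod_comm _ _ _ _).comp
    (h1.prod ((measurePreserving_prod_prod_comm _ _ _ _).comp (h2.prod h3)))

/-- The Markov property of the walk on the spine, together with its left subtrees, at the first
special vertex. -/
theorem lintegral_spineData_markov {F : Site d → ℕ × ℕ → Marks d (ℕ × List ℕ) → ℝ≥0∞}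
    {G : Site d → SpineData d → ℝ≥0∞} (hF : ∀ z c, Measurable (F z c)) (hG : ∀ z, Measurable (G z))
    (x : Site d) :
    ∫⁻ t : SpineData d, F (x + t.2.1 0) (t.1 0) t.firstForest * G (x + t.2.1 0) t.tail
        ∂(spineDataLaw d μ hμ)
      = avg (fun z => (∫⁻ c, ∫⁻ p, F z c p ∂(marksLaw d μ (ℕ × List ℕ))
          ∂(specialLaw μ hμ).toMeasure) * ∫⁻ t, G z t ∂(spineDataLaw d μ hμ)) x := by
  have hF' : Measurable fun q : (ℕ × ℕ) × Site d × Marks d (ℕ × List ℕ) =>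
      F (x + q.2.1) q.1 q.2.2 := by
    refine (measurable_from_prod_countable_right (f := fun q : ((ℕ × ℕ) × Site d)
      × Marks d (ℕ × List ℕ) => F (x + q.1.2) q.1.1 q.2) fun q => hF (x + q.2) q.1).comp
      (by fun_prop : Measurable fun q : (ℕ × ℕ) × Site d × Marks d (ℕ × List ℕ) =>
        ((q.1, q.2.1), q.2.2))
  have hG' : Measurable fun q : Site d × SpineData d => G (x + q.1) q.2 :=
    measurable_from_prod_countable_right fun s => hG (x + s)
  have hH : Measurable fun q : ((ℕ × ℕ) × Site d × Marks d (ℕ × List ℕ)) × SpineData d =>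
      F (x + q.1.2.1) q.1.1 q.1.2.2 * G (x + q.1.2.1) q.2 :=
    (hF'.comp measurable_fst).mul (hG'.comp (by fun_prop :
      Measurable fun q : ((ℕ × ℕ) × Site d × Marks d (ℕ × List ℕ)) × SpineData d =>
        (q.1.2.1, q.2)))
  rw [show ∫⁻ t : SpineData d, F (x + t.2.1 0) (t.1 0) t.firstForest * G (x + t.2.1 0) t.tail
        ∂(spineDataLaw d μ hμ) = _ from
      (measurePreserving_spineData_tail μ hμ).lintegral_comp hH,
    lintegral_prod _ hH.aemeasurable]
  have h1 : ∀ q : (ℕ × ℕ) × Site d × Marks d (ℕ × List ℕ),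
      ∫⁻ t, F (x + q.2.1) q.1 q.2.2 * G (x + q.2.1) t ∂(spineDataLaw d μ hμ)
        = F (x + q.2.1) q.1 q.2.2 * ∫⁻ t, G (x + q.2.1) t ∂(spineDataLaw d μ hμ) :=
    fun q => lintegral_const_mul _ (hG _)
  simp only [h1]
  have hI : Measurable fun s : Site d => ∫⁻ t, G (x + s) t ∂(spineDataLaw d μ hμ) :=
    measurable_site _
  have hFI : Measurable fun q : (ℕ × ℕ) × Site d × Marks d (ℕ × List ℕ) =>
      F (x + q.2.1) q.1 q.2.2 * ∫⁻ t, G (x + q.2.1) t ∂(spineDataLaw d μ hμ) :=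
    hF'.mul (hI.comp (by fun_prop))
  rw [lintegral_prod _ hFI.aemeasurable]
  have h2 : ∀ c : ℕ × ℕ, ∫⁻ y : Site d × Marks d (ℕ × List ℕ), F (x + y.1) c y.2
        * ∫⁻ t, G (x + y.1) t ∂(spineDataLaw d μ hμ)
        ∂((stepLaw d).toMeasure.prod (marksLaw d μ (ℕ × List ℕ)))
      = ∫⁻ s, (∫⁻ p, F (x + s) c p ∂(marksLaw d μ (ℕ × List ℕ)))
          * ∫⁻ t, G (x + s) t ∂(spineDataLaw d μ hμ) ∂(stepLaw d).toMeasure := by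
    intro c
    have hm : Measurable fun y : Site d × Marks d (ℕ × List ℕ) => F (x + y.1) c y.2
        * ∫⁻ t, G (x + y.1) t ∂(spineDataLaw d μ hμ) :=
      hFI.comp (by fun_prop : Measurable fun y : Site d × Marks d (ℕ × List ℕ) => (c, y.1, y.2))
    rw [lintegral_prod _ hm.aemeasurable]
    refine lintegral_congr fun s => ?_
    dsimp only
    rw [lintegral_mul_const _ (hF (x + s) c)]
  simp only [h2]
  rw [lintegral_lintegral_swap (measurable_of_countable _).aemeasurable, avg]
  exact lintegral_congr fun s => lintegral_mul_const _ (measurable_of_countable _)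

/-- The probability that the past of the tree, for the walk started from `x`, does not
hit `K`. The root has almost surely no normal offspring on the left, so that only the special
vertices and their left subtrees matter. -/
def pastAvoidProb (K : Finset (Site d)) (x : Site d) : ℝ≥0∞ :=
  ∫⁻ t, ind (SpineAvoids K x t) ∂(spineDataLaw d μ hμ)

theorem pastAvoidProb_le_one (K : Finset (Site d)) (x : Site d) :
    pastAvoidProb μ hμ K x ≤ 1 := by
  refine (lintegral_mono fun t => ind_le_one _).trans ?_
  simp

theorem lintegral_levelAvoids (K : Finset (Site d)) (z : Site d) (c : ℕ × ℕ) :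
    ∫⁻ p, ind (LevelAvoids K z c p) ∂(marksLaw d μ (ℕ × List ℕ))
      = ind (z ∉ K) * avoidProb μ K z ^ c.1 := by
  simp only [LevelAvoids, ind_and, SetLike.mem_coe]
  rw [lintegral_const_mul _ (measurable_ind_forestAvoids _ _ _), lintegral_forestAvoids]

theorem lintegral_specialLaw_levelAvoids (K : Finset (Site d)) (z : Site d) :
    ∫⁻ c, ∫⁻ p, ind (LevelAvoids K z c p) ∂(marksLaw d μ (ℕ × List ℕ))
        ∂(specialLaw μ hμ).toMeasure = leftWeight μ hμ K z := by
  simp only [lintegral_levelAvoids]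
  exact lintegral_const_mul _ (measurable_of_countable _)

/-- The Markov property at the first special vertex. -/
theorem pastAvoidProb_eq (K : Finset (Site d)) (x : Site d) :
    pastAvoidProb μ hμ K x = weightedAvg (leftWeight μ hμ K) (pastAvoidProb μ hμ K) x := by
  rw [pastAvoidProb]
  simp only [spineAvoids_iff K x, ind_and]
  rw [lintegral_spineData_markov μ hμ (F := fun z c p => ind (LevelAvoids (K : Set (Site d)) z c p))
    (G := fun z t => ind (SpineAvoids (K : Set (Site d)) z t)) (measurable_ind_levelAvoids _)
    (measurable_ind_spineAvoids _)]
  simp only [lintegral_specialLaw_levelAvoids]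
  rfl

/-- Along the spine, the weight of the levels before level `k` is `φ`, that of level `k` is `ψ`, and
what follows has weight `w`. -/
theorem lintegral_pastAvoid_mul (K : Finset (Site d)) (f : Site d → ℝ≥0∞) (k : ℕ) (x : Site d) :
    ∫⁻ t, ind (SpineAvoids K x t) * (((t.1 k).2 : ℝ≥0∞) * f (walk x t.2.1 (k + 1)))
        ∂(spineDataLaw d μ hμ)
      = (weightedAvg (leftWeight μ hμ K))^[k]
          (avg fun z => leftRightWeight μ hμ K z * f z * pastAvoidProb μ hμ K z) x := by
  induction k generalizing x with
  | zero =>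
    have h1 : ∀ t : SpineData d, ind (SpineAvoids K x t)
          * (((t.1 0).2 : ℝ≥0∞) * f (walk x t.2.1 (0 + 1)))
        = (((t.1 0).2 : ℝ≥0∞) * f (x + t.2.1 0)
            * ind (LevelAvoids K (x + t.2.1 0) (t.1 0) t.firstForest))
          * ind (SpineAvoids K (x + t.2.1 0) t.tail) := by
      intro t
      rw [spineAvoids_iff K x, ind_and]
      simp only [walk, zero_add, Finset.sum_range_one]
      ring
    rw [lintegral_congr h1, lintegral_spineData_markov μ hμ
      (F := fun z c p => (c.2 : ℝ≥0∞) * f z * ind (LevelAvoids (K : Set (Site d)) z c p))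
      (G := fun z t => ind (SpineAvoids (K : Set (Site d)) z t))
      (fun z c => measurable_const.mul (measurable_ind_levelAvoids _ _ _))
      (measurable_ind_spineAvoids _), iterate_zero, id]
    congr 1
    funext z
    have h2 : ∀ c : ℕ × ℕ, ∫⁻ p, (c.2 : ℝ≥0∞) * f z * ind (LevelAvoids K z c p)
          ∂(marksLaw d μ (ℕ × List ℕ))
        = (ind (z ∉ K) * f z) * ((c.2 : ℝ≥0∞) * avoidProb μ K z ^ c.1) := by
      intro c
      rw [lintegral_const_mul _ (measurable_ind_levelAvoids _ _ _), lintegral_levelAvoids]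
      ring
    simp only [h2]
    rw [lintegral_const_mul _ (measurable_of_countable _), leftRightWeight, leftRightGen,
      pastAvoidProb]
    ring
  | succ k ih =>
    have h1 : ∀ t : SpineData d, ind (SpineAvoids K x t)
          * (((t.1 (k + 1)).2 : ℝ≥0∞) * f (walk x t.2.1 (k + 1 + 1)))
        = ind (LevelAvoids K (x + t.2.1 0) (t.1 0) t.firstForest)
          * (ind (SpineAvoids K (x + t.2.1 0) t.tail)
            * (((t.tail.1 k).2 : ℝ≥0∞) * f (walk (x + t.2.1 0) t.tail.2.1 (k + 1)))) := by
      intro t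
      rw [spineAvoids_iff K x, ind_and, walk_succ, mul_assoc]
      rfl
    rw [lintegral_congr h1, lintegral_spineData_markov μ hμ
      (F := fun z c p => ind (LevelAvoids (K : Set (Site d)) z c p))
      (G := fun z t => ind (SpineAvoids (K : Set (Site d)) z t)
        * (((t.1 k).2 : ℝ≥0∞) * f (walk z t.2.1 (k + 1))))
      (measurable_ind_levelAvoids _) (fun z => (measurable_ind_spineAvoids _ _).mul
        (measurable_spine_functional k z fun c z => (c.2 : ℝ≥0∞) * f z)),
      iterate_succ_apply', weightedAvg]
    simp only [lintegral_specialLaw_levelAvoids, ih]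

theorem lintegral_right_mul (f : Site d → ℝ≥0∞) (k : ℕ) (x : Site d) :
    ∫⁻ t, ((t.1 k).2 : ℝ≥0∞) * f (walk x t.2.1 (k + 1)) ∂(spineDataLaw d μ hμ)
      = rightMean μ hμ * avg^[k + 1] f x := by
  have h : ∀ k x, MeasurePreserving (fun t : SpineData d => (t.1 k, walk x t.2.1 (k + 1)))
      (spineDataLaw d μ hμ)
      ((specialLaw μ hμ).toMeasure.prod ((stepsLaw d).map fun s => walk x s (k + 1))) := fun k x =>
    (measurePreserving_eval_infinitePi (fun _ : ℕ => (specialLaw μ hμ).toMeasure) k).prod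
      (((measurable_walk x (k + 1)).measurePreserving _).comp measurePreserving_fst)
  have hm := (measurable_walk x (k + 1)).aemeasurable (μ := stepsLaw d)
  have : IsProbabilityMeasure ((stepsLaw d).map fun s => walk x s (k + 1)) :=
    Measure.isProbabilityMeasure_map hm
  rw [(h k x).lintegral_comp (f := fun q : (ℕ × ℕ) × Site d => (q.1.2 : ℝ≥0∞) * f q.2)
    (measurable_of_countable _), lintegral_prod_mul (f := fun c : ℕ × ℕ => (c.2 : ℝ≥0∞)) (g := f)
    (measurable_of_countable _).aemeasurable (measurable_site _).aemeasurable,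
    lintegral_map (measurable_site _) (measurable_walk x (k + 1)), lintegral_walk, rightMean]

/-- The probability that a given special vertex or its left subtrees hit `K`. -/
theorem lintegral_not_levelAvoids (K : Finset (Site d)) (k : ℕ) (x : Site d) :
    ∫⁻ t : SpineData d, ind (¬LevelAvoids K (walk x t.2.1 (k + 1)) (t.1 k)
        (t.2.2.comp (Prod.mk k))) ∂(spineDataLaw d μ hμ)
      = avg^[k + 1] (fun z => ∫⁻ c, ∫⁻ p, ind (¬LevelAvoids K z c p) ∂(marksLaw d μ (ℕ × List ℕ))
          ∂(specialLaw μ hμ).toMeasure) x := by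
  have hm : ∀ z c, Measurable fun p : Marks d (ℕ × List ℕ) => ind (¬LevelAvoids K z c p) :=
    fun z c => measurable_ind_not (measurableSet_levelAvoids _ z c)
  induction k generalizing x with
  | zero =>
    have h := lintegral_spineData_markov μ hμ (F := fun z c p => ind (¬LevelAvoids (K : Set (Site d)) z c p))
      (G := fun _ _ => 1) hm (fun _ => measurable_const) x
    simp only [mul_one, lintegral_const, measure_univ] at h
    simp only [walk, zero_add, Finset.sum_range_one, iterate_one]
    exact h
  | succ k ih =>
    have hG : ∀ z, Measurable fun t : SpineData d => ind (¬LevelAvoids (K : Set (Site d)) (walk z t.2.1 (k + 1))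
        (t.1 k) (t.2.2.comp (Prod.mk k))) := fun z =>
      measurable_ind_not (measurableSet_levelAvoids_spine _ z k)
    have h := lintegral_spineData_markov μ hμ (F := fun _ _ _ => 1)
      (G := fun z t => ind (¬LevelAvoids (K : Set (Site d)) (walk z t.2.1 (k + 1)) (t.1 k)
        (t.2.2.comp (Prod.mk k)))) (fun _ _ => measurable_const) hG x
    simp only [one_mul, lintegral_const, measure_univ, mul_one, ih] at h
    rw [iterate_succ_apply', ← h]
    simp only [walk_succ x]
    rfl

end Law

/-! ### Transience -/

section Transience

theorem tsum_eq_tsum_antidiagonal (f : ℕ × ℕ → ℝ≥0∞) :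
    ∑' p, f p = ∑' n, ∑ p ∈ Finset.HasAntidiagonal.antidiagonal n, f p := by
  rw [← Finset.HasAntidiagonal.sigmaAntidiagonalEquivProd.tsum_eq, ENNReal.tsum_sigma']
  refine tsum_congr fun n => ?_
  exact Finset.tsum_subtype (Finset.HasAntidiagonal.antidiagonal n) f

theorem tsum_tsum_add (B : ℕ → ℝ≥0∞) : ∑' k, ∑' m, B (k + m) = ∑' n : ℕ, ((n : ℝ≥0∞) + 1) * B n := by
  rw [← ENNReal.tsum_prod (f := fun k m => B (k + m)), tsum_eq_tsum_antidiagonal]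
  refine tsum_congr fun n => ?_
  rw [Finset.sum_congr rfl (g := fun _ => B n) fun q hq => by
    rw [Finset.HasAntidiagonal.mem_antidiagonal.1 hq]]
  simp

theorem tendsto_tsum_tsum_add {B : ℕ → ℝ≥0∞} (hB : ∑' n : ℕ, ((n : ℝ≥0∞) + 1) * B n ≠ ∞) :
    Tendsto (fun n => ∑' k, ∑' m, B (k + n + m)) atTop (𝓝 0) := by
  rw [← tsum_tsum_add] at hB
  exact ENNReal.tendsto_sum_nat_add (fun k => ∑' m, B (k + m)) hB

variable {d : ℕ} [NeZero d] (μ : PMF ℕ) (hμ : ∑' i : ℕ, (i : ℝ≥0∞) * μ i = 1)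

theorem avg_iterate_greenPos (n : ℕ) (x y : Site d) :
    avg^[n] (fun z => greenPos z y) x = ∑' m, heat (n + 1 + m) x y := by
  have h : (fun z => greenPos z y) = avg fun z => green d z y := funext fun z => (avg_green z y).symm
  rw [h, ← iterate_succ_apply, avg_iterate_green]

theorem avg_iterate_greenPos_le {B : ℕ → ℝ≥0∞} (hB : ∀ n (x y : Site d), heat n x y ≤ B n) (n : ℕ)
    (x y : Site d) : avg^[n] (fun z => greenPos z y) x ≤ ∑' k, ∑' m, B (k + n + m) := by
  rw [avg_iterate_greenPos]
  refine (ENNReal.tsum_le_tsum fun m => hB _ _ _).trans ?_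
  refine le_trans (le_of_eq (tsum_congr fun m => by ring_nf)) (ENNReal.le_tsum
    (f := fun k => ∑' m, B (k + n + m)) 1)

/-- Union bound over the vertices of the tree and the points of `K`, each of which contributes the
Green's function, and transience. -/
theorem tendsto_avg_hitProb (hμ : ∑' i : ℕ, (i : ℝ≥0∞) * μ i = 1) (hd : 5 ≤ d)
    (K : Finset (Site d)) (x : Site d) :
    Tendsto (fun n => avg^[n] (hitProb μ K) x) atTop (𝓝 0) := by
  obtain ⟨B, hB, hs⟩ := exists_heat_le (d := d) 1 (by omega)
  simp only [pow_one] at hs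
  have h : Tendsto (fun n => ∑ y ∈ K, ∑' k, ∑' m, B (k + n + m)) atTop (𝓝 0) := by
    rw [← Finset.sum_const_zero (ι := Site d) (s := K)]
    exact tendsto_finsetSum _ fun y _ => tendsto_tsum_tsum_add hs
  refine tendsto_of_tendsto_of_tendsto_of_le_of_le tendsto_const_nhds h (fun _ => zero_le)
    fun n => ?_
  refine (avg_iterate_mono (hitProb_le μ hμ K) n x).trans ?_
  rw [avg_iterate_sum]
  exact Finset.sum_le_sum fun y _ => avg_iterate_greenPos_le hB n x y

/-- By `φ + ψ v = 1`, off `K` the probability that a level hits `K` is `ψ v`, and `ψ` is bounded. -/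
theorem lintegral_not_levelAvoids_le (K : Finset (Site d)) (z : Site d) :
    ∫⁻ c, ∫⁻ p, ind (¬LevelAvoids (K : Set (Site d)) z c p) ∂(marksLaw d μ (ℕ × List ℕ))
        ∂(specialLaw μ hμ).toMeasure
      ≤ ∑ y ∈ K, (ind (z = y) + rightMean μ hμ * greenPos z y) := by
  by_cases hz : z ∈ K
  · have h1 : ∫⁻ c, ∫⁻ p, ind (¬LevelAvoids (K : Set (Site d)) z c p)
        ∂(marksLaw d μ (ℕ × List ℕ)) ∂(specialLaw μ hμ).toMeasure ≤ 1 := by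
      refine (lintegral_mono fun c => lintegral_mono fun p => ind_le_one _).trans ?_
      simp
    refine h1.trans ?_
    refine le_trans ?_ (Finset.single_le_sum (fun _ _ => zero_le) hz)
    simp
  · have h1 : ∫⁻ c, ∫⁻ p, ind (¬LevelAvoids (K : Set (Site d)) z c p)
        ∂(marksLaw d μ (ℕ × List ℕ)) ∂(specialLaw μ hμ).toMeasure + leftWeight μ hμ K z = 1 := by
      rw [← lintegral_specialLaw_levelAvoids, ← lintegral_add_left (measurable_of_countable _)]
      have h2 : ∀ c : ℕ × ℕ, ∫⁻ p, ind (¬LevelAvoids (K : Set (Site d)) z c p)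
          ∂(marksLaw d μ (ℕ × List ℕ)) + ∫⁻ p, ind (LevelAvoids (K : Set (Site d)) z c p)
          ∂(marksLaw d μ (ℕ × List ℕ)) = 1 := by
        intro c
        rw [← lintegral_add_right _ (measurable_ind_levelAvoids _ _ _)]
        simp only [add_comm (ind (¬_)), ind_add_ind_not]
        simp
      simp only [h2]
      simp
    have h2 := leftWeight_add_leftRightWeight μ hμ K z
    rw [ind_of (p := z ∉ K) hz, add_comm] at h2
    have h3 : leftWeight μ hμ K z ≠ ∞ :=
      ne_top_of_le_ne_top ENNReal.one_ne_top (le_add_self.trans h2.le)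
    rw [(ENNReal.add_left_inj h3).1 (h1.trans h2.symm), Finset.sum_add_distrib, ← Finset.mul_sum]
    refine le_trans ?_ le_add_self
    refine mul_le_mul' ?_ (hitProb_le μ hμ K z)
    rw [leftRightWeight, ind_of (p := z ∉ K) hz, one_mul]
    exact leftRightGen_le μ hμ (avoidProb_le_one μ K z)

/-- Union bound over the levels of the spine. -/
theorem one_le_pastAvoidProb_add (K : Finset (Site d)) (x : Site d) :
    1 ≤ pastAvoidProb μ hμ K x + ∑' k, avg^[k + 1]
      (fun z => ∑ y ∈ K, (ind (z = y) + rightMean μ hμ * greenPos z y)) x := by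
  have h1 : ∀ t : SpineData d, (1 : ℝ≥0∞) ≤ ind (SpineAvoids (K : Set (Site d)) x t)
      + ∑' k, ind (¬LevelAvoids (K : Set (Site d)) (walk x t.2.1 (k + 1)) (t.1 k)
        (t.2.2.comp (Prod.mk k))) := by
    intro t
    by_cases h : SpineAvoids (K : Set (Site d)) x t
    · simp [h]
    · obtain ⟨k, hk⟩ := not_forall.1 h
      refine le_add_left (le_trans ?_ (ENNReal.le_tsum k))
      rw [ind_of (p := ¬_) hk]
  have hm : ∀ k, Measurable fun t : SpineData d => ind (¬LevelAvoids (K : Set (Site d))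
      (walk x t.2.1 (k + 1)) (t.1 k) (t.2.2.comp (Prod.mk k))) := fun k =>
    measurable_ind_not (measurableSet_levelAvoids_spine _ x k)
  have h2 := lintegral_mono (μ := spineDataLaw d μ hμ) h1
  rw [lintegral_const, measure_univ, one_mul,
    lintegral_add_left (measurable_ind_spineAvoids _ _),
    lintegral_tsum fun k => (hm k).aemeasurable] at h2
  refine h2.trans (add_le_add le_rfl (ENNReal.tsum_le_tsum fun k => ?_))
  rw [lintegral_not_levelAvoids]
  exact avg_iterate_mono (lintegral_not_levelAvoids_le μ hμ K) _ _

/-- From far away, the past of the tree avoids `K` with probability close to one. -/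
theorem tendsto_avg_pastAvoidProb (hd : 5 ≤ d) (hC : rightMean μ hμ ≠ ∞) (K : Finset (Site d))
    (x : Site d) : Tendsto (fun n => avg^[n] (pastAvoidProb μ hμ K) x) atTop (𝓝 1) := by
  obtain ⟨B, hB, hs⟩ := exists_heat_le (d := d) 1 (by omega)
  simp only [pow_one] at hs
  let T : ℕ → ℝ≥0∞ := fun n => ∑ y ∈ K,
    (∑' k, ∑' m, B (k + n + m) + rightMean μ hμ * ∑' k, ∑' m, B (k + n + m))
  have hT : Tendsto T atTop (𝓝 0) := by
    rw [← Finset.sum_const_zero (ι := Site d) (s := K)]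
    refine tendsto_finsetSum _ fun y _ => ?_
    have h1 := tendsto_tsum_tsum_add hs
    simpa using h1.add (ENNReal.Tendsto.const_mul h1 (Or.inr hC))
  have hle : ∀ n, 1 ≤ avg^[n] (pastAvoidProb μ hμ K) x + T n := by
    intro n
    have h1 := avg_iterate_mono (one_le_pastAvoidProb_add μ hμ K) n x
    rw [avg_iterate_const, avg_iterate_add, avg_iterate_tsum] at h1
    refine h1.trans (add_le_add le_rfl ?_)
    simp only [← iterate_add_apply, avg_iterate_sum, avg_iterate_add, avg_iterate_const_mul]
    rw [Summable.tsum_finsetSum fun _ _ => ENNReal.summable]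
    refine Finset.sum_le_sum fun y _ => ?_
    rw [ENNReal.tsum_add, ENNReal.tsum_mul_left]
    refine add_le_add ?_ (mul_le_mul' le_rfl ?_)
    · calc ∑' k, avg^[n + (k + 1)] (fun z => ind (z = y)) x ≤ ∑' m, B (1 + n + m) :=
          ENNReal.tsum_le_tsum fun k => (hB (n + (k + 1)) x y).trans (by
            rw [show n + (k + 1) = 1 + n + k by ring])
        _ ≤ _ := ENNReal.le_tsum (f := fun k => ∑' m, B (k + n + m)) 1
    · calc ∑' k, avg^[n + (k + 1)] (fun z => greenPos z y) x
          ≤ ∑' k, ∑' m, B (k + 2 + n + m) := by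
            refine ENNReal.tsum_le_tsum fun k => ?_
            rw [avg_iterate_greenPos]
            refine ENNReal.tsum_le_tsum fun m => (hB _ x y).trans ?_
            rw [show n + (k + 1) + 1 + m = k + 2 + n + m by ring]
        _ ≤ _ := ENNReal.tsum_comp_le_tsum_of_injective (add_left_injective 2)
            fun k => ∑' m, B (k + n + m)
  have hsub : Tendsto (fun n => 1 - T n) atTop (𝓝 1) := by
    simpa using ENNReal.Tendsto.sub tendsto_const_nhds hT (Or.inl ENNReal.one_ne_top)
  refine tendsto_of_tendsto_of_tendsto_of_le_of_le hsub tendsto_const_nhds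
    (fun n => tsub_le_iff_right.2 (hle n)) fun n => ?_
  refine (avg_iterate_mono (pastAvoidProb_le_one μ hμ K) n x).trans ?_
  rw [avg_iterate_const]

/-- The identity for a fixed finite set, in terms of the marks on which the past depends. -/
theorem sum_lintegral_spine_eq_one (hd : 5 ≤ d) (hC : rightMean μ hμ ≠ ∞) {K : Finset (Site d)}
    {y : Site d} (hy : y ∈ K) :
    ∑ x ∈ K, (pastAvoidProb μ hμ K x * (ind (x = y) + greenPos x y)
      + ∑' k, ∫⁻ t, ind (SpineAvoids (K : Set (Site d)) x t)
          * (((t.1 k).2 : ℝ≥0∞) * greenPos (walk x t.2.1 (k + 1)) y) ∂(spineDataLaw d μ hμ)) = 1 := by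
  simp only [lintegral_pastAvoid_mul μ hμ K fun z => greenPos z y]
  exact sum_weightedAvg_eq_one (hitProb_eq_avg μ hμ K) (leftWeight_add_leftRightWeight μ hμ K)
    (pastAvoidProb_eq μ hμ K) (tendsto_avg_hitProb μ hμ hd K)
    (tendsto_avg_pastAvoidProb μ hμ hd hC K) hy

end Transience

/-! ### Decomposition of the infinite tree -/

/-- The potential vertices are those of the spine and the normal ones on the left and on
the right. -/
def vertexEquiv : ℕ ⊕ (SideIndex ⊕ SideIndex) ≃ Vertex where
  toFun
    | .inl k => .spine k
    | .inr (.inl q) => .normal ⟨.past, q.1, q.2.1, q.2.2⟩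
    | .inr (.inr q) => .normal ⟨.future, q.1, q.2.1, q.2.2⟩
  invFun
    | .spine k => .inl k
    | .normal ⟨.past, k, c, u⟩ => .inr (.inl (k, c, u))
    | .normal ⟨.future, k, c, u⟩ => .inr (.inr (k, c, u))
  left_inv := by rintro (k | q | q) <;> rfl
  right_inv := by rintro (k | ⟨_ | _, k, c, u⟩) <;> rfl

instance : Countable Vertex := vertexEquiv.symm.injective.countable

namespace TreeData

variable {d : ℕ} (τ : TreeData d)

/-- The marks on which the past depends, apart from those at the root. -/
def spineData : SpineData d :=
  (fun k => τ.1 (k + 1), fun k => τ.2.2 (.spine (k + 1)),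
    (fun q => τ.2.1 ⟨.past, q.1 + 1, q.2.1, q.2.2⟩,
      fun q => τ.2.2 (.normal ⟨.past, q.1 + 1, q.2.1, q.2.2⟩)))

/-- The marks of the normal vertices on the right. -/
def futureMarks : Marks d SideIndex :=
  (fun q => τ.2.1 ⟨.future, q.1, q.2.1, q.2.2⟩,
    fun q => τ.2.2 (.normal ⟨.future, q.1, q.2.1, q.2.2⟩))

theorem hasNormal_past (k c : ℕ) (u : List ℕ) :
    τ.HasNormal .past (k + 1) c u
      ↔ InForest (τ.spineData.1 k).1 (τ.spineData.2.2.comp (Prod.mk k)) c u := by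
  induction u with
  | nil => rfl
  | cons j u ih =>
    simp only [HasNormal, InForest, ih]
    rfl

theorem normalWalk_past (x : Site d) (k c : ℕ) (u : List ℕ) :
    τ.normalWalk x .past (k + 1) c u
      = forestWalk (walk x τ.spineData.2.1 (k + 1)) (τ.spineData.2.2.comp (Prod.mk k)) c u := by
  induction u with
  | nil => rfl
  | cons j u ih =>
    simp only [normalWalk, forestWalk, ih]
    rfl

theorem hasNormal_future (k c : ℕ) (u : List ℕ) :
    τ.HasNormal .future k c u ↔ InForest (τ.1 k).2 (τ.futureMarks.comp (Prod.mk k)) c u := by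
  induction u with
  | nil => rfl
  | cons j u ih =>
    simp only [HasNormal, InForest, ih]
    rfl

theorem normalWalk_future (x : Site d) (k c : ℕ) (u : List ℕ) :
    τ.normalWalk x .future k c u
      = forestWalk (τ.spineWalk x k) (τ.futureMarks.comp (Prod.mk k)) c u := by
  induction u with
  | nil => rfl
  | cons j u ih =>
    simp only [normalWalk, forestWalk, ih]
    rfl

theorem hasNormal_lt {side : Side} {k c : ℕ} {u : List ℕ} (h : τ.HasNormal side k c u) :
    c < τ.spineOffspring side k := by
  induction u with
  | nil => exact h
  | cons j u ih => exact ih h.1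

theorem disjoint_pastRange_iff (x : Site d) (K : Set (Site d)) :
    Disjoint (τ.pastRange x) K ↔ ∀ v, v ∈ τ.past → τ.treeWalk x v ∉ K := by
  rw [pastRange, Set.disjoint_left, Set.forall_mem_image]

theorem disjoint_pastRange_iff_spineAvoids (h0 : (τ.1 0).1 = 0) (x : Site d) (K : Set (Site d)) :
    Disjoint (τ.pastRange x) K ↔ SpineAvoids K x τ.spineData := by
  rw [disjoint_pastRange_iff]
  constructor
  · refine fun h k => ⟨?_, fun c u hu => ?_⟩
    · exact h (.spine (k + 1)) (Nat.succ_ne_zero k)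
    · rw [← normalWalk_past]
      exact h (.normal ⟨.past, k + 1, c, u⟩) ⟨rfl, (τ.hasNormal_past k c u).2 hu⟩
  · rintro h (k | ⟨side, k, c, u⟩) hv
    · obtain ⟨k, rfl⟩ := Nat.exists_eq_succ_of_ne_zero hv
      exact (h k).1
    · obtain ⟨rfl, hn⟩ : side = .past ∧ τ.HasNormal side k c u := hv
      rcases k with _ | k
      · have := τ.hasNormal_lt hn
        rw [spineOffspring, h0] at this
        omega
      · have h1 := (h k).2 c u ((τ.hasNormal_past k c u).1 hn)
        rw [← normalWalk_past] at h1
        exact h1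

theorem futureLocalTime_eq (x y : Site d) :
    τ.futureLocalTime x y = ind (x = y) + ∑' k, forestLocalTime (τ.1 k).2 (τ.spineWalk x k) y
      (τ.futureMarks.comp (Prod.mk k)) := by
  classical
  have h1 : τ.futureLocalTime x y = ∑' v : Vertex, ind (v ∈ τ.future ∧ τ.treeWalk x v = y) := by
    rw [futureLocalTime, tsum_subtype τ.future fun v => ind (τ.treeWalk x v = y)]
    refine tsum_congr fun v => ?_
    by_cases h : v ∈ τ.future <;> simp [h]
  have h2 : ∀ k, ind (Vertex.spine k ∈ τ.future ∧ τ.treeWalk x (.spine k) = y)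
      = ind (k = 0) * ind (τ.spineWalk x k = y) := by
    intro k
    rw [← ind_and]
    rfl
  have h3 : ∀ q : SideIndex, ind (Vertex.normal ⟨.past, q.1, q.2.1, q.2.2⟩ ∈ τ.future
      ∧ τ.treeWalk x (.normal ⟨.past, q.1, q.2.1, q.2.2⟩) = y) = 0 := by
    refine fun q => ind_of_not ?_
    rintro ⟨⟨h, -⟩, -⟩
    cases h
  have h4 : ∀ q : SideIndex, ind (Vertex.normal ⟨.future, q.1, q.2.1, q.2.2⟩ ∈ τ.future
      ∧ τ.treeWalk x (.normal ⟨.future, q.1, q.2.1, q.2.2⟩) = y)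
      = ind (InForest (τ.1 q.1).2 (τ.futureMarks.comp (Prod.mk q.1)) q.2.1 q.2.2
        ∧ forestWalk (τ.spineWalk x q.1) (τ.futureMarks.comp (Prod.mk q.1)) q.2.1 q.2.2 = y) := by
    intro q
    congr 1
    rw [← hasNormal_future, ← normalWalk_future]
    refine propext (and_congr ⟨fun h => h.2, fun h => ⟨rfl, h⟩⟩ Iff.rfl)
  rw [h1, ← vertexEquiv.tsum_eq, ENNReal.summable.tsum_sum ENNReal.summable,
    ENNReal.summable.tsum_sum ENNReal.summable]
  simp only [vertexEquiv, Equiv.coe_fn_mk, h2, h3, h4, tsum_zero, zero_add]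
  congr 1
  · exact tsum_ind_mul (fun k => ind (τ.spineWalk x k = y)) 0 |>.trans (by simp [spineWalk, walk])
  · refine (ENNReal.tsum_prod (f := fun k (r : ℕ × List ℕ) =>
      ind (InForest (τ.1 k).2 (τ.futureMarks.comp (Prod.mk k)) r.1 r.2
        ∧ forestWalk (τ.spineWalk x k) (τ.futureMarks.comp (Prod.mk k)) r.1 r.2 = y))).trans ?_
    refine tsum_congr fun k => ?_
    rw [forestLocalTime, ENNReal.tsum_prod (f := fun c u =>
      ind (InForest (τ.1 k).2 (τ.futureMarks.comp (Prod.mk k)) c u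
        ∧ forestWalk (τ.spineWalk x k) (τ.futureMarks.comp (Prod.mk k)) c u = y))]

/-- The mean of `futureLocalTime` given the walk on the spine and the numbers of offspring of the
spine vertices: each normal offspring contributes the local time of a walk. -/
def meanFutureLocalTime [NeZero d] (x y : Site d) : ℝ≥0∞ :=
  ind (x = y) + ∑' i, (τ.spineOffspring .future i : ℝ≥0∞) * greenPos (τ.spineWalk x i) y

end TreeData

section Law

variable {d : ℕ} [NeZero d] (μ : PMF ℕ) (hμ : ∑' i : ℕ, (i : ℝ≥0∞) * μ i = 1)

instance : IsProbabilityMeasure (treeLaw d μ hμ) := by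
  unfold treeLaw
  infer_instance

theorem measurePreserving_prod_left_comm {α β γ : Type*} [MeasurableSpace α] [MeasurableSpace β]
    [MeasurableSpace γ] (a : Measure α) (b : Measure β) (c : Measure γ)
    [SFinite a] [SFinite b] [SFinite c] :
    MeasurePreserving (fun p : α × (β × γ) => (p.2.1, (p.1, p.2.2)))
      (a.prod (b.prod c)) (b.prod (a.prod c)) :=
  (measurePreserving_prodAssoc b a c).comp ((Measure.measurePreserving_swap.prod
    (MeasurePreserving.id c)).comp ((measurePreserving_prodAssoc a b c).symm))

/-- The offspring numbers of the root, the marks on which the past depends and the marks of the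
normal vertices on the right are independent. -/
theorem measurePreserving_treeData :
    MeasurePreserving (fun τ : TreeData d => (τ.1 0, (τ.spineData, τ.futureMarks)))
      (treeLaw d μ hμ)
      ((spineLaw μ hμ 0).toMeasure.prod ((spineDataLaw d μ hμ).prod (marksLaw d μ SideIndex))) := by
  have hC : MeasurePreserving (fun C : ℕ → ℕ × ℕ => (C 0, fun k => C (k + 1)))
      (Measure.infinitePi fun k => (spineLaw μ hμ k).toMeasure)
      ((spineLaw μ hμ 0).toMeasure.prod
        (Measure.infinitePi fun _ => (specialLaw μ hμ).toMeasure)) :=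
    ((measurePreserving_eval_infinitePi (fun _ : Unit => (spineLaw μ hμ 0).toMeasure) ()).prod
      (MeasurePreserving.id _)).comp
      (measurePreserving_split_infinitePi (fun k : ℕ => (spineLaw μ hμ k).toMeasure)
        (f := fun _ : Unit => 0) (g := fun k : ℕ => k + 1) (injective_of_subsingleton _)
        (add_left_injective 1) (fun _ b => (Nat.succ_ne_zero b).symm))
  have hp : Injective fun q : SideIndex => (⟨.past, q.1 + 1, q.2.1, q.2.2⟩ : NormalVertex) := by
    rintro ⟨k, c, u⟩ ⟨k', c', u'⟩ h
    simpa using h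
  have hf : Injective fun q : SideIndex => (⟨.future, q.1, q.2.1, q.2.2⟩ : NormalVertex) := by
    rintro ⟨k, c, u⟩ ⟨k', c', u'⟩ h
    simpa using h
  have hV := measurePreserving_split_infinitePi (fun _ : NormalVertex => μ.toMeasure) hp hf
    (fun a b => by simp)
  have hN : Injective Vertex.normal := fun v w h => by simpa using h
  have hJ1 := measurePreserving_split_infinitePi (fun _ : Vertex => (stepLaw d).toMeasure)
    (f := fun k => Vertex.spine (k + 1)) (g := Vertex.normal) (fun a b h => by simpa using h) hN
    (fun a b => by simp)
  have hJ2 := measurePreserving_split_infinitePi (fun _ : NormalVertex => (stepLaw d).toMeasure)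
    hp hf (fun a b => by simp)
  have hJ := ((MeasurePreserving.id (stepsLaw d)).prod hJ2).comp hJ1
  have h1 := (measurePreserving_prodAssoc _ _ _).symm.comp
    (((MeasurePreserving.id _).prod (measurePreserving_prod_prod_comm _ _ _ _)).comp
      ((measurePreserving_prod_left_comm _ _ _).comp (hV.prod hJ)))
  exact ((MeasurePreserving.id _).prod (measurePreserving_prodAssoc _ _ _).symm).comp
    ((measurePreserving_prodAssoc _ _ _).comp (hC.prod h1))

end Law

/-! ### The identity for a fixed finite set -/

section FixedSet

variable {d : ℕ}

theorem measurable_forestLocalTime_spine (k : ℕ) (x y : Site d) :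
    Measurable fun q : SpineData d × Marks d SideIndex => forestLocalTime (q.1.1 k).2
      (walk x q.1.2.1 (k + 1)) y (q.2.comp (Prod.mk (k + 1))) := by
  have h1 : Measurable fun q : ((ℕ × ℕ) × Site d) × Marks d (ℕ × List ℕ) =>
      forestLocalTime q.1.1.2 q.1.2 y q.2 :=
    measurable_from_prod_countable_right fun q => measurable_forestLocalTime q.1.2 q.2 y
  have h2 : Measurable fun q : SpineData d × Marks d SideIndex =>
      ((q.1.1 k, walk x q.1.2.1 (k + 1)), q.2.comp (Prod.mk (k + 1))) :=
    Measurable.prodMk (Measurable.prodMk (by fun_prop)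
      ((measurable_walk x (k + 1)).comp (by fun_prop)))
      ((Marks.measurable_comp _).comp measurable_snd)
  exact h1.comp h2

/-- The local time at `y` of the future when the root is at `x`, as a function of the independent
parts of the tree. -/
def futureFunctional (x y : Site d) (c : ℕ × ℕ) (t : SpineData d) (f : Marks d SideIndex) :
    ℝ≥0∞ :=
  ind (x = y) + (forestLocalTime c.2 x y (f.comp (Prod.mk 0))
    + ∑' k, forestLocalTime (t.1 k).2 (walk x t.2.1 (k + 1)) y (f.comp (Prod.mk (k + 1))))

theorem measurable_futureFunctional (x y : Site d) :
    Measurable fun q : (ℕ × ℕ) × SpineData d × Marks d SideIndex =>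
      futureFunctional x y q.1 q.2.1 q.2.2 := by
  unfold futureFunctional
  refine measurable_const.add (Measurable.add ?_ (Measurable.tsum fun k => ?_))
  · exact measurable_from_prod_countable_right (f := fun q : (ℕ × ℕ) × SpineData d
      × Marks d SideIndex => forestLocalTime q.1.2 x y (q.2.2.comp (Prod.mk 0))) fun c =>
      (measurable_forestLocalTime c.2 x y).comp ((Marks.measurable_comp _).comp measurable_snd)
  · exact (measurable_forestLocalTime_spine k x y).comp measurable_snd

theorem TreeData.futureLocalTime_eq_functional (τ : TreeData d) (x y : Site d) :
    τ.futureLocalTime x y = futureFunctional x y (τ.1 0) τ.spineData τ.futureMarks := by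
  rw [τ.futureLocalTime_eq, tsum_eq_zero_add' ENNReal.summable]
  simp [futureFunctional, TreeData.spineWalk, walk, TreeData.spineData]

variable [NeZero d] (μ : PMF ℕ) (hμ : ∑' i : ℕ, (i : ℝ≥0∞) * μ i = 1)

theorem ae_spineOffspring_past_zero : ∀ᵐ τ ∂(treeLaw d μ hμ), (τ.1 0).1 = 0 := by
  have h0 : ∀ᵐ c ∂(spineLaw μ hμ 0).toMeasure, c.1 = 0 := by
    rw [spineLaw, ← PMF.toMeasure_map _ _ (measurable_of_countable _),
      ae_map_iff (measurable_of_countable _).aemeasurable (MeasurableSet.of_discrete)]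
    exact ae_of_all _ fun _ => rfl
  have h1 : MeasurePreserving (fun τ : TreeData d => τ.1 0) (treeLaw d μ hμ)
      (spineLaw μ hμ 0).toMeasure :=
    measurePreserving_fst.comp (measurePreserving_treeData μ hμ)
  exact h1.quasiMeasurePreserving.ae h0

theorem lintegral_spineLaw_zero (F : ℕ × ℕ → ℝ≥0∞) :
    ∫⁻ c, F c ∂(spineLaw μ hμ 0).toMeasure = ∑' n, μ n * F (0, n) := by
  rw [spineLaw, ← PMF.toMeasure_map _ _ (measurable_of_countable _),
    lintegral_map (measurable_of_countable _) (measurable_of_countable _), lintegral_nat]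

/-- The mean of `futureFunctional` over the marks of the normal vertices on the right. -/
def meanFutureFunctional (x y : Site d) (c : ℕ × ℕ) (t : SpineData d) : ℝ≥0∞ :=
  ind (x = y) + ((c.2 : ℝ≥0∞) * greenPos x y
    + ∑' k, ((t.1 k).2 : ℝ≥0∞) * greenPos (walk x t.2.1 (k + 1)) y)

theorem measurable_meanFutureFunctional (x y : Site d) :
    Measurable fun q : (ℕ × ℕ) × SpineData d => meanFutureFunctional x y q.1 q.2 := by
  unfold meanFutureFunctional
  refine measurable_const.add (Measurable.add ?_ (Measurable.tsum fun k => ?_))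
  · exact (measurable_of_countable fun c : ℕ × ℕ => (c.2 : ℝ≥0∞) * greenPos x y).comp measurable_fst
  · exact (measurable_spine_functional k x fun c z => (c.2 : ℝ≥0∞) * greenPos z y).comp
      measurable_snd

theorem lintegral_futureFunctional (hμ : ∑' i : ℕ, (i : ℝ≥0∞) * μ i = 1) (x y : Site d)
    (c : ℕ × ℕ) (t : SpineData d) :
    ∫⁻ f, futureFunctional x y c t f ∂(marksLaw d μ SideIndex) = meanFutureFunctional x y c t := by
  have h1 : ∀ k m z, Measurable fun f : Marks d SideIndex =>
      forestLocalTime m z y (f.comp (Prod.mk k)) := fun k m z =>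
    (measurable_forestLocalTime m z y).comp (Marks.measurable_comp _)
  have h2 : ∀ k m z, ∫⁻ f : Marks d SideIndex, forestLocalTime m z y (f.comp (Prod.mk k))
      ∂(marksLaw d μ SideIndex) = m * greenPos z y := by
    intro k m z
    rw [← lintegral_forestLocalTime μ hμ]
    exact (measurePreserving_marks_comp (d := d) μ (Prod.mk_right_injective k)).lintegral_comp
      (measurable_forestLocalTime m z y)
  unfold futureFunctional meanFutureFunctional
  rw [lintegral_add_left measurable_const, lintegral_add_left (h1 _ _ _),
    lintegral_tsum fun k => (h1 _ _ _).aemeasurable]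
  simp only [h2, lintegral_const, measure_univ, mul_one]

theorem TreeData.meanFutureLocalTime_eq_functional (τ : TreeData d) (x y : Site d) :
    τ.meanFutureLocalTime x y = meanFutureFunctional x y (τ.1 0) τ.spineData := by
  rw [TreeData.meanFutureLocalTime, tsum_eq_zero_add' ENNReal.summable]
  simp [meanFutureFunctional, TreeData.spineWalk, walk, TreeData.spineData,
    TreeData.spineOffspring]

theorem lintegral_prod_prod {α β γ : Type*} [MeasurableSpace α] [MeasurableSpace β]
    [MeasurableSpace γ] {a : Measure α} {b : Measure β} {c : Measure γ} [SFinite a] [SFinite b]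
    [SFinite c] {F : α → β → γ → ℝ≥0∞} (hF : Measurable fun q : α × β × γ => F q.1 q.2.1 q.2.2) :
    ∫⁻ q : α × β × γ, F q.1 q.2.1 q.2.2 ∂(a.prod (b.prod c))
      = ∫⁻ x, ∫⁻ y, ∫⁻ z, F x y z ∂c ∂b ∂a := by
  rw [lintegral_prod _ hF.aemeasurable]
  exact lintegral_congr fun x => lintegral_prod _ (hF.comp measurable_prodMk_left).aemeasurable

theorem lintegral_avoid_futureFunctional (K : Set (Site d)) (x y : Site d) :
    ∫⁻ τ, ind (Disjoint (τ.pastRange x) K) * τ.futureLocalTime x y ∂(treeLaw d μ hμ)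
      = ∫⁻ c, ∫⁻ t, ind (SpineAvoids K x t) * meanFutureFunctional x y c t
          ∂(spineDataLaw d μ hμ) ∂(spineLaw μ hμ 0).toMeasure := by
  have h1 : ∀ᵐ τ ∂(treeLaw d μ hμ), ind (Disjoint (τ.pastRange x) K) * τ.futureLocalTime x y
      = ind (SpineAvoids K x τ.spineData)
        * futureFunctional x y (τ.1 0) τ.spineData τ.futureMarks := by
    filter_upwards [ae_spineOffspring_past_zero μ hμ] with τ h0
    rw [τ.disjoint_pastRange_iff_spineAvoids h0, τ.futureLocalTime_eq_functional]
  have hH : Measurable fun q : (ℕ × ℕ) × SpineData d × Marks d SideIndex =>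
      ind (SpineAvoids K x q.2.1) * futureFunctional x y q.1 q.2.1 q.2.2 :=
    ((measurable_ind_spineAvoids K x).comp (measurable_fst.comp measurable_snd)).mul
      (measurable_futureFunctional x y)
  rw [lintegral_congr_ae h1]
  refine ((measurePreserving_treeData μ hμ).lintegral_comp hH).trans ?_
  rw [lintegral_prod_prod (F := fun c t f => ind (SpineAvoids K x t) * futureFunctional x y c t f) hH]
  refine lintegral_congr fun c => lintegral_congr fun t => ?_
  rw [lintegral_const_mul', lintegral_futureFunctional μ hμ]
  exact ne_top_of_le_ne_top ENNReal.one_ne_top (ind_le_one _)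

theorem lintegral_avoid_meanFutureFunctional (K : Set (Site d)) (x y : Site d) :
    ∫⁻ τ, ind (Disjoint (τ.pastRange x) K) * τ.meanFutureLocalTime x y ∂(treeLaw d μ hμ)
      = ∫⁻ c, ∫⁻ t, ind (SpineAvoids K x t) * meanFutureFunctional x y c t
          ∂(spineDataLaw d μ hμ) ∂(spineLaw μ hμ 0).toMeasure := by
  have h1 : ∀ᵐ τ ∂(treeLaw d μ hμ), ind (Disjoint (τ.pastRange x) K) * τ.meanFutureLocalTime x y
      = ind (SpineAvoids K x τ.spineData) * meanFutureFunctional x y (τ.1 0) τ.spineData := by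
    filter_upwards [ae_spineOffspring_past_zero μ hμ] with τ h0
    rw [τ.disjoint_pastRange_iff_spineAvoids h0, τ.meanFutureLocalTime_eq_functional]
  have hH : Measurable fun q : (ℕ × ℕ) × SpineData d =>
      ind (SpineAvoids K x q.2) * meanFutureFunctional x y q.1 q.2 :=
    ((measurable_ind_spineAvoids K x).comp measurable_snd).mul (measurable_meanFutureFunctional x y)
  have hP : MeasurePreserving (fun τ : TreeData d => (τ.1 0, τ.spineData)) (treeLaw d μ hμ)
      ((spineLaw μ hμ 0).toMeasure.prod (spineDataLaw d μ hμ)) :=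
    ((MeasurePreserving.id _).prod measurePreserving_fst).comp (measurePreserving_treeData μ hμ)
  rw [lintegral_congr_ae h1]
  refine (hP.lintegral_comp hH).trans ?_
  rw [lintegral_prod _ hH.aemeasurable]

theorem lintegral_avoid_eq (K : Finset (Site d)) (x y : Site d) :
    ∫⁻ c, ∫⁻ t, ind (SpineAvoids (K : Set (Site d)) x t) * meanFutureFunctional x y c t
          ∂(spineDataLaw d μ hμ) ∂(spineLaw μ hμ 0).toMeasure
      = pastAvoidProb μ hμ K x * (ind (x = y) + greenPos x y)
      + ∑' k, ∫⁻ t, ind (SpineAvoids (K : Set (Site d)) x t)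
          * (((t.1 k).2 : ℝ≥0∞) * greenPos (walk x t.2.1 (k + 1)) y) ∂(spineDataLaw d μ hμ) := by
  have hS := measurable_ind_spineAvoids (K : Set (Site d)) x
  have hm : ∀ k, Measurable fun t : SpineData d => ind (SpineAvoids (K : Set (Site d)) x t)
      * (((t.1 k).2 : ℝ≥0∞) * greenPos (walk x t.2.1 (k + 1)) y) := fun k =>
    hS.mul (measurable_spine_functional k x fun c z => (c.2 : ℝ≥0∞) * greenPos z y)
  have h1 : ∀ c : ℕ × ℕ, ∫⁻ t, ind (SpineAvoids (K : Set (Site d)) x t)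
        * meanFutureFunctional x y c t ∂(spineDataLaw d μ hμ)
      = pastAvoidProb μ hμ K x * ind (x = y)
        + pastAvoidProb μ hμ K x * greenPos x y * c.2
        + ∑' k, ∫⁻ t, ind (SpineAvoids (K : Set (Site d)) x t)
          * (((t.1 k).2 : ℝ≥0∞) * greenPos (walk x t.2.1 (k + 1)) y) ∂(spineDataLaw d μ hμ) := by
    intro c
    simp only [meanFutureFunctional, mul_add, ← ENNReal.tsum_mul_left]
    rw [lintegral_add_left (hS.mul_const _), lintegral_add_left (hS.mul_const _),
      lintegral_mul_const _ hS, lintegral_mul_const _ hS, lintegral_tsum fun k => (hm k).aemeasurable,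
      pastAvoidProb]
    ring
  simp only [h1]
  rw [lintegral_add_right _ measurable_const, lintegral_add_left measurable_const]
  simp only [lintegral_const, measure_univ, mul_one]
  rw [lintegral_const_mul _ (measurable_of_countable _), lintegral_spineLaw_zero]
  simp only [mul_comm (μ _), hμ]
  ring

theorem sum_lintegral_avoid_futureLocalTime (hd : 5 ≤ d) (hC : rightMean μ hμ ≠ ∞)
    {K : Finset (Site d)} {y : Site d} (hy : y ∈ K) :
    ∑ x ∈ K, ∫⁻ τ, ind (Disjoint (τ.pastRange x) (K : Set (Site d))) * τ.futureLocalTime x y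
      ∂(treeLaw d μ hμ) = 1 := by
  simp only [lintegral_avoid_futureFunctional, lintegral_avoid_eq]
  exact sum_lintegral_spine_eq_one μ hμ hd hC hy

theorem sum_lintegral_avoid_meanFutureLocalTime (hd : 5 ≤ d) (hC : rightMean μ hμ ≠ ∞)
    {K : Finset (Site d)} {y : Site d} (hy : y ∈ K) :
    ∑ x ∈ K, ∫⁻ τ, ind (Disjoint (τ.pastRange x) (K : Set (Site d))) * τ.meanFutureLocalTime x y
      ∂(treeLaw d μ hμ) = 1 := by
  simp only [lintegral_avoid_meanFutureFunctional, lintegral_avoid_eq]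
  exact sum_lintegral_spine_eq_one μ hμ hd hC hy

end FixedSet

/-! ### Measurability and translation invariance -/

namespace TreeData

variable {d : ℕ}

theorem measurableSet_hasNormal (side : Side) (k c : ℕ) (u : List ℕ) :
    MeasurableSet {τ : TreeData d | τ.HasNormal side k c u} := by
  induction u with
  | nil =>
    cases side
    · exact measurableSet_lt measurable_const
        (by fun_prop : Measurable fun τ : TreeData d => (τ.1 k).1)
    · exact measurableSet_lt measurable_const
        (by fun_prop : Measurable fun τ : TreeData d => (τ.1 k).2)
  | cons j u ih =>
    exact ih.inter (measurableSet_lt measurable_const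
      (by fun_prop : Measurable fun τ : TreeData d => τ.2.1 ⟨side, k, c, u⟩))

theorem measurable_spineWalk (x : Site d) (k : ℕ) :
    Measurable fun τ : TreeData d => τ.spineWalk x k :=
  (measurable_walk x k).comp (by fun_prop)

theorem measurable_treeWalk (x : Site d) (v : Vertex) :
    Measurable fun τ : TreeData d => τ.treeWalk x v := by
  rcases v with k | ⟨side, k, c, u⟩
  · exact measurable_spineWalk x k
  · induction u with
    | nil =>
      exact (measurable_spineWalk x k).add
        (by fun_prop : Measurable fun τ : TreeData d => τ.2.2 (.normal ⟨side, k, c, []⟩))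
    | cons j u ih =>
      exact ih.add
        (by fun_prop : Measurable fun τ : TreeData d => τ.2.2 (.normal ⟨side, k, c, j :: u⟩))

theorem measurableSet_mem_past (v : Vertex) : MeasurableSet {τ : TreeData d | v ∈ τ.past} := by
  rcases v with k | ⟨side, k, c, u⟩
  · exact MeasurableSet.const _
  · exact (MeasurableSet.const _).inter (measurableSet_hasNormal side k c u)

theorem measurableSet_mem_future (v : Vertex) :
    MeasurableSet {τ : TreeData d | v ∈ τ.future} := by
  rcases v with k | ⟨side, k, c, u⟩
  · exact MeasurableSet.const _
  · exact (MeasurableSet.const _).inter (measurableSet_hasNormal side k c u)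

theorem measurableSet_disjoint_pastRange (x : Site d) (K : Set (Site d)) :
    MeasurableSet {τ : TreeData d | Disjoint (τ.pastRange x) K} := by
  simp only [disjoint_pastRange_iff, Set.ofPred_forall, imp_iff_not_or]
  refine MeasurableSet.iInter fun v => ?_
  exact (measurableSet_mem_past v).compl.union
    (measurable_treeWalk x v (MeasurableSet.of_discrete (s := Kᶜ)))

theorem futureLocalTime_eq_tsum (τ : TreeData d) (x y : Site d) :
    τ.futureLocalTime x y = ∑' v : Vertex, ind (v ∈ τ.future ∧ τ.treeWalk x v = y) := by
  rw [futureLocalTime, tsum_subtype τ.future fun v => ind (τ.treeWalk x v = y)]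
  refine tsum_congr fun v => ?_
  by_cases h : v ∈ τ.future <;> simp [h]

theorem measurable_futureLocalTime (x y : Site d) :
    Measurable fun τ : TreeData d => τ.futureLocalTime x y := by
  simp only [futureLocalTime_eq_tsum]
  exact Measurable.tsum fun v => measurable_ind ((measurableSet_mem_future v).inter
    (measurable_treeWalk x v (measurableSet_singleton y)))

theorem measurable_meanFutureLocalTime [NeZero d] (x y : Site d) :
    Measurable fun τ : TreeData d => τ.meanFutureLocalTime x y := by
  refine measurable_const.add (Measurable.tsum fun i => Measurable.mul ?_ ?_)
  · exact (measurable_of_countable fun c : ℕ × ℕ => (c.2 : ℝ≥0∞)).comp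
      (by fun_prop : Measurable fun τ : TreeData d => τ.1 i)
  · exact (measurable_site fun z => greenPos z y).comp (measurable_spineWalk x i)

theorem spineWalk_add (τ : TreeData d) (x z : Site d) (k : ℕ) :
    τ.spineWalk (x + z) k = τ.spineWalk x k + z := by
  simp only [spineWalk, walk, add_right_comm]

theorem treeWalk_add (τ : TreeData d) (x z : Site d) (v : Vertex) :
    τ.treeWalk (x + z) v = τ.treeWalk x v + z := by
  rcases v with k | ⟨side, k, c, u⟩
  · exact τ.spineWalk_add x z k
  · simp only [treeWalk]
    induction u with
    | nil => simp only [normalWalk, spineWalk_add, add_right_comm]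
    | cons j u ih => simp only [normalWalk, ih, add_right_comm]

theorem disjoint_pastRange_add (τ : TreeData d) (x z : Site d) (K : Set (Site d)) :
    Disjoint (τ.pastRange (x + z)) ((· + z) '' K) ↔ Disjoint (τ.pastRange x) K := by
  simp only [disjoint_pastRange_iff, treeWalk_add]
  refine forall₂_congr fun v _ => not_congr ?_
  simp

theorem futureLocalTime_add (τ : TreeData d) (x y z : Site d) :
    τ.futureLocalTime (x + z) (y + z) = τ.futureLocalTime x y := by
  simp only [futureLocalTime, treeWalk_add, add_left_inj]

theorem meanFutureLocalTime_add [NeZero d] (τ : TreeData d) (x y z : Site d) :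
    τ.meanFutureLocalTime (x + z) (y + z) = τ.meanFutureLocalTime x y := by
  simp only [meanFutureLocalTime, spineWalk_add, greenPos_add_right, add_left_inj]

end TreeData

/-! ### The two-sided walk seen from the left end of a window -/

section TwoSided

variable {d : ℕ}

/-- The increments, read from left to right, of the two-sided walk from time `-a` on, in terms of
its increments in positive and in negative times. -/
def glueSteps (a : ℕ) (s : (ℕ → Site d) × (ℕ → Site d)) (i : ℕ) : Site d :=
  if i < a then -s.2 (a - 1 - i) else s.1 (i - a)

theorem X_sub_eq (ω : Sample d) (a i : ℕ) :
    X ω ((i : ℤ) - a) = walk 0 (glueSteps a ω.2) i - walk 0 (glueSteps a ω.2) a := by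
  rcases le_or_gt a i with h | h
  · obtain ⟨n, rfl⟩ := Nat.exists_eq_add_of_le h
    have h1 : ((a + n : ℕ) : ℤ) - a = n := by push_cast; ring
    rw [h1, X, if_pos (by positivity), Int.toNat_natCast]
    simp only [walk, zero_add, Finset.sum_range_add, add_sub_cancel_left]
    refine Finset.sum_congr rfl fun k _ => ?_
    simp [glueSteps]
  · obtain ⟨n, rfl⟩ := Nat.exists_eq_add_of_le h.le
    have h1 : (i : ℤ) - (i + n : ℕ) = -(n : ℤ) := by push_cast; ring
    rw [h1, X, if_neg (by omega), neg_neg, Int.toNat_natCast]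
    simp only [walk, zero_add, Finset.sum_range_add, sub_add_cancel_left]
    rw [← Finset.sum_range_reflect, ← Finset.sum_neg_distrib]
    refine Finset.sum_congr rfl fun k hk => ?_
    have := Finset.mem_range.1 hk
    rw [glueSteps, if_pos (by omega), neg_neg, show i + n - 1 - (i + k) = n - 1 - k by omega]

theorem window_eq (a b : ℕ) : window (a : ℕ∞) (b : ℕ∞)
    = Set.range fun i : Fin (a + b + 1) => ((i : ℕ) : ℤ) - a := by
  ext j
  simp only [window, Set.mem_ofPred_eq, Nat.cast_le, Set.mem_range]
  constructor
  · rintro ⟨h1, h2⟩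
    exact ⟨⟨(j + a).toNat, by omega⟩, by simp; omega⟩
  · rintro ⟨i, rfl⟩
    omega

theorem tsum_window (a b : ℕ) (F : ℤ → ℝ≥0∞) :
    ∑' j : window (a : ℕ∞) (b : ℕ∞), F j = ∑ i : Fin (a + b + 1), F (((i : ℕ) : ℤ) - a) := by
  have hinj : Injective fun i : Fin (a + b + 1) => ((i : ℕ) : ℤ) - a := by
    intro i j h
    exact Fin.ext (by simpa using h)
  rw [window_eq, tsum_range F hinj, tsum_fintype]

variable [NeZero d]

theorem measurePreserving_neg_stepsLaw :
    MeasurePreserving (fun (s : ℕ → Site d) k => -s k) (stepsLaw d) (stepsLaw d) := by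
  have h : (stepLaw d).toMeasure.map (fun s => -s) = (stepLaw d).toMeasure := by
    refine Measure.ext_of_lintegral _ fun f hf => ?_
    rw [lintegral_map hf (measurable_site _), lintegral_countable', lintegral_countable',
      ← (Equiv.neg (Site d)).tsum_eq]
    refine tsum_congr fun s => ?_
    simp [PMF.toMeasure_apply_singleton, stepLaw_neg]
  refine ⟨by fun_prop, ?_⟩
  rw [stepsLaw, Measure.infinitePi_map_pi (fun _ => (stepLaw d).toMeasure)
    (f := fun _ s => -s) (fun _ => measurable_site _)]
  simp only [h]

/-- Seen from the left end of a window, the two-sided walk is a simple random walk, the step law being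
symmetric. -/
theorem measurePreserving_glueSteps (a : ℕ) :
    MeasurePreserving (glueSteps (d := d) a) ((stepsLaw d).prod (stepsLaw d)) (stepsLaw d) := by
  let e : ℕ → ℕ ⊕ ℕ := fun i => if i < a then .inr (a - 1 - i) else .inl (i - a)
  have he : Injective e := by
    intro i j h
    simp only [e] at h
    split_ifs at h <;> simp at h <;> omega
  let ν : ℕ → Measure (Site d) := fun _ => (stepLaw d).toMeasure
  have h0 : ∀ i, Sum.elim ν ν i = (stepLaw d).toMeasure := by rintro (i | i) <;> rfl
  have h1 := measurePreserving_comp_infinitePi (fun _ : ℕ ⊕ ℕ => (stepLaw d).toMeasure) he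
  have h2 := measurePreserving_sumElim_infinitePi ν ν
  simp only [funext h0] at h2
  have h3 := h1.comp (h2.comp ((MeasurePreserving.id (stepsLaw d)).prod
    measurePreserving_neg_stepsLaw))
  have h4 : glueSteps (d := d) a = (fun (ω : ℕ ⊕ ℕ → Site d) k => ω (e k))
      ∘ (fun p : (ℕ → Site d) × (ℕ → Site d) => Sum.elim p.1 p.2)
      ∘ Prod.map id (fun (s : ℕ → Site d) k => -s k) := by
    funext s i
    simp only [comp_apply, glueSteps, e]
    split_ifs <;> rfl
  rw [h4]
  exact h3

end TwoSided

/-! ### Summation over the position of the origin in the window -/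

section Window

variable {d : ℕ}

theorem measurable_X (j : ℤ) : Measurable fun ω : Sample d => X ω j := by
  unfold X
  split_ifs
  · exact (measurable_walk 0 _).comp (by fun_prop)
  · exact (measurable_walk 0 _).comp (by fun_prop)

theorem measurableSet_avoids (a b : ℕ∞) : MeasurableSet {ω : Sample d | Avoids ω a b} := by
  have h : {ω : Sample d | Avoids ω a b}
      = ⋂ (v : Vertex) (j : ℤ), {ω : Sample d | v ∉ ω.1.past ∨ j ∉ window a b
        ∨ ω.1.treeWalk 0 v ≠ X ω j} := by
    ext ω
    simp only [Set.mem_ofPred_eq, Set.mem_iInter, Avoids, TreeData.disjoint_pastRange_iff]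
    refine forall_congr' fun v => ?_
    constructor
    · intro hv j
      by_cases h1 : v ∈ ω.1.past
      · by_cases h2 : j ∈ window a b
        · exact Or.inr (Or.inr fun h3 => hv h1 ⟨j, h2, h3.symm⟩)
        · exact Or.inr (Or.inl h2)
      · exact Or.inl h1
    · rintro hv h1 ⟨j, h2, h3⟩
      rcases hv j with h | h | h
      · exact h h1
      · exact h h2
      · exact h h3.symm
  rw [h]
  refine MeasurableSet.iInter fun v => MeasurableSet.iInter fun j => ?_
  refine MeasurableSet.union ?_ (MeasurableSet.union (MeasurableSet.const _) ?_)
  · exact (measurable_fst (TreeData.measurableSet_mem_past v)).compl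
  · exact (measurableSet_eq_fun ((TreeData.measurable_treeWalk 0 v).comp measurable_fst)
      (measurable_X j)).compl

theorem measurableSet_noReturn (b : ℕ∞) : MeasurableSet {ω : Sample d | NoReturn ω b} := by
  simp only [NoReturn, Set.ofPred_forall]
  refine MeasurableSet.iInter fun k => MeasurableSet.iInter fun _ => MeasurableSet.iInter fun _ => ?_
  exact (measurable_X k (measurableSet_singleton 0)).compl

/-- The sum over the times at which a path makes its last visit to its position is a sum over the
points of the path. -/
theorem sum_last_visit {m : ℕ} (w : Fin m → Site d) (f : Site d → ℝ≥0∞) :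
    ∑ a, ind (∀ k, a < k → w k ≠ w a) * f (w a) = ∑ x ∈ Finset.univ.image w, f x := by
  classical
  have h1 : ∑ a, ind (∀ k, a < k → w k ≠ w a) * f (w a)
      = ∑ a ∈ Finset.univ.filter fun a => ∀ k, a < k → w k ≠ w a, f (w a) := by
    rw [Finset.sum_filter]
    refine Finset.sum_congr rfl fun a _ => ?_
    by_cases h : ∀ k, a < k → w k ≠ w a
    · rw [ind_of h, if_pos h, one_mul]
    · rw [ind_of_not h, if_neg h, zero_mul]
  rw [h1]
  refine Finset.sum_nbij w (fun a _ => by simp) ?_ ?_ (fun _ _ => rfl)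
  · intro a ha b hb hab
    simp only [Finset.coe_filter, Finset.mem_univ, true_and, Set.mem_ofPred_eq] at ha hb
    rcases lt_trichotomy a b with h | h | h
    · exact absurd hab.symm (ha b h)
    · exact h
    · exact absurd hab (hb a h)
  · intro x hx
    obtain ⟨i, -, rfl⟩ := Finset.mem_image.1 (Finset.mem_coe.1 hx)
    obtain ⟨a, ha, hmax⟩ := Finset.exists_max_image (Finset.univ.filter fun k => w k = w i) id
      ⟨i, by simp⟩
    simp only [Finset.mem_filter, Finset.mem_univ, true_and] at ha hmax
    refine ⟨a, ?_, ha⟩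
    simp only [Finset.coe_filter, Finset.mem_univ, true_and, Set.mem_ofPred_eq]
    intro k hk hka
    exact absurd (hmax k (hka.trans ha)) (not_le.2 hk)

theorem measurable_comp_X {l : TreeData d → Site d → Site d → ℝ≥0∞}
    (hl : ∀ x y, Measurable fun τ => l τ x y) (j : ℤ) :
    Measurable fun ω : Sample d => l ω.1 0 (X ω j) := by
  have h : Measurable fun q : Site d × TreeData d => l q.2 0 q.1 :=
    measurable_from_prod_countable_right fun y => hl 0 y
  exact h.comp ((measurable_X j).prodMk measurable_fst)

variable [NeZero d] (μ : PMF ℕ) (hμ : ∑' i : ℕ, (i : ℝ≥0∞) * μ i = 1)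

/-- The mean of the functional `l` of the tree on the event that the past of the walk started
from `x` avoids `K`. -/
def avoidMean (l : TreeData d → Site d → Site d → ℝ≥0∞) (K : Set (Site d)) (x y : Site d) :
    ℝ≥0∞ :=
  ∫⁻ τ, ind (Disjoint (τ.pastRange x) K) * l τ x y ∂(treeLaw d μ hμ)

theorem avoidMean_add {l : TreeData d → Site d → Site d → ℝ≥0∞}
    (hl : ∀ τ x y z, l τ (x + z) (y + z) = l τ x y) (K : Set (Site d)) (x y z : Site d) :
    avoidMean μ hμ l ((· + z) '' K) (x + z) (y + z) = avoidMean μ hμ l K x y := by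
  simp only [avoidMean, TreeData.disjoint_pastRange_add, hl]

/-- The mean, over the tree and the two-sided walk, of the sum of `l` along a window in which the
past avoids the walk and the walk does not return to the origin. -/
def windowMean (l : TreeData d → Site d → Site d → ℝ≥0∞) (a b : ℕ∞) : ℝ≥0∞ :=
  ∫⁻ ω, ind (Avoids ω a b) * ind (NoReturn ω b) * ∑' j : window a b, l ω.1 0 (X ω j)
    ∂(law d μ hμ)

/-- Translation to the left end of the window: the past starts from the position at time `a` of a
walk with `a + b + 1` points and must avoid all these points. -/
theorem windowMean_eq {l : TreeData d → Site d → Site d → ℝ≥0∞}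
    (hl : ∀ x y, Measurable fun τ => l τ x y)
    (hadd : ∀ τ x y z, l τ (x + z) (y + z) = l τ x y) (a b : ℕ) :
    windowMean μ hμ l a b = ∫⁻ s, (ind (∀ k : Fin (a + b + 1), a < (k : ℕ) → walk 0 s k ≠ walk 0 s a)
      * ∑ i : Fin (a + b + 1), avoidMean μ hμ l (Set.range fun k : Fin (a + b + 1) => walk 0 s k)
        (walk 0 s a) (walk 0 s i)) ∂(stepsLaw d) := by
  have hmeas : Measurable fun ω : Sample d => ind (Avoids ω a b) * ind (NoReturn ω b)
      * ∑' j : window (a : ℕ∞) (b : ℕ∞), l ω.1 0 (X ω j) :=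
    ((measurable_ind (measurableSet_avoids _ _)).mul (measurable_ind (measurableSet_noReturn _))).mul
      (Measurable.tsum fun j => measurable_comp_X hl j)
  have hψ : Measurable fun s : ℕ → Site d =>
      ind (∀ k : Fin (a + b + 1), a < (k : ℕ) → walk 0 s k ≠ walk 0 s a)
      * ∑ i : Fin (a + b + 1), avoidMean μ hμ l (Set.range fun k : Fin (a + b + 1) => walk 0 s k)
        (walk 0 s a) (walk 0 s i) := by
    have h1 : Measurable fun s : ℕ → Site d => fun k : Fin (a + b + 1) => walk 0 s k :=
      measurable_pi_iff.2 fun k => measurable_walk 0 k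
    exact (measurable_of_countable fun w : Fin (a + b + 1) → Site d =>
      ind (∀ k : Fin (a + b + 1), a < (k : ℕ) → w k ≠ w ⟨a, by omega⟩)
      * ∑ i, avoidMean μ hμ l (Set.range w) (w ⟨a, by omega⟩) (w i)).comp h1
  rw [windowMean, law, lintegral_prod_symm _ hmeas.aemeasurable,
    ← (measurePreserving_glueSteps a).lintegral_comp hψ]
  refine lintegral_congr fun s => ?_
  set W : ℕ → Site d := walk 0 (glueSteps a s) with hW
  have hX : ∀ (τ : TreeData d) (i : ℕ), X (τ, s) ((i : ℤ) - a) = W i - W a := fun τ i =>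
    X_sub_eq (τ, s) a i
  have hA : ∀ τ : TreeData d, Avoids (τ, s) a b ↔ Disjoint (τ.pastRange 0)
      (Set.range fun k : Fin (a + b + 1) => W k - W a) := by
    intro τ
    rw [Avoids, window_eq, ← Set.range_comp]
    simp only [comp_def, hX]
  have hR : ∀ τ : TreeData d, NoReturn (τ, s) b
      ↔ ∀ k : Fin (a + b + 1), a < (k : ℕ) → W k ≠ W a := by
    intro τ
    have h1 : ∀ k : ℕ, X (τ, s) (k : ℤ) = W (a + k) - W a := by
      intro k
      rw [← hX τ]
      congr 1
      push_cast
      ring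
    constructor
    · intro h k hk
      have h2 := h (k - a) (by omega) (by exact_mod_cast (by omega : (k : ℕ) - a ≤ b))
      rw [h1, sub_ne_zero, Nat.add_sub_cancel' hk.le] at h2
      exact h2
    · intro h k hk hkb
      have hkb' : k ≤ b := by exact_mod_cast hkb
      rw [h1, sub_ne_zero]
      exact h ⟨a + k, by omega⟩ (by simp; omega)
  have hS : ∀ τ : TreeData d, ∑' j : window (a : ℕ∞) (b : ℕ∞), l τ 0 (X (τ, s) j)
      = ∑ i : Fin (a + b + 1), l τ 0 (W i - W a) := by
    intro τ
    rw [tsum_window a b fun j => l τ 0 (X (τ, s) j)]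
    simp only [hX]
  simp only [hA, hR, hS]
  have hD := TreeData.measurableSet_disjoint_pastRange (d := d) 0
    (Set.range fun k : Fin (a + b + 1) => W k - W a)
  have h3 : ∀ τ : TreeData d, ind (Disjoint (τ.pastRange 0)
        (Set.range fun k : Fin (a + b + 1) => W k - W a))
        * ind (∀ k : Fin (a + b + 1), a < (k : ℕ) → W k ≠ W a)
        * ∑ i : Fin (a + b + 1), l τ 0 (W i - W a)
      = ind (∀ k : Fin (a + b + 1), a < (k : ℕ) → W k ≠ W a)
        * ∑ i : Fin (a + b + 1), ind (Disjoint (τ.pastRange 0)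
          (Set.range fun k : Fin (a + b + 1) => W k - W a)) * l τ 0 (W i - W a) := by
    intro τ
    rw [← Finset.mul_sum]
    ring
  simp only [h3]
  have hm : ∀ i : Fin (a + b + 1), Measurable fun τ : TreeData d => ind (Disjoint (τ.pastRange 0)
      (Set.range fun k : Fin (a + b + 1) => W k - W a)) * l τ 0 (W i - W a) :=
    fun i => (measurable_ind hD).mul (hl 0 _)
  rw [lintegral_const_mul' _ _ (ne_top_of_le_ne_top ENNReal.one_ne_top (ind_le_one _)),
    lintegral_finsetSum _ fun i _ => hm i]
  congr 1
  refine Finset.sum_congr rfl fun i _ => ?_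
  have h4 : (Set.range fun k : Fin (a + b + 1) => W k)
      = (· + W a) '' (Set.range fun k : Fin (a + b + 1) => W k - W a) := by
    rw [← Set.range_comp]
    simp [comp_def]
  have h5 := avoidMean_add μ hμ hadd (Set.range fun k : Fin (a + b + 1) => W k - W a) 0 (W i - W a)
    (W a)
  rw [zero_add, sub_add_cancel, ← h4] at h5
  exact h5.symm

/-- All the splittings of a window of `m + 1` times into times before and after the origin
contribute `m + 1` altogether. -/
theorem sum_windowMean {l : TreeData d → Site d → Site d → ℝ≥0∞}
    (hl : ∀ x y, Measurable fun τ => l τ x y)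
    (hadd : ∀ τ x y z, l τ (x + z) (y + z) = l τ x y)
    (hsum : ∀ (K : Finset (Site d)), ∀ y ∈ K, ∑ x ∈ K, avoidMean μ hμ l K x y = 1) (m : ℕ) :
    ∑ p ∈ Finset.HasAntidiagonal.antidiagonal m, windowMean μ hμ l p.1 p.2 = m + 1 := by
  rw [Finset.Nat.sum_antidiagonal_eq_sum_range_succ_mk, Finset.sum_range]
  have h1 : ∀ a : Fin (m + 1), windowMean μ hμ l (a : ℕ) ((m - a : ℕ) : ℕ∞)
      = ∫⁻ s, ind (∀ k : Fin (m + 1), a < k → walk 0 s k ≠ walk 0 s a)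
        * ∑ i : Fin (m + 1), avoidMean μ hμ l (Set.range fun k : Fin (m + 1) => walk 0 s k)
          (walk 0 s a) (walk 0 s i) ∂(stepsLaw d) := by
    intro a
    have := windowMean_eq μ hμ hl hadd (a : ℕ) (m - a)
    rw [show (a : ℕ) + (m - a) = m by omega] at this
    exact this
  have hψ : ∀ a : Fin (m + 1), Measurable fun s : ℕ → Site d =>
      ind (∀ k : Fin (m + 1), a < k → walk 0 s k ≠ walk 0 s a)
      * ∑ i : Fin (m + 1), avoidMean μ hμ l (Set.range fun k : Fin (m + 1) => walk 0 s k)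
        (walk 0 s a) (walk 0 s i) := by
    intro a
    have h1 : Measurable fun s : ℕ → Site d => fun k : Fin (m + 1) => walk 0 s k :=
      measurable_pi_iff.2 fun k => measurable_walk 0 k
    exact (measurable_of_countable fun w : Fin (m + 1) → Site d =>
      ind (∀ k : Fin (m + 1), a < k → w k ≠ w a)
      * ∑ i, avoidMean μ hμ l (Set.range w) (w a) (w i)).comp h1
  rw [Finset.sum_congr rfl fun a _ => h1 a, ← lintegral_finsetSum _ fun a _ => hψ a]
  have h2 : ∀ s : ℕ → Site d, ∑ a : Fin (m + 1),
      ind (∀ k : Fin (m + 1), a < k → walk 0 s k ≠ walk 0 s a)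
      * ∑ i : Fin (m + 1), avoidMean μ hμ l (Set.range fun k : Fin (m + 1) => walk 0 s k)
        (walk 0 s a) (walk 0 s i) = m + 1 := by
    intro s
    set w : Fin (m + 1) → Site d := fun k => walk 0 s k with hw
    have h3 := sum_last_visit w fun x => ∑ i, avoidMean μ hμ l (Set.range w) x (w i)
    refine h3.trans ?_
    rw [Finset.sum_comm]
    have h4 : Set.range w = ((Finset.univ.image w : Finset (Site d)) : Set (Site d)) := by simp
    rw [h4, Finset.sum_congr rfl fun i _ => hsum _ (w i) (by simp)]
    simp
  simp only [h2]
  simp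

end Window

/-! ### Finiteness of the sums of Green's functions -/

section Finiteness

variable {d : ℕ}

theorem measurable_spineSum (f : Site d → ℝ≥0∞) (i : ℕ) : Measurable fun τ : TreeData d =>
    (τ.spineOffspring .future i : ℝ≥0∞) * f (τ.spineWalk 0 i) :=
  ((measurable_of_countable fun c : ℕ × ℕ => (c.2 : ℝ≥0∞)).comp
    (by fun_prop : Measurable fun τ : TreeData d => τ.1 i)).mul
    ((measurable_site f).comp (TreeData.measurable_spineWalk 0 i))

variable [NeZero d] (μ : PMF ℕ) (hμ : ∑' i : ℕ, (i : ℝ≥0∞) * μ i = 1)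

theorem greenPos_comm (x y : Site d) : greenPos x y = greenPos y x := by
  simp only [greenPos, heat_comm]

theorem Z_le_U (ω : Sample d) (a b : ℕ∞) : Z ω a b ≤ U ω a b := by
  refine ENNReal.tsum_le_tsum fun j => ENNReal.tsum_le_tsum fun i => ?_
  rw [green_eq_add]
  gcongr
  exact le_self_add

/-- Removing the starting points of the walks from the sum of Green's functions leaves the mean
local time in the future. -/
theorem N_add_U_sub_Z (ω : Sample d) (a b : ℕ∞) (h : U ω a b < ∞) :
    N ω a b + (U ω a b - Z ω a b) = ∑' j : window a b, ω.1.meanFutureLocalTime 0 (X ω j) := by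
  have hU : U ω a b = Z ω a b + ∑' j : window a b, ∑' i : ℕ,
      (ω.1.spineOffspring .future i : ℝ≥0∞) * greenPos (ω.1.spineWalk 0 i) (X ω j) := by
    simp only [U, Z, ← ENNReal.tsum_add, ← mul_add]
    simp only [green_eq_add, greenPos_comm]
  have hZ : Z ω a b ≠ ∞ := ((Z_le_U ω a b).trans_lt h).ne
  rw [hU, ENNReal.add_sub_cancel_left hZ, N, ← ENNReal.tsum_add]
  simp only [TreeData.meanFutureLocalTime, eq_comm]

theorem lintegral_spineOffspring_mul (f : Site d → ℝ≥0∞) (i : ℕ) :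
    ∫⁻ τ, (τ.spineOffspring .future i : ℝ≥0∞) * f (τ.spineWalk 0 i) ∂(treeLaw d μ hμ)
      ≤ (1 + rightMean μ hμ) * avg^[i] f 0 := by
  have hP := measurePreserving_treeData (d := d) μ hμ
  rcases i with _ | k
  · have h0 := (measurePreserving_fst.comp hP).lintegral_comp
      (measurable_of_countable fun c : ℕ × ℕ => (c.2 : ℝ≥0∞))
    rw [lintegral_spineLaw_zero] at h0
    have h1 : ∀ τ : TreeData d, τ.spineWalk 0 0 = 0 := fun τ => by
      simp [TreeData.spineWalk, walk]
    simp only [h1, iterate_zero, id]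
    have hm : Measurable fun τ : TreeData d => (τ.spineOffspring .future 0 : ℝ≥0∞) :=
      (measurable_of_countable fun c : ℕ × ℕ => (c.2 : ℝ≥0∞)).comp
        (by fun_prop : Measurable fun τ : TreeData d => τ.1 0)
    rw [lintegral_mul_const _ hm]
    refine mul_le_mul_left ?_ _
    refine le_trans (le_of_eq ?_) (le_self_add : (1 : ℝ≥0∞) ≤ 1 + rightMean μ hμ)
    refine h0.trans ?_
    simp only [mul_comm (μ _), hμ]
  · have h0 := ((measurePreserving_fst.comp measurePreserving_snd).comp hP).lintegral_comp
      (measurable_spine_functional k 0 fun c z => (c.2 : ℝ≥0∞) * f z)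
    refine (le_of_eq (h0.trans (lintegral_right_mul μ hμ f k 0))).trans ?_
    gcongr
    exact le_add_self

/-- The mean of the sum of Green's functions along the spine, with the weights `d_i`, is bounded in
terms of the Green's function of the walk indexed by pairs of times. -/
theorem lintegral_spine_green_le (y : Site d) :
    ∫⁻ τ, ∑' i, (τ.spineOffspring .future i : ℝ≥0∞) * green d y (τ.spineWalk 0 i)
        ∂(treeLaw d μ hμ)
      ≤ (1 + rightMean μ hμ) * ∑' i, ∑' k, heat (i + k) 0 y := by
  rw [lintegral_tsum fun i => (measurable_spineSum (green d y) i).aemeasurable,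
    ← ENNReal.tsum_mul_left]
  refine ENNReal.tsum_le_tsum fun i => ?_
  refine (lintegral_spineOffspring_mul μ hμ (green d y) i).trans (le_of_eq ?_)
  rw [← avg_iterate_green, funext (green_comm y)]

theorem ae_spine_green_lt_top (hd : 5 ≤ d) (hC : rightMean μ hμ ≠ ∞) :
    ∀ᵐ τ ∂(treeLaw d μ hμ), ∀ y : Site d,
      ∑' i, (τ.spineOffspring .future i : ℝ≥0∞) * green d y (τ.spineWalk 0 i) < ∞ := by
  rw [ae_all_iff]
  intro y
  refine ae_lt_top (Measurable.tsum fun i => measurable_spineSum (green d y) i) (ne_top_of_le_ne_top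
    ?_ (lintegral_spine_green_le μ hμ y))
  obtain ⟨B, hB, hfin⟩ := exists_heat_le (d := d) 1 (by omega)
  refine ENNReal.mul_ne_top (ENNReal.add_ne_top.2 ⟨ENNReal.one_ne_top, hC⟩)
    (ne_top_of_le_ne_top hfin ?_)
  simp only [pow_one]
  rw [← tsum_tsum_add B]
  exact ENNReal.tsum_le_tsum fun i => ENNReal.tsum_le_tsum fun k => hB _ _ _

/-- For finite windows the sum of Green's functions is finite as soon as `d ≥ 5`. -/
theorem ae_U_lt_top (hd : 5 ≤ d) (hC : rightMean μ hμ ≠ ∞) :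
    ∀ᵐ ω ∂(law d μ hμ), ∀ a b : ℕ, U ω a b < ∞ := by
  filter_upwards [Measure.quasiMeasurePreserving_fst.ae (ae_spine_green_lt_top (d := d) μ hμ hd hC)]
    with ω h a b
  rw [U, tsum_window a b fun j => ∑' i : ℕ,
    (ω.1.spineOffspring .future i : ℝ≥0∞) * green d (X ω j) (ω.1.spineWalk 0 i)]
  exact ENNReal.sum_lt_top.2 fun i _ => h _

theorem lintegral_X (f : Site d → ℝ≥0∞) (j : ℤ) :
    ∫⁻ s : (ℕ → Site d) × (ℕ → Site d),
      f (if 0 ≤ j then walk 0 s.1 j.toNat else walk 0 s.2 (-j).toNat)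
        ∂((stepsLaw d).prod (stepsLaw d)) = avg^[j.natAbs] f 0 := by
  split_ifs with h
  · rw [show j.natAbs = j.toNat by omega, ← lintegral_walk]
    exact measurePreserving_fst.lintegral_comp ((measurable_site f).comp (measurable_walk 0 _))
  · rw [show j.natAbs = (-j).toNat by omega, ← lintegral_walk]
    exact measurePreserving_snd.lintegral_comp ((measurable_site f).comp (measurable_walk 0 _))

theorem measurable_spine_green_comp_X (j : ℤ) : Measurable fun ω : Sample d =>
    ∑' i, (ω.1.spineOffspring .future i : ℝ≥0∞) * green d (X ω j) (ω.1.spineWalk 0 i) :=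
  (measurable_from_prod_countable_right (f := fun q : Site d × TreeData d =>
    ∑' i, (q.2.spineOffspring .future i : ℝ≥0∞) * green d q.1 (q.2.spineWalk 0 i))
    fun y => Measurable.tsum fun i => measurable_spineSum (green d y) i).comp
    ((measurable_X j).prodMk measurable_fst)

theorem measurable_U (a b : ℕ∞) : Measurable fun ω : Sample d => U ω a b :=
  Measurable.tsum fun j => measurable_spine_green_comp_X j

theorem lintegral_spine_green_comp_X_le (j : ℤ) :
    ∫⁻ ω : Sample d, ∑' i, (ω.1.spineOffspring .future i : ℝ≥0∞)
        * green d (X ω j) (ω.1.spineWalk 0 i) ∂(law d μ hμ)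
      ≤ (1 + rightMean μ hμ) * ∑' i, ∑' k, heat (j.natAbs + (i + k)) (0 : Site d) 0 := by
  rw [law, lintegral_prod_symm _ (measurable_spine_green_comp_X j).aemeasurable]
  have h1 : ∀ y : Site d, ∑' i, ∑' k, heat (i + k) 0 y = ∑' i, ∑' k, heat (i + k) y 0 := by
    intro y
    simp only [heat_comm _ (0 : Site d) y]
  have h2 := lintegral_X (d := d)
    (fun y => (1 + rightMean μ hμ) * ∑' i, ∑' k, heat (i + k) y 0) j
  rw [avg_iterate_const_mul] at h2
  simp only [avg_iterate_tsum, avg_iterate_heat] at h2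
  rw [← h2]
  refine lintegral_mono fun s => ?_
  rw [← h1]
  exact lintegral_spine_green_le μ hμ _

theorem tsum_natAbs_le (f : ℕ → ℝ≥0∞) : ∑' j : ℤ, f j.natAbs ≤ 2 * ∑' m, f m := by
  have h := (tsum_of_nat_of_neg_add_one (f := fun j : ℤ => f j.natAbs) ENNReal.summable
    ENNReal.summable)
  rw [h, two_mul]
  have h1 : ∀ n : ℕ, (-((n : ℤ) + 1)).natAbs = n + 1 := fun n => by omega
  simp only [Int.natAbs_natCast, h1]
  exact add_le_add le_rfl (ENNReal.tsum_comp_le_tsum_of_injective (add_left_injective 1) f)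

theorem window_top : window ⊤ ⊤ = Set.univ := by
  ext j
  simp [window]

theorem tsum_window_top (f : ℤ → ℝ≥0∞) : ∑' j : window ⊤ ⊤, f j = ∑' j, f j := by
  rw [window_top, tsum_univ]

/-- In dimension `d ≥ 7` the sum of Green's functions over the whole walk is integrable, because
`∑ (n + 1)² p_n < ∞` for the return probabilities `p_n`. -/
theorem lintegral_U_top_ne_top (hd : 7 ≤ d) (hC : rightMean μ hμ ≠ ∞) :
    ∫⁻ ω, U ω ⊤ ⊤ ∂(law d μ hμ) ≠ ∞ := by
  have h1 : ∀ ω : Sample d, U ω ⊤ ⊤ = ∑' j : ℤ, ∑' i : ℕ,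
      (ω.1.spineOffspring .future i : ℝ≥0∞) * green d (X ω j) (ω.1.spineWalk 0 i) := fun ω =>
    tsum_window_top fun j => ∑' i : ℕ,
      (ω.1.spineOffspring .future i : ℝ≥0∞) * green d (X ω j) (ω.1.spineWalk 0 i)
  simp only [h1]
  rw [lintegral_tsum fun j => (measurable_spine_green_comp_X j).aemeasurable]
  refine ne_top_of_le_ne_top ?_ (ENNReal.tsum_le_tsum fun j =>
    lintegral_spine_green_comp_X_le μ hμ j)
  rw [ENNReal.tsum_mul_left]
  refine ENNReal.mul_ne_top (ENNReal.add_ne_top.2 ⟨ENNReal.one_ne_top, hC⟩) ?_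
  refine ne_top_of_le_ne_top ?_ (tsum_natAbs_le fun m => ∑' i, ∑' k, heat (m + (i + k)) (0 : Site d) 0)
  refine ENNReal.mul_ne_top ENNReal.ofNat_ne_top ?_
  obtain ⟨B, hB, hfin⟩ := exists_heat_le (d := d) 2 (by omega)
  refine ne_top_of_le_ne_top hfin ?_
  have h2 : ∀ m, ∑' i, ∑' k, heat (m + (i + k)) (0 : Site d) 0
      ≤ ∑' n : ℕ, ((n : ℝ≥0∞) + 1) * B (m + n) := by
    intro m
    rw [← tsum_tsum_add fun n => B (m + n)]
    exact ENNReal.tsum_le_tsum fun i => ENNReal.tsum_le_tsum fun k => hB _ _ _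
  have h3 : ∀ m n : ℕ, ((n : ℝ≥0∞) + 1) * B (m + n) ≤ (((m + n : ℕ) : ℝ≥0∞) + 1) * B (m + n) := by
    intro m n
    gcongr
    exact_mod_cast Nat.le_add_left n m
  refine (ENNReal.tsum_le_tsum fun m => (h2 m).trans
    (ENNReal.tsum_le_tsum fun n => h3 m n)).trans (le_of_eq ?_)
  rw [tsum_tsum_add fun n => ((n : ℝ≥0∞) + 1) * B n]
  simp only [pow_two, mul_assoc]

theorem lintegral_N_top_ne_top (hd : 5 ≤ d) : ∫⁻ ω : Sample d, N ω ⊤ ⊤ ∂(law d μ hμ) ≠ ∞ := by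
  have h1 : ∀ ω : Sample d, N ω ⊤ ⊤ = ∑' j : ℤ, ind (X ω j = 0) := fun ω =>
    tsum_window_top fun j => ind (X ω j = 0)
  simp only [h1]
  have hm : ∀ j : ℤ, Measurable fun ω : Sample d => ind (X ω j = 0) := fun j =>
    (measurable_site fun z => ind (z = 0)).comp (measurable_X j)
  rw [lintegral_tsum fun j => (hm j).aemeasurable]
  have h2 : ∀ j : ℤ, ∫⁻ ω : Sample d, ind (X ω j = 0) ∂(law d μ hμ) = heat j.natAbs (0 : Site d) 0 := by
    intro j
    rw [law, lintegral_prod_symm _ (hm j).aemeasurable]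
    have h3 := lintegral_X (d := d) (fun z => ind (z = 0)) j
    refine Eq.trans (lintegral_congr fun s => ?_) h3
    simp [X]
  simp only [h2]
  refine ne_top_of_le_ne_top ?_ (tsum_natAbs_le fun m => heat m (0 : Site d) 0)
  refine ENNReal.mul_ne_top ENNReal.ofNat_ne_top ?_
  obtain ⟨B, hB, hfin⟩ := exists_heat_le (d := d) 0 (by omega)
  refine ne_top_of_le_ne_top hfin (ENNReal.tsum_le_tsum fun n => ?_)
  simpa using hB n 0 0

end Finiteness

/-! ### Geometric killing times -/

section Geometric

instance (n : ℕ) : IsProbabilityMeasure (geomLaw n) := by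
  unfold geomLaw
  infer_instance

theorem geomLaw_singleton {n : ℕ} (hn : 1 ≤ n) (k : ℕ) :
    geomLaw n {k} = ENNReal.ofReal (1 - (n : ℝ)⁻¹) ^ k * ENNReal.ofReal (n : ℝ)⁻¹ := by
  have h0 : (0 : ℝ) ≤ 1 - (n : ℝ)⁻¹ := sub_nonneg.2 (Nat.cast_inv_le_one n)
  rw [geomLaw, geometricMeasure_singleton, ENNReal.ofReal_mul (pow_nonneg h0 k),
    ENNReal.ofReal_pow h0]
  intro h
  have h1 : ((n : ℝ)⁻¹) = 0 := congrArg Subtype.val h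
  rw [inv_eq_zero, Nat.cast_eq_zero] at h1
  omega

/-- Two independent geometric times of the same parameter have, given their sum `m`, the uniform
law on the `m + 1` ways of splitting it. -/
theorem lintegral_geomLaw_prod_eq_one {n : ℕ} (hn : 1 ≤ n) {φ : ℕ × ℕ → ℝ≥0∞}
    (hφ : ∀ m : ℕ, ∑ p ∈ Finset.HasAntidiagonal.antidiagonal m, φ p = m + 1) :
    ∫⁻ p, φ p ∂((geomLaw n).prod (geomLaw n)) = 1 := by
  set r := ENNReal.ofReal (1 - (n : ℝ)⁻¹)
  set w := ENNReal.ofReal (n : ℝ)⁻¹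
  have h1 : ∀ ψ : ℕ × ℕ → ℝ≥0∞, ∫⁻ p, ψ p ∂((geomLaw n).prod (geomLaw n))
      = ∑' m : ℕ, r ^ m * w * w * ∑ p ∈ Finset.HasAntidiagonal.antidiagonal m, ψ p := by
    intro ψ
    rw [lintegral_countable', tsum_eq_tsum_antidiagonal]
    refine tsum_congr fun m => ?_
    rw [Finset.mul_sum]
    refine Finset.sum_congr rfl fun p hp => ?_
    rw [← Finset.HasAntidiagonal.mem_antidiagonal.1 hp, ← Set.singleton_prod_singleton (a := p.1) (b := p.2),
      Measure.prod_prod, geomLaw_singleton hn, geomLaw_singleton hn, pow_add]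
    ring
  have h2 := h1 fun _ => 1
  rw [lintegral_const, measure_univ, mul_one] at h2
  rw [h1, h2]
  refine tsum_congr fun m => ?_
  rw [hφ]
  simp

variable {d : ℕ}

theorem measurable_windowIntegrand {l : TreeData d → Site d → Site d → ℝ≥0∞}
    (hl : ∀ x y, Measurable fun τ => l τ x y) (a b : ℕ∞) :
    Measurable fun ω : Sample d => ind (Avoids ω a b) * ind (NoReturn ω b)
      * ∑' j : window a b, l ω.1 0 (X ω j) :=
  ((measurable_ind (measurableSet_avoids _ _)).mul (measurable_ind (measurableSet_noReturn _))).mul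
    (Measurable.tsum fun j => measurable_comp_X hl j)

variable [NeZero d] (μ : PMF ℕ) (hμ : ∑' i : ℕ, (i : ℝ≥0∞) * μ i = 1)

instance : IsProbabilityMeasure (law d μ hμ) := by
  unfold law
  infer_instance

theorem lintegral_lawN (n : ℕ) {F : Sample d → ℕ × ℕ → ℝ≥0∞}
    (hF : ∀ p, Measurable fun ω => F ω p) :
    ∫⁻ q, F q.1 q.2 ∂(lawN d μ hμ n)
      = ∫⁻ p, ∫⁻ ω, F ω p ∂(law d μ hμ) ∂((geomLaw n).prod (geomLaw n)) := by
  have h : Measurable fun q : Sample d × ℕ × ℕ => F q.1 q.2 :=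
    measurable_from_prod_countable_left hF
  rw [lawN, lintegral_prod_symm _ h.aemeasurable]

theorem ae_lawN (n : ℕ) {P : Sample d → Prop} (h : ∀ᵐ ω ∂(law d μ hμ), P ω) :
    ∀ᵐ q ∂(lawN d μ hμ n), P q.1 :=
  Measure.quasiMeasurePreserving_fst.ae h

theorem lintegral_lawN_window_eq_one {n : ℕ} (hn : 1 ≤ n)
    {l : TreeData d → Site d → Site d → ℝ≥0∞}
    (hl : ∀ x y, Measurable fun τ => l τ x y)
    (hadd : ∀ τ x y z, l τ (x + z) (y + z) = l τ x y)
    (hsum : ∀ (K : Finset (Site d)), ∀ y ∈ K, ∑ x ∈ K, avoidMean μ hμ l K x y = 1) :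
    ∫⁻ q, ind (Avoids q.1 q.2.1 q.2.2) * ind (NoReturn q.1 q.2.2)
      * ∑' j : window (q.2.1 : ℕ∞) (q.2.2 : ℕ∞), l q.1.1 0 (X q.1 j) ∂(lawN d μ hμ n) = 1 := by
  refine (lintegral_lawN μ hμ n (F := fun ω p => ind (Avoids ω p.1 p.2) * ind (NoReturn ω p.2)
      * ∑' j : window (p.1 : ℕ∞) (p.2 : ℕ∞), l ω.1 0 (X ω j))
      fun p => measurable_windowIntegrand hl _ _).trans ?_
  exact lintegral_geomLaw_prod_eq_one hn fun m => sum_windowMean μ hμ hl hadd hsum m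

end Geometric

/-! ### The infinite window -/

section Infinite

/-- A bounded double sequence with a limit, whose averages over the antidiagonals are equal to one,
tends to one. -/
theorem eq_one_of_tendsto_of_sum_antidiagonal {φ : ℕ × ℕ → ℝ} {c C : ℝ}
    (hbdd : ∀ p, |φ p - c| ≤ C) (hlim : Tendsto φ atTop (𝓝 c))
    (hφ : ∀ m : ℕ, ∑ p ∈ Finset.HasAntidiagonal.antidiagonal m, φ p = m + 1) : c = 1 := by
  have hC : 0 ≤ C := (abs_nonneg _).trans (hbdd 0)
  by_contra hne
  obtain ⟨ε, hε, hε2⟩ : ∃ ε : ℝ, 0 < ε ∧ 2 * ε < |1 - c| :=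
    ⟨|1 - c| / 3, by have := abs_pos.2 (sub_ne_zero.2 (Ne.symm hne)); positivity, by
      have := abs_pos.2 (sub_ne_zero.2 (Ne.symm hne)); linarith⟩
  -- All but `2 M` of the points of an antidiagonal have both coordinates at least `M`.
  obtain ⟨⟨M₁, M₂⟩, hM⟩ := eventually_atTop.1 (Metric.tendsto_nhds.1 hlim ε hε)
  set M := max M₁ M₂ with hMdef
  have h1 : ∀ p : ℕ × ℕ, |φ p - c| ≤ ε + C * ((if p.1 < M then 1 else 0)
      + (if p.2 < M then 1 else 0)) := by
    intro p
    by_cases hp1 : p.1 < M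
    · have : (0 : ℝ) ≤ if p.2 < M then 1 else 0 := by split_ifs <;> norm_num
      rw [if_pos hp1]
      nlinarith [hbdd p]
    · by_cases hp2 : p.2 < M
      · rw [if_neg hp1, if_pos hp2]
        nlinarith [hbdd p]
      · have := hM p (Prod.mk_le_mk.2 ⟨by omega, by omega⟩)
        rw [Real.dist_eq] at this
        rw [if_neg hp1, if_neg hp2]
        linarith
  have hcount : ∀ m : ℕ, ∑ k ∈ Finset.range (m + 1), (if k < M then (1 : ℝ) else 0) ≤ M := by
    intro m
    rw [← Finset.sum_filter, Finset.sum_const, nsmul_eq_mul, mul_one]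
    refine Nat.cast_le.2 ((Finset.card_le_card fun k hk => ?_).trans (Finset.card_range M).le)
    exact Finset.mem_range.2 (Finset.mem_filter.1 hk).2
  have h2 : ∀ m : ℕ, ((m : ℝ) + 1) * |1 - c| ≤ (m + 1) * ε + C * (M + M) := by
    intro m
    have hcard : ∀ t : ℝ, ∑ p ∈ Finset.HasAntidiagonal.antidiagonal m, t = (m + 1) * t := by
      intro t
      simp
    have h3 : ((m : ℝ) + 1) * (1 - c) = ∑ p ∈ Finset.HasAntidiagonal.antidiagonal m, (φ p - c) := by
      rw [Finset.sum_sub_distrib, hφ, hcard]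
      ring
    have h4 : ((m : ℝ) + 1) * |1 - c| = |((m : ℝ) + 1) * (1 - c)| := by
      rw [abs_mul, abs_of_nonneg (by positivity : (0 : ℝ) ≤ m + 1)]
    rw [h4, h3]
    refine (Finset.abs_sum_le_sum_abs _ _).trans ((Finset.sum_le_sum fun p _ => h1 p).trans ?_)
    rw [Finset.sum_add_distrib, hcard, ← Finset.mul_sum, Finset.sum_add_distrib]
    have h5 := Finset.Nat.sum_antidiagonal_eq_sum_range_succ
      (fun i _ => if i < M then (1 : ℝ) else 0) m
    have h6 := Finset.Nat.sum_antidiagonal_swap (n := m) (f := fun p => if p.1 < M then (1 : ℝ) else 0)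
    simp only [Prod.fst_swap] at h6
    rw [h6]
    rw [h5]
    have := hcount m
    gcongr
  obtain ⟨m, hm⟩ := exists_nat_gt (C * (M + M) / ε)
  have h7 := h2 m
  rw [div_lt_iff₀ hε] at hm
  nlinarith

variable {d : ℕ}

theorem window_eq_Icc (a b : ℕ) : window (a : ℕ∞) (b : ℕ∞) = ↑(Finset.Icc (-(a : ℤ)) b) := by
  ext j
  simp only [window, Set.mem_ofPred_eq, Nat.cast_le, Finset.coe_Icc, Set.mem_Icc]
  omega

theorem tendsto_tsum_window (f : ℤ → ℝ≥0∞) :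
    Tendsto (fun p : ℕ × ℕ => ∑' j : window (p.1 : ℕ∞) (p.2 : ℕ∞), f j) atTop
      (𝓝 (∑' j : window ⊤ ⊤, f j)) := by
  rw [tsum_window_top]
  have h : Tendsto (fun p : ℕ × ℕ => Finset.Icc (-(p.1 : ℤ)) p.2) atTop atTop := by
    refine tendsto_atTop_finset_of_monotone (fun p q hpq => ?_) fun j => ⟨(j.natAbs, j.natAbs), ?_⟩
    · obtain ⟨h1, h2⟩ := hpq
      exact Finset.Icc_subset_Icc (by simpa using h1) (by simpa using h2)
    · rw [Finset.mem_Icc]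
      dsimp only
      omega
  refine (ENNReal.summable.hasSum.comp h).congr fun p => ?_
  rw [window_eq_Icc]
  exact (Finset.tsum_subtype' _ f).symm

theorem mem_window_of_natAbs_le {a b : ℕ} {j : ℤ} (ha : j.natAbs ≤ a) (hb : j.natAbs ≤ b) :
    j ∈ window (a : ℕ∞) (b : ℕ∞) := by
  simp only [window, Set.mem_ofPred_eq, Nat.cast_le]
  omega

theorem ind_avoids_noReturn_eventually_eq (ω : Sample d) :
    ∀ᶠ p : ℕ × ℕ in atTop, ind (Avoids ω p.1 p.2) * ind (NoReturn ω p.2)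
      = ind (Avoids ω ⊤ ⊤) * ind (NoReturn ω ⊤) := by
  simp only [← ind_and]
  by_cases h : Avoids ω ⊤ ⊤ ∧ NoReturn ω ⊤
  · refine Eventually.of_forall fun p => ?_
    rw [ind_of h, ind_of ⟨h.1.mono_right (Set.image_mono (by simp [window_top])),
      fun k hk _ => h.2 k hk le_top⟩]
  · rw [ind_of_not h]
    by_cases hA : Avoids ω ⊤ ⊤
    · obtain ⟨k, hk, hX⟩ : ∃ k : ℕ, 1 ≤ k ∧ X ω k = 0 := by
        by_contra hcon
        push Not at hcon
        exact h ⟨hA, fun k hk _ => hcon k hk⟩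
      filter_upwards [eventually_ge_atTop (0, k)] with p hp
      exact ind_of_not fun hp' => hp'.2 k hk (Nat.cast_le.2 hp.2) hX
    · obtain ⟨x, hx, j, -, rfl⟩ := Set.not_disjoint_iff.1 hA
      filter_upwards [eventually_ge_atTop (j.natAbs, j.natAbs)] with p hp
      exact ind_of_not fun hp' => Set.disjoint_left.1 hp'.1 hx
        ⟨j, mem_window_of_natAbs_le hp.1 hp.2, rfl⟩

variable [NeZero d] (μ : PMF ℕ) (hμ : ∑' i : ℕ, (i : ℝ≥0∞) * μ i = 1)

/-- Dominated convergence over the finite windows, whose averages over `a + b = m` are equal to one. -/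
theorem windowMean_top_eq_one {l : TreeData d → Site d → Site d → ℝ≥0∞}
    (hl : ∀ x y, Measurable fun τ => l τ x y)
    (hadd : ∀ τ x y z, l τ (x + z) (y + z) = l τ x y)
    (hsum : ∀ (K : Finset (Site d)), ∀ y ∈ K, ∑ x ∈ K, avoidMean μ hμ l K x y = 1)
    (hfin : ∫⁻ ω, ∑' j : window ⊤ ⊤, l ω.1 0 (X ω j) ∂(law d μ hμ) ≠ ∞) :
    windowMean μ hμ l ⊤ ⊤ = 1 := by
  have hind : ∀ (ω : Sample d) (a b : ℕ∞), ind (Avoids ω a b) * ind (NoReturn ω b) ≤ 1 :=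
    fun ω a b => mul_le_one' (ind_le_one _) (ind_le_one _)
  have hmono : ∀ (ω : Sample d) (a b : ℕ∞), ∑' j : window a b, l ω.1 0 (X ω j)
      ≤ ∑' j : window ⊤ ⊤, l ω.1 0 (X ω j) := fun ω a b => by
    rw [tsum_window_top fun j => l ω.1 0 (X ω j)]
    exact ENNReal.tsum_comp_le_tsum_of_injective Subtype.val_injective _
  have hle : ∀ (ω : Sample d) (a b : ℕ∞), ind (Avoids ω a b) * ind (NoReturn ω b)
      * ∑' j : window a b, l ω.1 0 (X ω j) ≤ ∑' j : window ⊤ ⊤, l ω.1 0 (X ω j) := fun ω a b =>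
    (mul_le_mul' (hind ω a b) (hmono ω a b)).trans (one_mul _).le
  have hbound : ∀ a b : ℕ∞, windowMean μ hμ l a b
      ≤ ∫⁻ ω, ∑' j : window ⊤ ⊤, l ω.1 0 (X ω j) ∂(law d μ hμ) := fun a b =>
    lintegral_mono fun ω => hle ω a b
  have hne : ∀ a b : ℕ∞, windowMean μ hμ l a b ≠ ∞ := fun a b =>
    ne_top_of_le_ne_top hfin (hbound a b)
  have hlim : Tendsto (fun p : ℕ × ℕ => windowMean μ hμ l p.1 p.2) atTop
      (𝓝 (windowMean μ hμ l ⊤ ⊤)) := by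
    refine tendsto_lintegral_filter_of_dominated_convergence _
      (Eventually.of_forall fun p => measurable_windowIntegrand hl _ _)
      (Eventually.of_forall fun p => Eventually.of_forall fun ω => hle ω _ _) hfin
      (Eventually.of_forall fun ω => ?_)
    have h1 := tendsto_tsum_window fun j => l ω.1 0 (X ω j)
    have h2 := ENNReal.Tendsto.const_mul (a := ind (Avoids ω ⊤ ⊤) * ind (NoReturn ω ⊤)) h1
      (Or.inr (ne_top_of_le_ne_top ENNReal.one_ne_top (hind ω ⊤ ⊤)))
    refine h2.congr' ?_
    filter_upwards [ind_avoids_noReturn_eventually_eq ω] with p hp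
    rw [hp]
  have h1 : (windowMean μ hμ l ⊤ ⊤).toReal = 1 := by
    set C := (∫⁻ ω, ∑' j : window ⊤ ⊤, l ω.1 0 (X ω j) ∂(law d μ hμ)).toReal
    have hC : ∀ a b : ℕ∞, (windowMean μ hμ l a b).toReal ≤ C := fun a b =>
      ENNReal.toReal_mono hfin (hbound a b)
    refine eq_one_of_tendsto_of_sum_antidiagonal (C := C)
      (φ := fun p : ℕ × ℕ => (windowMean μ hμ l p.1 p.2).toReal) (fun p => ?_)
      ((ENNReal.tendsto_toReal (hne ⊤ ⊤)).comp hlim) fun m => ?_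
    · rw [abs_le]
      constructor <;> linarith [hC p.1 p.2, hC ⊤ ⊤,
        (ENNReal.toReal_nonneg : 0 ≤ (windowMean μ hμ l p.1 p.2).toReal),
        (ENNReal.toReal_nonneg : 0 ≤ (windowMean μ hμ l ⊤ ⊤).toReal)]
    · rw [← ENNReal.toReal_sum fun p _ => hne _ _, sum_windowMean μ hμ hl hadd hsum,
        ENNReal.toReal_add (ENNReal.natCast_ne_top m) ENNReal.one_ne_top]
      simp
  rw [← ENNReal.ofReal_toReal (hne ⊤ ⊤), h1, ENNReal.ofReal_one]

end Infinite

end LawlerTree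

end

theorem lemma2p6 (d : ℕ) [NeZero d] (hd : 5 ≤ d)
    (μ : PMF ℕ) (hμ : ∑' i : ℕ, (i : ℝ≥0∞) * μ i = 1)
    (hvar_pos : 0 < evariance (fun i : ℕ => (i : ℝ)) μ.toMeasure)
    (hvar_fin : evariance (fun i : ℕ => (i : ℝ)) μ.toMeasure < ∞) :
    (∀ n : ℕ, 1 ≤ n →
      (∫⁻ q : LawlerTree.Sample d × ℕ × ℕ,
          LawlerTree.ind (LawlerTree.Avoids q.1 q.2.1 q.2.2)
            * LawlerTree.ind (LawlerTree.NoReturn q.1 q.2.2)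
            * LawlerTree.L q.1 q.2.1 q.2.2
          ∂(LawlerTree.lawN d μ hμ n) = 1)
      ∧ (∀ᵐ q ∂(LawlerTree.lawN d μ hμ n),
          LawlerTree.Z q.1 q.2.1 q.2.2 ≤ LawlerTree.U q.1 q.2.1 q.2.2
            ∧ LawlerTree.U q.1 q.2.1 q.2.2 < ∞)
      ∧ (∫⁻ q : LawlerTree.Sample d × ℕ × ℕ,
          LawlerTree.ind (LawlerTree.Avoids q.1 q.2.1 q.2.2)
            * LawlerTree.ind (LawlerTree.NoReturn q.1 q.2.2)
            * (LawlerTree.N q.1 q.2.1 q.2.2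
                + (LawlerTree.U q.1 q.2.1 q.2.2 - LawlerTree.Z q.1 q.2.1 q.2.2))
          ∂(LawlerTree.lawN d μ hμ n) = 1))
    ∧ (7 ≤ d →
      (∀ᵐ ω ∂(LawlerTree.law d μ hμ),
          LawlerTree.Z ω ⊤ ⊤ ≤ LawlerTree.U ω ⊤ ⊤ ∧ LawlerTree.U ω ⊤ ⊤ < ∞)
      ∧ (∫⁻ ω : LawlerTree.Sample d,
          LawlerTree.ind (LawlerTree.Avoids ω ⊤ ⊤)
            * LawlerTree.ind (LawlerTree.NoReturn ω ⊤)
            * (LawlerTree.N ω ⊤ ⊤ + (LawlerTree.U ω ⊤ ⊤ - LawlerTree.Z ω ⊤ ⊤))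
          ∂(LawlerTree.law d μ hμ) = 1)) := by
  have hC := LawlerTree.rightMean_ne_top μ hμ hvar_fin
  have hsum : ∀ (K : Finset (LawlerTree.Site d)), ∀ y ∈ K, ∑ x ∈ K,
      LawlerTree.avoidMean μ hμ (fun τ => τ.meanFutureLocalTime) K x y = 1 := fun K y hy =>
    LawlerTree.sum_lintegral_avoid_meanFutureLocalTime μ hμ hd hC hy
  refine ⟨fun n hn => ?_, fun hd7 => ?_⟩
  · have hU := LawlerTree.ae_lawN μ hμ n (LawlerTree.ae_U_lt_top (d := d) μ hμ hd hC)
    refine ⟨?_, ?_, ?_⟩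
    · exact LawlerTree.lintegral_lawN_window_eq_one μ hμ hn
        LawlerTree.TreeData.measurable_futureLocalTime LawlerTree.TreeData.futureLocalTime_add
        fun K y hy => LawlerTree.sum_lintegral_avoid_futureLocalTime μ hμ hd hC hy
    · filter_upwards [hU] with q hq
      exact ⟨LawlerTree.Z_le_U _ _ _, hq _ _⟩
    · refine Eq.trans (lintegral_congr_ae ?_) (LawlerTree.lintegral_lawN_window_eq_one μ hμ hn
        LawlerTree.TreeData.measurable_meanFutureLocalTime
        LawlerTree.TreeData.meanFutureLocalTime_add hsum)
      filter_upwards [hU] with q hq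
      rw [LawlerTree.N_add_U_sub_Z _ _ _ (hq _ _)]
  · have hfinU := LawlerTree.lintegral_U_top_ne_top (d := d) μ hμ hd7 hC
    have hU : ∀ᵐ ω ∂(LawlerTree.law d μ hμ), LawlerTree.U ω ⊤ ⊤ < ∞ :=
      ae_lt_top (LawlerTree.measurable_U ⊤ ⊤) hfinU
    have hN : ∀ᵐ ω ∂(LawlerTree.law d μ hμ), LawlerTree.N ω ⊤ ⊤
        + (LawlerTree.U ω ⊤ ⊤ - LawlerTree.Z ω ⊤ ⊤)
        = ∑' j : LawlerTree.window ⊤ ⊤, ω.1.meanFutureLocalTime 0 (LawlerTree.X ω j) := by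
      filter_upwards [hU] with ω hω
      exact LawlerTree.N_add_U_sub_Z _ _ _ hω
    refine ⟨?_, ?_⟩
    · filter_upwards [hU] with ω hω
      exact ⟨LawlerTree.Z_le_U _ _ _, hω⟩
    · refine Eq.trans (lintegral_congr_ae ?_) (LawlerTree.windowMean_top_eq_one μ hμ
        LawlerTree.TreeData.measurable_meanFutureLocalTime
        LawlerTree.TreeData.meanFutureLocalTime_add hsum ?_)
      · filter_upwards [hN] with ω hω
        rw [hω]
      · rw [← lintegral_congr_ae hN]
        refine ne_top_of_le_ne_top (ENNReal.add_ne_top.2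
          ⟨LawlerTree.lintegral_N_top_ne_top (d := d) μ hμ hd, hfinU⟩) ?_
        rw [← lintegral_add_right _ (LawlerTree.measurable_U ⊤ ⊤)]
        exact lintegral_mono fun ω => by gcongr; exact tsub_le_self
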